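/- **Setting.** There are $n\ge 1$ agents. Agent $i$ has sample losses $f_i(x,y;\xi)$ and $g_i(x,y;\xi)$ on $\mathbb R^{d_x}\times\mathbb R^{d_y}$, differentiable in $(x,y)$. Put $f_i(x,y)=\mathbb E f_i(x,y;\xi_{f,i})$, $g_i(x,y)=\mathbb E g_i(x,y;\xi_{g,i})$, $F=\frac1n\sum_i f_i$, $G=\frac1n\sum_i g_i$. For $\gamma,\mu>0$ let $$V_\gamma(x,y)=\min_\theta\Big\{G(x,\theta)+\tfrac1{2\gamma}\|\theta-y\|^2\Big\},\qquad \Psi_\mu=\mu F+G-V_\gamma,$$ and let $\theta^*_\gamma(x,y)$ be the minimizer. *Assumptions.* - $F\ge \underline F$. Every $f_i$ is $C^1$ with $L_1$-Lipschitz gradient and every $g_i$ is $C^1$ with $L_2$-Lipschitz gradient in $(x,y)$ ($L_1\ge0$, $L_2>0$). - The sample gradients $\nabla f_i(x,y;\xi_{f,i})$ and $\nabla g_i(x,y;\xi_{g,i})$ are unbiased estimators of $\nabla f_i(x,y)$ and $\nabla g_i(x,y)$ with variances at most $\delta_f^2$ and $\delta_g^2$. In iteration $k$ agent $i$ draws a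 pair $(\xi_{f,i}^k,\xi_{g,i}^k)$; these pairs are independent over all $i$ and $k$, and the laws of $\xi_{f,i}^k$ and of $\xi_{g,i}^k$ do not depend on $k$. - $W=(w_{ij})\in\mathbb R^{n\times n}$ is nonnegative, symmetric and doubly stochastic with eigenvalues $1=\lambda_1>\lambda_2\ge\dots\ge\lambda_n$ and $\rho=\max\{|\lambda_2|,|\lambda_n|\}<1$ ($\rho=0$ if $n=1$). No assumption on gradient heterogeneity is made. *Algorithm (SUN-DSBO-GT).* The initial points $\theta_i^0,x_i^0,y_i^0$ are deterministic and $D^{-1}_{\Diamond,i}=\hat D^{-1}_{\Diamond,i}=0$ for $\Diamond\in\{\theta,x,y\}$. For $k=0,\dots,K-1$, $$\hat D^k_{\theta,i}=\nabla_y g_i(x_i^k,\theta_i^k;\xi^k_{g,i})+\tfrac1\gamma(\theta_i^k-y_i^k),$$ $$\hat D^k_{x,i}=\mu_k\nabla_x f_i(x_i^k,y_i^k;\xi^k_{f,i})+\nabla_x g_i(x_i^k,y_i^k;\xi^k_{g,i})-\nabla_x g_i(x_i^k,\theta_i^k;\xi^k_{g,i}),$$ $$\hat D^k_{y,i}=\mu_k\nabla_y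 f_i(x_i^k,y_i^k;\xi^k_{f,i})+\nabla_y g_i(x_i^k,y_i^k;\xi^k_{g,i})-\tfrac1\gamma(y_i^k-\theta_i^k),$$ $$D^k_{\Diamond,i}=\sum_j w_{ij}\big(D^{k-1}_{\Diamond,j}+\hat D^k_{\Diamond,j}-\hat D^{k-1}_{\Diamond,j}\big),\qquad \Diamond_i^{k+1}=\sum_j w_{ij}\big(\Diamond_j^k-\lambda_\Diamond D^k_{\Diamond,j}\big).$$ Here $\mu_k=\mu_0(k+1)^{-p}$ with $\mu_0>0$, $p\in[0,1/4)$; $\gamma\in(0,\frac1{2L_2})$; $\lambda_\theta=c_\theta n^{1/2}K^{-1/2}$ and $\lambda_x=\lambda_y=c_\lambda\lambda_\theta$ with $c_\theta,c_\lambda>0$. Bars denote averages over the agents, and $\operatorname{disp}(v)=\frac1n\sum_i\|v_i-\bar v\|^2$. Put $$\Delta^k=\mathbb E\big[\operatorname{disp}(x^k)+\operatorname{disp}(y^k)+\operatorname{disp}(\theta^k)\big].$$ *Constants.* Let $\eta=\frac1\gamma-L_2$, $L_\theta=\frac1\eta\sqrt{L_2^2+\gamma^{-2}}$, $a_1=\frac1{2L_\theta}\sqrt{L_2^2+\gamma^{-2}}$,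 $$\tau_2=2\,\frac{3(\mu_0^2L_1^2+2L_2^2)c_\lambda+4(\mu_0^2L_1^2+L_2^2)c_\lambda+\frac{12a_1}{\eta}L_2^2}{c_\lambda(1-\rho)},$$ $$\tau_3=2\,\frac{3(\mu_0^2L_1^2+L_2^2)c_\lambda+4(\mu_0^2L_1^2+L_2^2+\gamma^{-2})c_\lambda+\frac{12a_1}{\eta}\gamma^{-2}}{c_\lambda(1-\rho)},$$ $$\tau_4=2\,\frac{3L_2^2c_\lambda+4\gamma^{-2}c_\lambda+\frac{12a_1}{\eta}(L_2^2+\gamma^{-2})}{c_\lambda(1-\rho)},\qquad \tau_{j+3}=\frac{\tau_j}{(1-\rho)^2}\ (j=2,3,4),$$ $$M_4=4a_1+6c_\lambda^2\Big(\tfrac12\big(\mu_0L_1+L_2+\max\{L_2,\tfrac1\gamma\}\big)+4a_1L_\theta^2\Big).$$ With $\Phi^0=\mu_0\big(F(\bar x^0,\bar y^0)-\underline F\big)+G(\bar x^0,\bar y^0)-V_\gamma(\bar x^0,\bar y^0)$ and $e^0=\|\bar\theta^0-\theta^*_\gamma(\bar x^0,\bar y^0)\|^2$ put $$\mathcal L^0=\Phi^0+a_1e^0+\tau_2\lambda_x\operatorname{disp}(x^0)+\tau_3\lambda_y\operatorname{disp}(y^0)+\tau_4\lambda_\theta\operatorname{disp}(\theta^0)+\tau_5\lambda_x^2\,\mathbb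 E\operatorname{disp}(D_x^0)+\tau_6\lambda_y^2\,\mathbb E\operatorname{disp}(D_y^0)+\tau_7\lambda_\theta^2\,\mathbb E\operatorname{disp}(D_\theta^0),$$ $$\mathcal C_2=\mathcal L^0+M_4(\mu_0\delta_f^2+2\delta_g^2).$$ **Theorem (convergence rate of SUN-DSBO-GT).** Let $c_\lambda\le\frac{\eta}{32a_1L_\theta^2}$. There is $\kappa>0$, depending only on $L_1,L_2,\gamma,\mu_0,c_\lambda$, and for all $p\in[0,1/4)$ and $c_\theta>0$ there is $C>0$, depending only on $L_1,L_2,\gamma,\mu_0,c_\lambda,p,c_\theta$, such that for every problem, network and run as above (all $n$, $d_x$, $d_y$, $\rho$, $\delta_f$, $\delta_g$, $\underline F$, initial points, and all $K\ge1$) whose learning rate satisfies $\lambda_\theta\le\kappa(1-\rho)^4$: 1. $\theta^*_\gamma(x,y)$ is the unique minimizer and is an $L_\theta$-Lipschitz function of $(x,y)$, every $\Psi_{\mu_k}$ is differentiable, and the expectations below are finite; 2. $\displaystyle\frac1K\sum_{k=0}^{K-1}\mathbb E\|\nabla\Psi_{\mu_k}(\bar x^k,\bar y^k)\|^2\le C\,\frac{\mathcal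 C_2}{n^{1/2}K^{1/2}}+C\,\frac{n(\delta_f^2+\delta_g^2)}{(1-\rho)^4K}$; 3. $\displaystyle\frac1K\sum_{k=0}^{K-1}\Delta^k\le C\,\frac{\mathcal C_2}{K^{1/2}}+C\,\frac{n^{3/2}(\delta_f^2+\delta_g^2)}{(1-\rho)^4K}$; 4. $\mathcal C_2$ is bounded independently of $n$ and $1-\rho$ in terms of the initial data and the variances: $\mathcal C_2\le C\,(\mathcal I^0+\delta_f^2+\delta_g^2)$, where $\mathcal I^0=\Phi^0+e^0+\Delta^0+\operatorname{disp}(\tilde D_x^0)+\operatorname{disp}(\tilde D_y^0)+\operatorname{disp}(\tilde D_\theta^0)$ and $\tilde D^0_{\Diamond,i}$ is $\hat D^0_{\Diamond,i}$ with the sample gradients replaced by the exact gradients. -/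

import Mathlib

open MeasureTheory ProbabilityTheory
open scoped Gradient

noncomputable section

namespace SunDSBO

/-! ### Spaces, averages -/

/-- `ℝᵈ` with the Euclidean norm. -/
abbrev Vec (d : ℕ) := EuclideanSpace ℝ (Fin d)

/-- `ℝ^{dx} × ℝ^{dy}` with the Euclidean norm. -/
abbrev Pair (dx dy : ℕ) := WithLp 2 (Vec dx × Vec dy)

/-- The point `(x, y)`. -/
abbrev pt {dx dy : ℕ} (x : Vec dx) (y : Vec dy) : Pair dx dy := WithLp.toLp 2 (x, y)

/-- Average over the agents. -/
def avg {n d : ℕ} (v : Fin n → Vec d) : Vec d := (n : ℝ)⁻¹ • ∑ i, v i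

/-- Mean squared deviation from the average over the agents. -/
def disp {n d : ℕ} (v : Fin n → Vec d) : ℝ := (n : ℝ)⁻¹ * ∑ i, ‖v i - avg v‖ ^ 2

/-! ### The bilevel problem -/

/-- The data of a decentralized stochastic bilevel problem with `n` agents: sample losses
`f_i(z; ξ)`, `g_i(z; ξ)` and the distributions of the samples of each agent. -/
structure Problem (n dx dy : ℕ) (Ξf Ξg : Type*) [MeasurableSpace Ξf] [MeasurableSpace Ξg] where
  lossF : Fin n → Pair dx dy → Ξf → ℝ
  lossG : Fin n → Pair dx dy → Ξg → ℝ
  distF : Fin n → Measure Ξf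
  distG : Fin n → Measure Ξg

section Objectives

variable {n dx dy : ℕ} {Ξf Ξg : Type*} [MeasurableSpace Ξf] [MeasurableSpace Ξg]

/-- Local upper-level objective `f_i(z) = E f_i(z; ξ)`. -/
def Problem.f (pb : Problem n dx dy Ξf Ξg) (i : Fin n) (z : Pair dx dy) : ℝ :=
  ∫ ξ, pb.lossF i z ξ ∂(pb.distF i)

/-- Local lower-level objective `g_i(z) = E g_i(z; ξ)`. -/
def Problem.g (pb : Problem n dx dy Ξf Ξg) (i : Fin n) (z : Pair dx dy) : ℝ :=
  ∫ ξ, pb.lossG i z ξ ∂(pb.distG i)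

/-- Global upper-level objective. -/
def Problem.F (pb : Problem n dx dy Ξf Ξg) (z : Pair dx dy) : ℝ := (n : ℝ)⁻¹ * ∑ i, pb.f i z

/-- Global lower-level objective. -/
def Problem.G (pb : Problem n dx dy Ξf Ξg) (z : Pair dx dy) : ℝ := (n : ℝ)⁻¹ * ∑ i, pb.g i z

/-- The function `θ ↦ G(x, θ) + ‖θ - y‖² / (2γ)` for `z = (x, y)`. -/
def Problem.envObj (pb : Problem n dx dy Ξf Ξg) (γ : ℝ) (z : Pair dx dy) (θ : Vec dy) : ℝ :=
  pb.G (pt z.fst θ) + 1 / (2 * γ) * ‖θ - z.snd‖ ^ 2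

/-- Moreau envelope `V_γ` of `G` in its second variable. -/
def Problem.V (pb : Problem n dx dy Ξf Ξg) (γ : ℝ) (z : Pair dx dy) : ℝ :=
  ⨅ θ, pb.envObj γ z θ

/-- The minimizer `θ*_γ(x, y)` in the definition of the Moreau envelope. -/
def Problem.thetaStar (pb : Problem n dx dy Ξf Ξg) (γ : ℝ) (z : Pair dx dy) : Vec dy :=
  Classical.epsilon fun θ => IsMinOn (pb.envObj γ z) Set.univ θ

/-- The penalty function `Ψ_μ = μ F + G - V_γ`. -/
def Problem.Psi (pb : Problem n dx dy Ξf Ξg) (γ μ : ℝ) (z : Pair dx dy) : ℝ :=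
  μ * pb.F z + pb.G z - pb.V γ z

/-! ### Assumptions -/

/-- Each `f_i` (resp. `g_i`) is continuously differentiable with `L₁`- (resp. `L₂`-) Lipschitz
gradient. -/
structure Smooth (pb : Problem n dx dy Ξf Ξg) (L₁ L₂ : ℝ) : Prop where
  contDiff_f : ∀ i, ContDiff ℝ 1 (pb.f i)
  contDiff_g : ∀ i, ContDiff ℝ 1 (pb.g i)
  lip_f : ∀ i z z', ‖∇ (pb.f i) z - ∇ (pb.f i) z'‖ ≤ L₁ * ‖z - z'‖
  lip_g : ∀ i z z', ‖∇ (pb.g i) z - ∇ (pb.g i) z'‖ ≤ L₂ * ‖z - z'‖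

/-- One stochastic gradient oracle: the sample gradient `∇ℓ(z; ξ)`, `ξ ∼ D`, is an unbiased
estimator of the gradient of `z ↦ E ℓ(z; ξ)` with variance at most `δ²`. -/
structure IsOracle {Ξ : Type*} [MeasurableSpace Ξ] (loss : Pair dx dy → Ξ → ℝ)
    (D : Measure Ξ) (δ : ℝ) : Prop where
  prob : IsProbabilityMeasure D
  integrable_loss : ∀ z, Integrable (loss z) D
  differentiable : ∀ ξ, Differentiable ℝ fun z => loss z ξ
  measurable_grad : Measurable fun q : Pair dx dy × Ξ => ∇ (fun z => loss z q.2) q.1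
  integrable_grad : ∀ z, Integrable (fun ξ => ∇ (fun z' => loss z' ξ) z) D
  unbiased : ∀ z, ∫ ξ, ∇ (fun z' => loss z' ξ) z ∂D = ∇ (fun z' => ∫ ξ, loss z' ξ ∂D) z
  integrable_sq : ∀ z, Integrable
    (fun ξ => ‖∇ (fun z' => ∫ ξ', loss z' ξ' ∂D) z - ∇ (fun z' => loss z' ξ) z‖ ^ 2) D
  variance_le : ∀ z,
    ∫ ξ, ‖∇ (fun z' => ∫ ξ', loss z' ξ' ∂D) z - ∇ (fun z' => loss z' ξ) z‖ ^ 2 ∂D ≤ δ ^ 2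

/-- The sampling of the algorithm: agent `i` draws `ξ_{f,i}^k ∼ distF i` and
`ξ_{g,i}^k ∼ distG i` in iteration `k`, independently over agents and iterations. -/
structure IsSampling (pb : Problem n dx dy Ξf Ξg) {Ω : Type*} [MeasurableSpace Ω] (P : Measure Ω)
    (ξf : Fin n → ℕ → Ω → Ξf) (ξg : Fin n → ℕ → Ω → Ξg) : Prop where
  measurable_f : ∀ i k, Measurable (ξf i k)
  measurable_g : ∀ i k, Measurable (ξg i k)
  law_f : ∀ i k, P.map (ξf i k) = pb.distF i
  law_g : ∀ i k, P.map (ξg i k) = pb.distG i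
  indep : iIndepFun (fun (q : Fin n × ℕ) ω => (ξf q.1 q.2 ω, ξg q.1 q.2 ω)) P

end Objectives

/-- The eigenvalue `λ_{j+1}` of a symmetric `n × n` matrix (`j < n`), the eigenvalues being listed
with multiplicity in decreasing order `λ_1 ≥ ⋯ ≥ λ_n`. -/
def eig {n : ℕ} {W : Matrix (Fin n) (Fin n) ℝ} (hW : W.IsHermitian) (j : ℕ) : ℝ :=
  if h : j < Fintype.card (Fin n) then hW.eigenvalues₀ ⟨j, h⟩ else 0

/-- The connectivity parameter `max {|λ_2|, |λ_n|}`; it is `0` for a single agent. -/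
def connectivity {n : ℕ} {W : Matrix (Fin n) (Fin n) ℝ} (hW : W.IsHermitian) : ℝ :=
  if 2 ≤ n then max |eig hW 1| |eig hW (n - 1)| else 0

/-- `W` is a nonnegative, symmetric, doubly stochastic matrix with `1 = λ_1 > λ_2`, whose
connectivity parameter is `ρ < 1`. -/
structure IsMixing {n : ℕ} (W : Matrix (Fin n) (Fin n) ℝ) (ρ : ℝ) : Prop where
  nonneg : ∀ i j, 0 ≤ W i j
  symm : W.IsHermitian
  row_sum : ∀ i, ∑ j, W i j = 1
  col_sum : ∀ j, ∑ i, W i j = 1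
  eig_one : eig symm 0 = 1
  eig_two : 2 ≤ n → eig symm 1 < 1
  rho_eq : ρ = connectivity symm
  rho_lt : ρ < 1

/-! ### The algorithm SUN-DSBO-GT -/

section Directions

variable {dx dy : ℕ}

/-- `∇_y g(x, θ) + (θ - y) / γ`, where `g'` stands for the gradient of `g`. -/
def dirθ (γ : ℝ) (g' : Pair dx dy → Pair dx dy) (x : Vec dx) (y θ : Vec dy) : Vec dy :=
  (g' (pt x θ)).snd + (1 / γ) • (θ - y)

/-- `μ ∇_x f(x, y) + ∇_x g(x, y) - ∇_x g(x, θ)`. -/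
def dirx (μ : ℝ) (f' g' : Pair dx dy → Pair dx dy) (x : Vec dx) (y θ : Vec dy) : Vec dx :=
  μ • (f' (pt x y)).fst + (g' (pt x y)).fst - (g' (pt x θ)).fst

/-- `μ ∇_y f(x, y) + ∇_y g(x, y) - (y - θ) / γ`. -/
def diry (γ μ : ℝ) (f' g' : Pair dx dy → Pair dx dy) (x : Vec dx) (y θ : Vec dy) : Vec dy :=
  μ • (f' (pt x y)).snd + (g' (pt x y)).snd - (1 / γ) • (y - θ)

end Directions

/-- The input of the algorithm. -/
structure Input (n dx dy : ℕ) where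
  W : Matrix (Fin n) (Fin n) ℝ
  γ : ℝ
  μ : ℕ → ℝ
  lamθ : ℕ → ℝ
  lamx : ℕ → ℝ
  lamy : ℕ → ℝ
  θ₀ : Fin n → Vec dy
  x₀ : Fin n → Vec dx
  y₀ : Fin n → Vec dy

/-- The state of all agents at the beginning of iteration `k`: the iterates `θ^k, x^k, y^k`, the
trackers `D^{k-1}` and the stochastic directions `D̂^{k-1}` of the previous iteration. -/
structure State (n dx dy : ℕ) where
  θ : Fin n → Vec dy
  x : Fin n → Vec dx
  y : Fin n → Vec dy
  Dθ : Fin n → Vec dy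
  Dx : Fin n → Vec dx
  Dy : Fin n → Vec dy
  Hθ : Fin n → Vec dy
  Hx : Fin n → Vec dx
  Hy : Fin n → Vec dy

/-- The gradient tracking update `D_i^k = ∑_j w_ij (D_j^{k-1} + D̂_j^k - D̂_j^{k-1})`. -/
def track {n d : ℕ} (W : Matrix (Fin n) (Fin n) ℝ) (Dprev Hnew Hprev : Fin n → Vec d)
    (i : Fin n) : Vec d :=
  ∑ j, W i j • (Dprev j + Hnew j - Hprev j)

/-- The variable update `v_i^{k+1} = ∑_j w_ij (v_j^k - lam D_j^k)`. -/
def mix {n d : ℕ} (W : Matrix (Fin n) (Fin n) ℝ) (lam : ℝ) (v D : Fin n → Vec d)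
    (i : Fin n) : Vec d :=
  ∑ j, W i j • (v j - lam • D j)

section Algorithm

variable {n dx dy : ℕ} {Ξf Ξg : Type*} [MeasurableSpace Ξf] [MeasurableSpace Ξg]

/-- Iteration `k`, in which agent `i` uses the samples `ξf i`, `ξg i`. -/
def step (pb : Problem n dx dy Ξf Ξg) (I : Input n dx dy) (k : ℕ) (ξf : Fin n → Ξf)
    (ξg : Fin n → Ξg) (s : State n dx dy) : State n dx dy :=
  let f' := fun i => ∇ (fun z => pb.lossF i z (ξf i))
  let g' := fun i => ∇ (fun z => pb.lossG i z (ξg i))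
  let Hθ := fun i => dirθ I.γ (g' i) (s.x i) (s.y i) (s.θ i)
  let Hx := fun i => dirx (I.μ k) (f' i) (g' i) (s.x i) (s.y i) (s.θ i)
  let Hy := fun i => diry I.γ (I.μ k) (f' i) (g' i) (s.x i) (s.y i) (s.θ i)
  let Dθ := track I.W s.Dθ Hθ s.Hθ
  let Dx := track I.W s.Dx Hx s.Hx
  let Dy := track I.W s.Dy Hy s.Hy
  { θ := mix I.W (I.lamθ k) s.θ Dθ
    x := mix I.W (I.lamx k) s.x Dx
    y := mix I.W (I.lamy k) s.y Dy
    Dθ := Dθ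
    Dx := Dx
    Dy := Dy
    Hθ := Hθ
    Hx := Hx
    Hy := Hy }

/-- The state at the beginning of iteration `k` of SUN-DSBO-GT, run with the samples `ξf`, `ξg`. -/
def run (pb : Problem n dx dy Ξf Ξg) (I : Input n dx dy) (ξf : Fin n → ℕ → Ξf)
    (ξg : Fin n → ℕ → Ξg) : ℕ → State n dx dy
  | 0 =>
    { θ := I.θ₀
      x := I.x₀
      y := I.y₀
      Dθ := 0
      Dx := 0
      Dy := 0
      Hθ := 0
      Hx := 0
      Hy := 0 }
  | k + 1 => step pb I k (fun i => ξf i k) (fun i => ξg i k) (run pb I ξf ξg k)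

/-- The penalty parameters `μ_k = μ₀ (k+1)^{-p}` and the constant learning rates
`λ_θ = c_θ n^{1/2} K^{-1/2}`, `λ_x = λ_y = c_λ λ_θ` for a run of `K` iterations. -/
def input (W : Matrix (Fin n) (Fin n) ℝ) (γ μ₀ p cθ cl : ℝ) (K : ℕ) (θ₀ : Fin n → Vec dy)
    (x₀ : Fin n → Vec dx) (y₀ : Fin n → Vec dy) : Input n dx dy where
  W := W
  γ := γ
  μ := fun k => μ₀ * ((k : ℝ) + 1) ^ (-p)
  lamθ := fun _ => cθ * √n / √K
  lamx := fun _ => cl * (cθ * √n / √K)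
  lamy := fun _ => cl * (cθ * √n / √K)
  θ₀ := θ₀
  x₀ := x₀
  y₀ := y₀

variable {Ω : Type*}

/-- The random state at the beginning of iteration `k`. -/
def iter (pb : Problem n dx dy Ξf Ξg) (I : Input n dx dy) (ξf : Fin n → ℕ → Ω → Ξf)
    (ξg : Fin n → ℕ → Ω → Ξg) (k : ℕ) (ω : Ω) : State n dx dy :=
  run pb I (fun i j => ξf i j ω) (fun i j => ξg i j ω) k

/-- `‖∇Ψ_{μ_k}(x̄^k, ȳ^k)‖²`. -/
def gradSq (pb : Problem n dx dy Ξf Ξg) (I : Input n dx dy) (ξf : Fin n → ℕ → Ω → Ξf)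
    (ξg : Fin n → ℕ → Ω → Ξg) (k : ℕ) (ω : Ω) : ℝ :=
  ‖∇ (pb.Psi I.γ (I.μ k))
    (pt (avg (iter pb I ξf ξg k ω).x) (avg (iter pb I ξf ξg k ω).y))‖ ^ 2

/-- The consensus error of iteration `k`, before taking the expectation. -/
def consSq (pb : Problem n dx dy Ξf Ξg) (I : Input n dx dy) (ξf : Fin n → ℕ → Ω → Ξf)
    (ξg : Fin n → ℕ → Ω → Ξg) (k : ℕ) (ω : Ω) : ℝ :=
  disp (iter pb I ξf ξg k ω).x + disp (iter pb I ξf ξg k ω).y + disp (iter pb I ξf ξg k ω).θ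

end Algorithm

/-! ### The constants -/

/-- `η = 1/γ - L₂`. -/
def eta (L₂ γ : ℝ) : ℝ := 1 / γ - L₂

/-- A Lipschitz constant of `θ*_γ`. -/
def Lθ (L₂ γ : ℝ) : ℝ := √(L₂ ^ 2 + 1 / γ ^ 2) / eta L₂ γ

def a1 (L₂ γ : ℝ) : ℝ := 1 / (2 * Lθ L₂ γ) * √(L₂ ^ 2 + 1 / γ ^ 2)

def tau2 (L₁ L₂ γ μ₀ cl ρ : ℝ) : ℝ :=
  2 * ((3 * (μ₀ ^ 2 * L₁ ^ 2 + 2 * L₂ ^ 2) * cl + 4 * (μ₀ ^ 2 * L₁ ^ 2 + L₂ ^ 2) * cl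
    + 2 * a1 L₂ γ * (6 / eta L₂ γ) * L₂ ^ 2) / (cl * (1 - ρ)))

def tau3 (L₁ L₂ γ μ₀ cl ρ : ℝ) : ℝ :=
  2 * ((3 * (μ₀ ^ 2 * L₁ ^ 2 + L₂ ^ 2) * cl + 4 * (μ₀ ^ 2 * L₁ ^ 2 + L₂ ^ 2 + 1 / γ ^ 2) * cl
    + 2 * a1 L₂ γ * (6 / eta L₂ γ) * (1 / γ ^ 2)) / (cl * (1 - ρ)))

def tau4 (L₂ γ cl ρ : ℝ) : ℝ :=
  2 * ((3 * L₂ ^ 2 * cl + 4 / γ ^ 2 * cl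
    + 2 * a1 L₂ γ * (6 / eta L₂ γ) * (L₂ ^ 2 + 1 / γ ^ 2)) / (cl * (1 - ρ)))

def M4 (L₁ L₂ γ μ₀ cl : ℝ) : ℝ :=
  4 * a1 L₂ γ
    + ((μ₀ * L₁ + L₂ + max L₂ (1 / γ)) / 2 + 4 * a1 L₂ γ * Lθ L₂ γ ^ 2) * (6 * cl ^ 2)

section Constants

variable {n dx dy : ℕ} {Ξf Ξg : Type*} [MeasurableSpace Ξf] [MeasurableSpace Ξg]
  {Ω : Type*} [MeasurableSpace Ω]

/-- `Φ_{μ₀}(x̄⁰, ȳ⁰) = μ₀ (F - F_low) + G - V_γ` at the initial average. -/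
def phi0 (pb : Problem n dx dy Ξf Ξg) (I : Input n dx dy) (Flow : ℝ) : ℝ :=
  let z₀ := pt (avg I.x₀) (avg I.y₀)
  I.μ 0 * (pb.F z₀ - Flow) + pb.G z₀ - pb.V I.γ z₀

/-- `‖θ̄⁰ - θ*_γ(x̄⁰, ȳ⁰)‖²`. -/
def lowErr0 (pb : Problem n dx dy Ξf Ξg) (I : Input n dx dy) : ℝ :=
  ‖avg I.θ₀ - pb.thetaStar I.γ (pt (avg I.x₀) (avg I.y₀))‖ ^ 2

/-- The initial value of the Lyapunov function. The trackers `D⁰` are stored in the state after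
the first iteration. -/
def lyap0 (pb : Problem n dx dy Ξf Ξg) (I : Input n dx dy) (P : Measure Ω)
    (ξf : Fin n → ℕ → Ω → Ξf) (ξg : Fin n → ℕ → Ω → Ξg) (L₁ L₂ cl ρ Flow : ℝ) : ℝ :=
  let t2 := tau2 L₁ L₂ I.γ (I.μ 0) cl ρ
  let t3 := tau3 L₁ L₂ I.γ (I.μ 0) cl ρ
  let t4 := tau4 L₂ I.γ cl ρ
  phi0 pb I Flow + a1 L₂ I.γ * lowErr0 pb I
    + t2 * I.lamx 0 * disp I.x₀ + t3 * I.lamy 0 * disp I.y₀ + t4 * I.lamθ 0 * disp I.θ₀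
    + t2 / (1 - ρ) ^ 2 * I.lamx 0 ^ 2 * ∫ ω, disp (iter pb I ξf ξg 1 ω).Dx ∂P
    + t3 / (1 - ρ) ^ 2 * I.lamy 0 ^ 2 * ∫ ω, disp (iter pb I ξf ξg 1 ω).Dy ∂P
    + t4 / (1 - ρ) ^ 2 * I.lamθ 0 ^ 2 * ∫ ω, disp (iter pb I ξf ξg 1 ω).Dθ ∂P

/-- The constant `C₂` of the convergence rate. -/
def C2 (pb : Problem n dx dy Ξf Ξg) (I : Input n dx dy) (P : Measure Ω)
    (ξf : Fin n → ℕ → Ω → Ξf) (ξg : Fin n → ℕ → Ω → Ξg) (L₁ L₂ cl ρ Flow δf δg : ℝ) : ℝ :=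
  lyap0 pb I P ξf ξg L₁ L₂ cl ρ Flow
    + M4 L₁ L₂ I.γ (I.μ 0) cl * (I.μ 0 * δf ^ 2 + 2 * δg ^ 2)

/-- The size of the initial data: the initial gap of `Φ`, the initial lower-level and consensus
errors, and the dispersion of the exact local directions at the initial points. It involves neither
the network nor the learning rates. -/
def initSize (pb : Problem n dx dy Ξf Ξg) (I : Input n dx dy) (Flow : ℝ) : ℝ :=
  phi0 pb I Flow + lowErr0 pb I + disp I.x₀ + disp I.y₀ + disp I.θ₀
    + disp (fun i => dirx (I.μ 0) (∇ (pb.f i)) (∇ (pb.g i)) (I.x₀ i) (I.y₀ i) (I.θ₀ i))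
    + disp (fun i => diry I.γ (I.μ 0) (∇ (pb.f i)) (∇ (pb.g i)) (I.x₀ i) (I.y₀ i) (I.θ₀ i))
    + disp (fun i => dirθ I.γ (∇ (pb.g i)) (I.x₀ i) (I.y₀ i) (I.θ₀ i))

end Constants

end SunDSBO

end

open SunDSBO

set_option linter.unusedSectionVars false

namespace SunDSBO

/-! ### Averages over the agents -/

section Averages

variable {n : ℕ} {E : Type*} [NormedAddCommGroup E] [InnerProductSpace ℝ E]

/-! Write u = (x, y, θ), use the single step size lam = λ_θ and move the factor c = c_λ into the
direction. The averaged iterate then takes steps `ū - lam • (drift + mean noise)`, where the drift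
differs from the exact averaged direction at ū only by a Lipschitz term in the consensus error.

Descent comes from one potential, `pot`: it adds to Ψ_μ - μ F_low the lower-level gap G(x, θ) + ‖θ -
y‖²/(2γ) - V_γ. Let ψ = ∇Ψ_μ, let w be the z-gradient of the gap and t its θ-gradient. The potential
has gradient (ψ + w, t), while the algorithm moves along (c(ψ - w), t), since it uses θ where the
exact gradient of Ψ_μ has θ*. The inner product is c(‖ψ‖² - ‖w‖²) + ‖t‖². Strong convexity in θ
gives ‖t‖ ≥ η‖θ - θ*‖, Lipschitz continuity gives ‖w‖² ≤ (L₂² + γ⁻²)‖θ - θ*‖², and the bound on c_λ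
lets the first absorb the second. Hence `Regular.pot_step_le` decreases the potential by a multiple
of ‖ψ‖² + ‖θ - θ*‖², up to consensus error and noise. The differentiability of V_γ behind this is
the envelope argument of `Smooth.quadApprox_V`. The decrease of μ_k does no harm, as the potential
is monotone in μ.

The network enters through `IsMixing.spread_gossip_add_le`: a communication round contracts
deviations from the average, so the consensus and tracking errors satisfy recursions with factor ρ.
Gradient tracking keeps the average tracker equal to the average direction. Sample independence
makes the errors of different agents orthogonal, whence the gain 1/n in
`IsRun.integral_norm_mean_noise_sq_le`.

Without a heterogeneity bound the delicate term is (μ_k - μ_{k+1}) ∇f_i in the increment of the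
tracked directions. Its dispersion is compared with that at the initial points. The displacement
from there is at most k times a sum of squared steps (`IsRun.expShift_le`), and the factor k is paid
for by (k+1)(μ_k - μ_{k+1}) ≤ μ₀, while the remaining factor is summable by telescoping
(`sum_sq_mul_le`). The initial dispersion is read off the first tracker: a linear combination of
D_x, D_y, D_θ isolates ∇f_i up to a gradient difference of g_i, which the initial consensus error
and the potential control (`Regular.sq_mul_spread_gossip_upperDir_le`).

The coupled recursions are summed and solved in the deterministic lemma `tracking_sum_le`, whose
smallness condition is lam ≤ κ(1-ρ)⁴. `IsRun.le_C2` and `IsRun.C2_le` compare its initial terms with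
C₂ and C₂ with the initial data; inserting lam = c_θ √n/√K in `rate_le` gives the rates. -/

/-- Average over the agents, in any inner product space. -/
noncomputable def mean (v : Fin n → E) : E := (n : ℝ)⁻¹ • ∑ i, v i

/-- Mean square over the agents. -/
noncomputable def meanSq (v : Fin n → E) : ℝ := (n : ℝ)⁻¹ * ∑ i, ‖v i‖ ^ 2

/-- Mean squared deviation from the average over the agents. -/
noncomputable def spread (v : Fin n → E) : ℝ := meanSq fun i => v i - mean v

/-- One communication round. -/
noncomputable def gossip (W : Matrix (Fin n) (Fin n) ℝ) (v : Fin n → E) (i : Fin n) : E :=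
  ∑ j, W i j • v j

theorem mean_add (u v : Fin n → E) : mean (fun i => u i + v i) = mean u + mean v := by
  simp [mean, Finset.sum_add_distrib]

theorem mean_sub (u v : Fin n → E) : mean (fun i => u i - v i) = mean u - mean v := by
  simp [mean, Finset.sum_sub_distrib, smul_sub]

theorem mean_smul (c : ℝ) (v : Fin n → E) : mean (fun i => c • v i) = c • mean v := by
  simp [mean, ← Finset.smul_sum, smul_comm c]

theorem mean_const (hn : 0 < n) (c : E) : mean (fun _ : Fin n => c) = c := by
  have : (n : ℝ) ≠ 0 := by positivity
  simp [mean, ← Nat.cast_smul_eq_nsmul ℝ, smul_smul, this]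

theorem mean_map {E' : Type*} [NormedAddCommGroup E'] [InnerProductSpace ℝ E'] (A : E →ₗ[ℝ] E')
    (v : Fin n → E) : mean (fun i => A (v i)) = A (mean v) := by
  simp [mean, map_sum]

theorem meanSq_nonneg (v : Fin n → E) : 0 ≤ meanSq v := by unfold meanSq; positivity

theorem spread_nonneg (v : Fin n → E) : 0 ≤ spread v := meanSq_nonneg _

theorem meanSq_mono {E' : Type*} [NormedAddCommGroup E'] [InnerProductSpace ℝ E']
    {u : Fin n → E} {v : Fin n → E'} {c : ℝ} (h : ∀ i, ‖u i‖ ^ 2 ≤ c * ‖v i‖ ^ 2) :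
    meanSq u ≤ c * meanSq v := by
  unfold meanSq
  rw [mul_left_comm, Finset.mul_sum (a := c)]
  gcongr with i
  exact h i

theorem meanSq_smul (c : ℝ) (v : Fin n → E) : meanSq (fun i => c • v i) = c ^ 2 * meanSq v := by
  unfold meanSq
  simp_rw [norm_smul, mul_pow, Real.norm_eq_abs, sq_abs, ← Finset.mul_sum]
  ring

/-- Weighted arithmetic-geometric mean inequality. The weight stays free because the contraction
estimate needs a factor close to 1 on the first term. -/
theorem norm_add_sq_le_young (a : ℝ) (ha : 0 < a) (x y : E) :
    ‖x + y‖ ^ 2 ≤ (1 + a) * ‖x‖ ^ 2 + (1 + a⁻¹) * ‖y‖ ^ 2 := by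
  have h := norm_add_le x y
  have h2 : ‖x + y‖ ^ 2 ≤ (‖x‖ + ‖y‖) ^ 2 := by gcongr
  have h3 : 2 * ‖x‖ * ‖y‖ ≤ a * ‖x‖ ^ 2 + a⁻¹ * ‖y‖ ^ 2 := by
    have : 0 ≤ a⁻¹ * (a * ‖x‖ - ‖y‖) ^ 2 := by positivity
    have e : a⁻¹ * (a * ‖x‖ - ‖y‖) ^ 2 = a * ‖x‖ ^ 2 + a⁻¹ * ‖y‖ ^ 2 - 2 * ‖x‖ * ‖y‖ := by
      field_simp; ring
    linarith
  nlinarith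

theorem meanSq_add_le_young (a : ℝ) (ha : 0 < a) (u v : Fin n → E) :
    meanSq (fun i => u i + v i) ≤ (1 + a) * meanSq u + (1 + a⁻¹) * meanSq v := by
  unfold meanSq
  calc (n : ℝ)⁻¹ * ∑ i, ‖u i + v i‖ ^ 2
      ≤ (n : ℝ)⁻¹ * ∑ i, ((1 + a) * ‖u i‖ ^ 2 + (1 + a⁻¹) * ‖v i‖ ^ 2) := by
        gcongr with i; exact norm_add_sq_le_young a ha _ _
    _ = _ := by rw [Finset.sum_add_distrib, ← Finset.mul_sum, ← Finset.mul_sum]; ring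

theorem meanSq_add_le (u v : Fin n → E) :
    meanSq (fun i => u i + v i) ≤ 2 * meanSq u + 2 * meanSq v := by
  have := meanSq_add_le_young 1 one_pos u v
  norm_num at this; exact this

theorem meanSq_sub_le (u v : Fin n → E) :
    meanSq (fun i => u i - v i) ≤ 2 * meanSq u + 2 * meanSq v := by
  have := meanSq_add_le u (fun i => - v i)
  simpa [sub_eq_add_neg, meanSq] using this

theorem spread_add_le_young (a : ℝ) (ha : 0 < a) (u v : Fin n → E) :
    spread (fun i => u i + v i) ≤ (1 + a) * spread u + (1 + a⁻¹) * spread v := by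
  have := meanSq_add_le_young a ha (fun i => u i - mean u) (fun i => v i - mean v)
  unfold spread
  rw [mean_add]
  simpa only [add_sub_add_comm] using this

theorem spread_add_le (u v : Fin n → E) :
    spread (fun i => u i + v i) ≤ 2 * spread u + 2 * spread v := by
  have := spread_add_le_young 1 one_pos u v
  norm_num at this; exact this

theorem spread_smul (c : ℝ) (v : Fin n → E) : spread (fun i => c • v i) = c ^ 2 * spread v := by
  unfold spread
  rw [mean_smul, ← meanSq_smul]
  simp_rw [smul_sub]

theorem spread_sub_le (u v : Fin n → E) :
    spread (fun i => u i - v i) ≤ 2 * spread u + 2 * spread v := by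
  have := spread_add_le u (fun i => (-1 : ℝ) • v i)
  rw [spread_smul] at this
  simpa [sub_eq_add_neg] using this

/-- The variance identity. Both Jensen's inequality for the average and the bound of deviations by
the mean square are read off from it. -/
theorem spread_eq (hn : 0 < n) (v : Fin n → E) : spread v = meanSq v - ‖mean v‖ ^ 2 := by
  have hn' : (n : ℝ) ≠ 0 := by positivity
  have hs : ∑ i, v i = (n : ℝ) • mean v := by simp [mean, smul_smul, hn']
  unfold spread meanSq
  simp_rw [norm_sub_sq_real]
  rw [Finset.sum_add_distrib, Finset.sum_sub_distrib, ← Finset.mul_sum, ← sum_inner, hs,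
    real_inner_smul_left, real_inner_self_eq_norm_sq]
  simp only [Finset.sum_const, Finset.card_univ, Fintype.card_fin, nsmul_eq_mul]
  field_simp
  ring

theorem norm_mean_sq_le (hn : 0 < n) (v : Fin n → E) : ‖mean v‖ ^ 2 ≤ meanSq v := by
  have := spread_eq hn v
  linarith [spread_nonneg v]

theorem spread_le_meanSq (hn : 0 < n) (v : Fin n → E) : spread v ≤ meanSq v := by
  rw [spread_eq hn v]
  linarith [sq_nonneg ‖mean v‖]

theorem meanSq_eq (hn : 0 < n) (v : Fin n → E) : meanSq v = spread v + ‖mean v‖ ^ 2 := by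
  rw [spread_eq hn v]; ring

theorem spread_map_le {E' : Type*} [NormedAddCommGroup E'] [InnerProductSpace ℝ E']
    (A : E →ₗ[ℝ] E') {c : ℝ} (hA : ∀ x, ‖A x‖ ^ 2 ≤ c * ‖x‖ ^ 2) (v : Fin n → E) :
    spread (fun i => A (v i)) ≤ c * spread v := by
  unfold spread
  rw [mean_map]
  simp_rw [← map_sub]
  exact meanSq_mono fun i => hA _

/-- Mean squared displacement in terms of the deviations and the displacement of the average. -/
theorem meanSq_sub_le_spread (hn : 0 < n) (u v : Fin n → E) :
    meanSq (fun i => u i - v i) ≤ 2 * spread u + 2 * spread v + ‖mean u - mean v‖ ^ 2 := by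
  rw [meanSq_eq hn, mean_sub]
  linarith [spread_sub_le u v]

/-! ### Algebra of communication rounds -/

theorem gossip_add (W : Matrix (Fin n) (Fin n) ℝ) (u v : Fin n → E) :
    gossip W (fun i => u i + v i) = fun i => gossip W u i + gossip W v i := by
  funext i; simp [gossip, Finset.sum_add_distrib]

theorem gossip_sub (W : Matrix (Fin n) (Fin n) ℝ) (u v : Fin n → E) :
    gossip W (fun i => u i - v i) = fun i => gossip W u i - gossip W v i := by
  funext i; simp [gossip, smul_sub, Finset.sum_sub_distrib]

theorem gossip_smul (W : Matrix (Fin n) (Fin n) ℝ) (c : ℝ) (v : Fin n → E) :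
    gossip W (fun i => c • v i) = fun i => c • gossip W v i := by
  funext i; simp [gossip, Finset.smul_sum, smul_comm c]

theorem gossip_map {E' : Type*} [NormedAddCommGroup E'] [InnerProductSpace ℝ E']
    (W : Matrix (Fin n) (Fin n) ℝ) (A : E →ₗ[ℝ] E') (v : Fin n → E) :
    gossip W (fun i => A (v i)) = fun i => A (gossip W v i) := by
  funext i; simp [gossip, map_sum]

theorem gossip_const {W : Matrix (Fin n) (Fin n) ℝ} (hrow : ∀ i, ∑ j, W i j = 1) (c : E) :
    gossip W (fun _ => c) = fun _ => c := by
  funext i; simp [gossip, ← Finset.sum_smul, hrow i]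

/-- Unit column sums conserve the total. Thus the averages obey a recursion in which the network
does not appear. -/
theorem mean_gossip {W : Matrix (Fin n) (Fin n) ℝ} (hcol : ∀ j, ∑ i, W i j = 1) (v : Fin n → E) :
    mean (gossip W v) = mean v := by
  unfold mean gossip
  rw [Finset.sum_comm]
  simp_rw [← Finset.sum_smul, hcol, one_smul]

end Averages

/-! ### Spectral contraction -/

section Spectral

variable {n : ℕ} {W : Matrix (Fin n) (Fin n) ℝ} {ρ : ℝ}

/-- The ordering places every eigenvalue after the first between λ_n and λ_2, so the two extreme
ones bound its absolute value. -/
theorem IsMixing.abs_eig_le (h : IsMixing W ρ) (hn : 2 ≤ n) (m : Fin (Fintype.card (Fin n)))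
    (hm : 1 ≤ (m : ℕ)) : |h.symm.eigenvalues₀ m| ≤ ρ ∧ h.symm.eigenvalues₀ m < 1 := by
  have hc : Fintype.card (Fin n) = n := Fintype.card_fin n
  have hanti := h.symm.eigenvalues₀_antitone
  have hm2 := m.2
  have e1 : eig h.symm 1 = h.symm.eigenvalues₀ ⟨1, by omega⟩ := by
    unfold eig; rw [dif_pos]
  have en : eig h.symm (n - 1) = h.symm.eigenvalues₀ ⟨n - 1, by omega⟩ := by
    unfold eig; rw [dif_pos]
  have h1 : h.symm.eigenvalues₀ m ≤ eig h.symm 1 := by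
    rw [e1]; exact hanti (Fin.mk_le_of_le_val hm)
  have h2 : eig h.symm (n - 1) ≤ h.symm.eigenvalues₀ m := by
    rw [en]; exact hanti (by rw [Fin.le_def]; simp only; omega)
  refine ⟨?_, h1.trans_lt (h.eig_two hn)⟩
  have hρ : ρ = max |eig h.symm 1| |eig h.symm (n - 1)| :=
    h.rho_eq.trans (by rw [connectivity, if_pos hn])
  exact ((abs_le_max_abs_abs h2 h1).trans (max_comm _ _).le).trans hρ.ge

theorem IsMixing.rho_nonneg (h : IsMixing W ρ) : 0 ≤ ρ := by
  refine le_of_le_of_eq ?_ h.rho_eq.symm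
  rw [connectivity]
  split_ifs
  · exact (abs_nonneg _).trans (le_max_left _ _)
  · exact le_rfl

/-- In an orthonormal eigenbasis the all-ones vector, an eigenvector for 1, is orthogonal to every
basis vector of eigenvalue below 1, hence a multiple of the leading one. A vector of zero sum
therefore has no leading component, and all other components shrink by ρ. -/
theorem IsMixing.sum_sq_mulVec_le (h : IsMixing W ρ) (v : Fin n → ℝ) (hv : ∑ i, v i = 0) :
    ∑ i, (W.mulVec v i) ^ 2 ≤ ρ ^ 2 * ∑ i, v i ^ 2 := by
  rcases lt_or_ge n 2 with hn | hn
  · have hsub : Subsingleton (Fin n) := by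
      rw [Fin.subsingleton_iff_le_one]; omega
    have hv0 : v = 0 := by
      funext i
      rw [Fintype.sum_subsingleton _ i] at hv
      exact hv
    simp [hv0]
  let b := h.symm.eigenvectorBasis
  let V : EuclideanSpace ℝ (Fin n) := WithLp.toLp 2 v
  let WV : EuclideanSpace ℝ (Fin n) := WithLp.toLp 2 (W.mulVec v)
  let o : EuclideanSpace ℝ (Fin n) := WithLp.toLp 2 (fun _ => 1)
  have key : ∀ j (x : Fin n → ℝ), inner ℝ (b j) (WithLp.toLp 2 (W.mulVec x))
      = h.symm.eigenvalues j * inner ℝ (b j) (WithLp.toLp 2 x) := by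
    intro j x
    have hb := h.symm.mulVec_eigenvectorBasis j
    have hT : W.transpose = W := by simpa using! h.symm
    simp only [EuclideanSpace.inner_eq_star_dotProduct, star_trivial]
    rw [dotProduct_comm, Matrix.dotProduct_mulVec, ← Matrix.mulVec_transpose, hT]
    change W.mulVec (h.symm.eigenvectorBasis j).ofLp ⬝ᵥ x = _
    rw [hb, smul_dotProduct, dotProduct_comm]
    rfl
  -- This is the reindexing that relates `eigenvalues` to the sorted list `eigenvalues₀`, so that
  -- `j0` carries λ_1.
  let e := (Fintype.equivOfCardEq (Fintype.card_fin _) : Fin (Fintype.card (Fin n)) ≃ Fin n)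
  have hc : Fintype.card (Fin n) = n := Fintype.card_fin n
  let j0 : Fin n := e ⟨0, by omega⟩
  have hother : ∀ j, j ≠ j0 → |h.symm.eigenvalues j| ≤ ρ ∧ h.symm.eigenvalues j < 1 := by
    intro j hj
    refine h.abs_eig_le hn (e.symm j) ?_
    by_contra hlt
    apply hj
    have h0 : e.symm j = ⟨0, by omega⟩ := by
      apply Fin.ext; simp only; omega
    rw [← e.apply_symm_apply j, h0]
  have hW1 : W.mulVec (fun _ => 1) = fun _ => 1 := by
    funext i; simp [Matrix.mulVec, dotProduct, h.row_sum i]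
  have ho : ∀ j, j ≠ j0 → inner ℝ (b j) o = 0 := by
    intro j hj
    have := key j (fun _ => 1)
    rw [hW1] at this
    have hlt := (hother j hj).2
    -- Compare W1 = 1 with the action of W on the j-th coordinate; the first factor is nonzero away
    -- from `j0`.
    have h3 : (1 - h.symm.eigenvalues j) * inner ℝ (b j) o = 0 := by
      change inner ℝ (b j) o = _ * inner ℝ (b j) o at this
      linarith
    rcases mul_eq_zero.mp h3 with h4 | h4
    · linarith
    · exact h4
  have hov : inner ℝ o V = 0 := by
    simp [o, V, EuclideanSpace.inner_eq_star_dotProduct, dotProduct, hv]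
  have hexp : o = (inner ℝ (b j0) o) • b j0 := by
    conv_lhs => rw [← b.sum_repr' o]
    rw [Finset.sum_eq_single j0]
    · intro j _ hj; rw [ho j hj, zero_smul]
    · simp
  have hne : inner ℝ (b j0) o ≠ 0 := by
    intro h0
    rw [h0, zero_smul] at hexp
    have : o j0 = 0 := by rw [hexp]; rfl
    simp [o] at this
  have hb0 : inner ℝ (b j0) V = 0 := by
    rw [hexp, real_inner_smul_left] at hov
    exact (mul_eq_zero.mp hov).resolve_left hne
  have n1 : ∑ i, (W.mulVec v i) ^ 2 = ∑ j, (inner ℝ (b j) WV) ^ 2 := by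
    have := b.sum_sq_norm_inner_right WV
    simp only [Real.norm_eq_abs, sq_abs] at this
    rw [this, EuclideanSpace.norm_sq_eq]
    simp [WV]
  have n2 : ∑ i, (v i) ^ 2 = ∑ j, (inner ℝ (b j) V) ^ 2 := by
    have := b.sum_sq_norm_inner_right V
    simp only [Real.norm_eq_abs, sq_abs] at this
    rw [this, EuclideanSpace.norm_sq_eq]
    simp [V]
  rw [n1, n2, Finset.mul_sum]
  gcongr with j
  rw [key j v, mul_pow]
  by_cases hj : j = j0
  · subst hj
    change _ * (inner ℝ (b j0) V) ^ 2 ≤ _ * (inner ℝ (b j0) V) ^ 2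
    rw [hb0]; simp
  · gcongr ?_ * _
    rw [← sq_abs]
    gcongr
    exact (hother j hj).1

variable {E : Type*} [NormedAddCommGroup E] [InnerProductSpace ℝ E] [FiniteDimensional ℝ E]

/-- Mixing acts on each coordinate of an orthonormal basis of `E` separately, so the scalar
contraction applies to every coordinate of the deviations, which have zero sum. -/
theorem IsMixing.spread_gossip_le (h : IsMixing W ρ) (hn : 0 < n) (v : Fin n → E) :
    spread (gossip W v) ≤ ρ ^ 2 * spread v := by
  have hn' : (n : ℝ) ≠ 0 := by positivity
  let b := stdOrthonormalBasis ℝ E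
  have key : ∀ u : Fin n → E, ∑ i, u i = 0 → ∑ i, ‖gossip W u i‖ ^ 2 ≤ ρ ^ 2 * ∑ i, ‖u i‖ ^ 2 := by
    intro u hu
    have e : ∀ x : E, ‖x‖ ^ 2 = ∑ j, (inner ℝ (b j) x) ^ 2 := by
      intro x
      rw [← b.sum_sq_norm_inner_right x]
      simp
    simp_rw [e]
    rw [Finset.sum_comm, Finset.sum_comm (γ := Fin n), Finset.mul_sum]
    gcongr with j
    have := h.sum_sq_mulVec_le (fun i => inner ℝ (b j) (u i)) (by rw [← inner_sum, hu, inner_zero_right])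
    refine le_trans (le_of_eq ?_) this
    refine Finset.sum_congr rfl fun i _ => ?_
    simp [gossip, inner_sum, Matrix.mulVec, dotProduct, real_inner_smul_right]
  have hz : ∑ i, (v i - mean v) = 0 := by
    rw [Finset.sum_sub_distrib]
    simp [mean, ← Nat.cast_smul_eq_nsmul ℝ, smul_smul, hn']
  have := key _ hz
  unfold spread meanSq
  rw [mean_gossip h.col_sum, mul_left_comm]
  have e2 : (fun i => gossip W v i - mean v) = gossip W (fun i => v i - mean v) := by
    rw [gossip_sub, gossip_const h.row_sum]
  simp_rw [funext_iff] at e2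
  simp_rw [e2]
  gcongr

theorem IsMixing.spread_gossip_le_self (h : IsMixing W ρ) (hn : 0 < n) (v : Fin n → E) :
    spread (gossip W v) ≤ spread v := by
  refine (h.spread_gossip_le hn v).trans (mul_le_of_le_one_left (spread_nonneg v) ?_)
  nlinarith [h.rho_nonneg, h.rho_lt]

/-- Contraction of the consensus error under one communication round. -/
theorem IsMixing.spread_gossip_add_le (h : IsMixing W ρ) (hn : 0 < n) (u v : Fin n → E) :
    spread (gossip W fun i => u i + v i)
      ≤ ρ * spread u + 2 / (1 - ρ) * spread (gossip W v) := by
  have h0 := h.rho_nonneg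
  have h1 := h.rho_lt
  have hb : 0 < 1 - ρ := by linarith
  rw [gossip_add]
  -- With weight 1 - ρ the first factor is (2 - ρ)ρ² = ρ(1 - (1-ρ)²) ≤ ρ: one power of ρ is given up
  -- for the constant 2/(1-ρ) on the second term.
  refine (spread_add_le_young (1 - ρ) hb _ _).trans ?_
  have hu := h.spread_gossip_le hn u
  have hsu := spread_nonneg u
  have hsv := spread_nonneg (gossip W v)
  have a1 : (1 + (1 - ρ)) * spread (gossip W u) ≤ ρ * spread u := by
    calc (1 + (1 - ρ)) * spread (gossip W u) ≤ (1 + (1 - ρ)) * (ρ ^ 2 * spread u) := by gcongr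
      _ = (ρ * (1 - (1 - ρ) ^ 2)) * spread u := by ring
      _ ≤ ρ * spread u := by
        gcongr
        nlinarith [sq_nonneg (1 - ρ)]
  have a2 : 1 + (1 - ρ)⁻¹ ≤ 2 / (1 - ρ) := by
    have : 1 ≤ (1 - ρ)⁻¹ := (one_le_inv₀ hb).mpr (by linarith)
    rw [div_eq_mul_inv]; linarith
  have a3 : (1 + (1 - ρ)⁻¹) * spread (gossip W v) ≤ 2 / (1 - ρ) * spread (gossip W v) := by gcongr
  linarith

end Spectral

/-! ### Functions with a quadratic first-order remainder -/

section QuadApprox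

variable {H : Type*} [NormedAddCommGroup H] [InnerProductSpace ℝ H] [CompleteSpace H]

/-- `g` is a gradient field of `f` with first-order remainder at most `C ‖z' - z‖²`. -/
def QuadApprox (f : H → ℝ) (g : H → H) (C : ℝ) : Prop :=
  ∀ z z', |f z' - f z - inner ℝ (g z) (z' - z)| ≤ C * ‖z' - z‖ ^ 2

/-- A quadratic remainder is little-o of the displacement. The differentiability of V_γ and Ψ_μ is
obtained in this way, without being known beforehand. -/
theorem QuadApprox.hasGradientAt {f : H → ℝ} {g : H → H} {C : ℝ} (h : QuadApprox f g C) (z : H) :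
    HasGradientAt f (g z) z := by
  rw [hasGradientAt_iff_isLittleO]
  have hO : (fun z' => f z' - f z - inner ℝ (g z) (z' - z)) =O[nhds z] fun z' => ‖z' - z‖ ^ 2 := by
    refine Asymptotics.IsBigO.of_bound C (Filter.Eventually.of_forall fun z' => ?_)
    simpa using h z z'
  refine hO.trans_isLittleO ?_
  have : (fun z' : H => ‖z' - z‖ ^ 2) = fun z' => ‖z' - z‖ * ‖z' - z‖ := by
    funext z'; ring
  rw [this]
  refine Asymptotics.isLittleO_of_tendsto' (f := fun z' : H => ‖z' - z‖ * ‖z' - z‖)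
    (g := fun z' => ‖z' - z‖) ?_ ?_ |>.of_norm_right
  · exact Filter.Eventually.of_forall fun z' hz => by simp [hz]
  · have h1 : (fun z' : H => ‖z' - z‖ * ‖z' - z‖ / ‖z' - z‖) = fun z' => ‖z' - z‖ := by
      funext z'; rw [mul_self_div_self]
    rw [h1]
    have : Continuous fun z' : H => ‖z' - z‖ := by fun_prop
    simpa using this.tendsto z

theorem QuadApprox.gradient {f : H → ℝ} {g : H → H} {C : ℝ} (h : QuadApprox f g C) : ∇ f = g :=
  funext fun z => (h.hasGradientAt z).gradient

theorem QuadApprox.differentiable {f : H → ℝ} {g : H → H} {C : ℝ} (h : QuadApprox f g C) :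
    Differentiable ℝ f := fun z => (h.hasGradientAt z).differentiableAt

theorem QuadApprox.continuous {f : H → ℝ} {g : H → H} {C : ℝ} (h : QuadApprox f g C) :
    Continuous f := h.differentiable.continuous

theorem QuadApprox.add {f₁ f₂ : H → ℝ} {g₁ g₂ : H → H} {C₁ C₂ : ℝ} (h₁ : QuadApprox f₁ g₁ C₁)
    (h₂ : QuadApprox f₂ g₂ C₂) :
    QuadApprox (fun z => f₁ z + f₂ z) (fun z => g₁ z + g₂ z) (C₁ + C₂) := by
  intro z z'
  have a := abs_le.mp (h₁ z z')
  have b := abs_le.mp (h₂ z z')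
  rw [inner_add_left, abs_le]
  constructor <;> nlinarith [a.1, a.2, b.1, b.2]

theorem QuadApprox.const_mul {f : H → ℝ} {g : H → H} {C : ℝ} (h : QuadApprox f g C) (c : ℝ) :
    QuadApprox (fun z => c * f z) (fun z => c • g z) (|c| * C) := by
  intro z z'
  have : c * f z' - c * f z - inner ℝ (c • g z) (z' - z)
      = c * (f z' - f z - inner ℝ (g z) (z' - z)) := by
    rw [real_inner_smul_left]; ring
  rw [this, abs_mul, mul_assoc]
  gcongr
  exact h z z'

theorem QuadApprox.average {n : ℕ} (hn : 0 < n) {f : Fin n → H → ℝ} {g : Fin n → H → H} {C : ℝ}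
    (h : ∀ i, QuadApprox (f i) (g i) C) :
    QuadApprox (fun z => (n : ℝ)⁻¹ * ∑ i, f i z) (fun z => mean fun i => g i z) C := by
  intro z z'
  have hn' : (0 : ℝ) < n := by positivity
  have e : (n : ℝ)⁻¹ * ∑ i, f i z' - (n : ℝ)⁻¹ * ∑ i, f i z
      - inner ℝ (mean fun i => g i z) (z' - z)
      = (n : ℝ)⁻¹ * ∑ i, (f i z' - f i z - inner ℝ (g i z) (z' - z)) := by
    rw [mean, real_inner_smul_left, sum_inner, Finset.sum_sub_distrib, Finset.sum_sub_distrib]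
    ring
  rw [e, abs_mul, abs_of_pos (inv_pos.mpr hn')]
  calc (n : ℝ)⁻¹ * |∑ i, (f i z' - f i z - inner ℝ (g i z) (z' - z))|
      ≤ (n : ℝ)⁻¹ * ∑ i, |f i z' - f i z - inner ℝ (g i z) (z' - z)| := by
        gcongr; exact Finset.abs_sum_le_sum_abs _ _
    _ ≤ (n : ℝ)⁻¹ * ∑ _i : Fin n, C * ‖z' - z‖ ^ 2 := by
        gcongr with i; exact h i z z'
    _ = C * ‖z' - z‖ ^ 2 := by simp [hn'.ne']

/-- The mean value inequality on the segment, applied to f minus its linearization at z. It yields L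
in place of the sharp L/2, which is why 1/(2γ) - L₂ appears below as a strong convexity constant. -/
theorem quadApprox_of_lipschitz_gradient {f : H → ℝ} {L : ℝ} (hf : Differentiable ℝ f) (hL : 0 ≤ L)
    (hlip : ∀ z z', ‖∇ f z - ∇ f z'‖ ≤ L * ‖z - z'‖) : QuadApprox f (∇ f) L := by
  intro z z'
  have hg : ∀ x, HasFDerivAt f (InnerProductSpace.toDual ℝ H (∇ f x)) x := fun x =>
    (hf x).hasGradientAt.hasFDerivAt
  have := Convex.norm_image_sub_le_of_norm_hasFDerivWithin_le' (f := f) (C := L * ‖z' - z‖)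
    (s := segment ℝ z z') (x := z) (y := z') (f' := fun x => InnerProductSpace.toDual ℝ H (∇ f x))
    (φ := InnerProductSpace.toDual ℝ H (∇ f z)) (fun x _ => (hg x).hasFDerivWithinAt)
    (fun x hx => by
      rw [← map_sub, LinearIsometryEquiv.norm_map]
      refine (hlip x z).trans ?_
      gcongr
      have h := norm_sub_le_of_mem_segment hx
      rwa [norm_sub_rev x z] at *
      ) (convex_segment _ _) (left_mem_segment _ _ _) (right_mem_segment _ _ _)
  rw [InnerProductSpace.toDual_apply_apply, Real.norm_eq_abs] at this
  calc _ ≤ _ := this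
    _ = _ := by ring

end QuadApprox

/-! ### The Moreau envelope -/

section Envelope

variable {n dx dy : ℕ} {Ξf Ξg : Type*} [MeasurableSpace Ξf] [MeasurableSpace Ξg]
  {pb : Problem n dx dy Ξf Ξg} {L₁ L₂ γ : ℝ}

theorem Smooth.quadApprox_f (hs : Smooth pb L₁ L₂) (hL₁ : 0 ≤ L₁) (i : Fin n) :
    QuadApprox (pb.f i) (∇ (pb.f i)) L₁ :=
  quadApprox_of_lipschitz_gradient ((hs.contDiff_f i).differentiable one_ne_zero) hL₁ (hs.lip_f i)

theorem Smooth.quadApprox_g (hs : Smooth pb L₁ L₂) (hL₂ : 0 < L₂) (i : Fin n) :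
    QuadApprox (pb.g i) (∇ (pb.g i)) L₂ :=
  quadApprox_of_lipschitz_gradient ((hs.contDiff_g i).differentiable one_ne_zero) hL₂.le (hs.lip_g i)

theorem Smooth.gradient_F (hs : Smooth pb L₁ L₂) (hn : 0 < n) (hL₁ : 0 ≤ L₁) :
    ∇ pb.F = fun z => mean fun i => ∇ (pb.f i) z :=
  (QuadApprox.average hn (hs.quadApprox_f hL₁)).gradient

theorem Smooth.gradient_G (hs : Smooth pb L₁ L₂) (hn : 0 < n) (hL₂ : 0 < L₂) :
    ∇ pb.G = fun z => mean fun i => ∇ (pb.g i) z :=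
  (QuadApprox.average hn (hs.quadApprox_g hL₂)).gradient

theorem Smooth.quadApprox_F (hs : Smooth pb L₁ L₂) (hn : 0 < n) (hL₁ : 0 ≤ L₁) :
    QuadApprox pb.F (∇ pb.F) L₁ := by
  rw [hs.gradient_F hn hL₁]
  exact QuadApprox.average hn (hs.quadApprox_f hL₁)

theorem Smooth.quadApprox_G (hs : Smooth pb L₁ L₂) (hn : 0 < n) (hL₂ : 0 < L₂) :
    QuadApprox pb.G (∇ pb.G) L₂ := by
  rw [hs.gradient_G hn hL₂]
  exact QuadApprox.average hn (hs.quadApprox_g hL₂)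

theorem norm_mean_sub_mean_le {E H : Type*} [NormedAddCommGroup E] [InnerProductSpace ℝ E]
    [NormedAddCommGroup H] (hn : 0 < n)
    {g : Fin n → H → E} {L : ℝ} (h : ∀ i z z', ‖g i z - g i z'‖ ≤ L * ‖z - z'‖) (z z' : H) :
    ‖(mean fun i => g i z) - mean fun i => g i z'‖ ≤ L * ‖z - z'‖ := by
  have hn' : (0 : ℝ) < n := by positivity
  rw [← mean_sub, mean, norm_smul, norm_inv, Real.norm_natCast]
  calc (n : ℝ)⁻¹ * ‖∑ i, (g i z - g i z')‖ ≤ (n : ℝ)⁻¹ * ∑ _i : Fin n, L * ‖z - z'‖ := by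
        gcongr; exact norm_sum_le_of_le _ fun i _ => h i z z'
    _ = L * ‖z - z'‖ := by simp [hn'.ne']

theorem Smooth.lip_F (hs : Smooth pb L₁ L₂) (hn : 0 < n) (hL₁ : 0 ≤ L₁) (z z' : Pair dx dy) :
    ‖∇ pb.F z - ∇ pb.F z'‖ ≤ L₁ * ‖z - z'‖ := by
  rw [hs.gradient_F hn hL₁]
  exact norm_mean_sub_mean_le hn hs.lip_f z z'

theorem Smooth.lip_G (hs : Smooth pb L₁ L₂) (hn : 0 < n) (hL₂ : 0 < L₂) (z z' : Pair dx dy) :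
    ‖∇ pb.G z - ∇ pb.G z'‖ ≤ L₂ * ‖z - z'‖ := by
  rw [hs.gradient_G hn hL₂]
  exact norm_mean_sub_mean_le hn hs.lip_g z z'

/-- Gradient of `(x, y) ↦ G(x, θ) + ‖θ - y‖² / (2γ)`. -/
noncomputable def envGradZ (G' : Pair dx dy → Pair dx dy) (γ : ℝ) (z : Pair dx dy) (θ : Vec dy) :
    Pair dx dy :=
  pt (G' (pt z.fst θ)).fst ((1 / γ) • (z.snd - θ))

/-- Gradient of `θ ↦ G(x, θ) + ‖θ - y‖² / (2γ)`. -/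
noncomputable def envGradθ (G' : Pair dx dy → Pair dx dy) (γ : ℝ) (z : Pair dx dy) (θ : Vec dy) :
    Vec dy :=
  dirθ γ G' z.fst z.snd θ

/-! ### Coordinates of ℝ^{dx} × ℝ^{dy} -/

@[simp] theorem pt_fst (x : Vec dx) (y : Vec dy) : (pt x y).fst = x := rfl

@[simp] theorem pt_snd (x : Vec dx) (y : Vec dy) : (pt x y).snd = y := rfl

theorem norm_pt_sq (x : Vec dx) (y : Vec dy) : ‖pt x y‖ ^ 2 = ‖x‖ ^ 2 + ‖y‖ ^ 2 := by
  exact WithLp.prod_norm_sq_eq_of_L2 _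

theorem norm_fst_le (z : Pair dx dy) : ‖z.fst‖ ≤ ‖z‖ := by
  have := WithLp.prod_norm_sq_eq_of_L2 z
  exact abs_le_of_sq_le_sq' (by nlinarith [sq_nonneg ‖z.snd‖]) (norm_nonneg _) |>.2

theorem norm_snd_le (z : Pair dx dy) : ‖z.snd‖ ≤ ‖z‖ := by
  have := WithLp.prod_norm_sq_eq_of_L2 z
  exact abs_le_of_sq_le_sq' (by nlinarith [sq_nonneg ‖z.fst‖]) (norm_nonneg _) |>.2

theorem pt_sub_pt (x x' : Vec dx) (y y' : Vec dy) : pt x y - pt x' y' = pt (x - x') (y - y') := rfl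

theorem norm_pt_sub_pt_right (x : Vec dx) (y y' : Vec dy) : ‖pt x y - pt x y'‖ = ‖y - y'‖ := by
  have : ‖pt x y - pt x y'‖ ^ 2 = ‖y - y'‖ ^ 2 := by rw [pt_sub_pt, norm_pt_sq]; simp
  exact (sq_eq_sq₀ (norm_nonneg _) (norm_nonneg _)).mp this

theorem norm_pt_sub_pt_left (x x' : Vec dx) (y : Vec dy) : ‖pt x y - pt x' y‖ = ‖x - x'‖ := by
  have : ‖pt x y - pt x' y‖ ^ 2 = ‖x - x'‖ ^ 2 := by rw [pt_sub_pt, norm_pt_sq]; simp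
  exact (sq_eq_sq₀ (norm_nonneg _) (norm_nonneg _)).mp this

theorem inner_pair (z z' : Pair dx dy) :
    inner ℝ z z' = inner ℝ z.fst z'.fst + inner ℝ z.snd z'.snd := WithLp.prod_inner_apply z z'

/-- A quadratic form is its own second-order remainder, so the expansion of ‖θ - y‖²/(2γ) is exact.
-/
theorem env_quad_aux (γ : ℝ) (a b a' b' : Vec dy) :
    1 / (2 * γ) * ‖a' - b'‖ ^ 2 - 1 / (2 * γ) * ‖a - b‖ ^ 2 - inner ℝ ((1 / γ) • (b - a)) (b' - b)
      - inner ℝ ((1 / γ) • (a - b)) (a' - a) = 1 / (2 * γ) * ‖(a' - a) - (b' - b)‖ ^ 2 := by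
  have e : a' - b' = (a - b) + ((a' - a) - (b' - b)) := by abel
  rw [e, norm_add_sq_real, real_inner_smul_left, real_inner_smul_left]
  have e2 : inner ℝ (b - a) (b' - b) = - inner ℝ (a - b) (b' - b) := by
    rw [← inner_neg_left, neg_sub]
  rw [e2, inner_sub_right (a - b) (a' - a) (b' - b)]
  have e3 : 1 / (2 * γ) = (1 / γ) / 2 := by ring
  rw [e3]
  ring

/-- Joint first-order expansion of `(z, θ) ↦ G(x, θ) + ‖θ - y‖² / (2γ)`. -/
theorem Smooth.env_quad (hs : Smooth pb L₁ L₂) (hn : 0 < n) (hL₂ : 0 < L₂) (hγ : 0 < γ)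
    (z z' : Pair dx dy) (θ θ' : Vec dy) :
    |pb.envObj γ z' θ' - pb.envObj γ z θ - inner ℝ (envGradZ (∇ pb.G) γ z θ) (z' - z)
      - inner ℝ (envGradθ (∇ pb.G) γ z θ) (θ' - θ)|
      ≤ (L₂ + 1 / γ) * (‖z' - z‖ ^ 2 + ‖θ' - θ‖ ^ 2) := by
  have hG := hs.quadApprox_G hn hL₂ (pt z.fst θ) (pt z'.fst θ')
  have hq := env_quad_aux γ θ z.snd θ' z'.snd
  have hz := WithLp.prod_norm_sq_eq_of_L2 (z' - z)
  rw [pt_sub_pt, norm_pt_sq, inner_pair] at hG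
  simp only [pt_fst, pt_snd] at hG
  simp only [Problem.envObj, envGradZ, envGradθ, dirθ, inner_pair, inner_add_left]
  simp only [WithLp.sub_fst, WithLp.sub_snd, pt_fst, pt_snd] at hz ⊢
  rw [hz]
  have hy : ‖(θ' - θ) - (z'.snd - z.snd)‖ ^ 2 ≤ 2 * ‖θ' - θ‖ ^ 2 + 2 * ‖z'.snd - z.snd‖ ^ 2 := by
    have := norm_add_sq_le_young 1 one_pos (θ' - θ) (-(z'.snd - z.snd))
    rw [norm_neg, ← sub_eq_add_neg] at this
    norm_num at this; exact this
  have hg : 1 / (2 * γ) * ‖(θ' - θ) - (z'.snd - z.snd)‖ ^ 2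
      ≤ 1 / γ * (‖θ' - θ‖ ^ 2 + ‖z'.snd - z.snd‖ ^ 2) := by
    calc _ ≤ 1 / (2 * γ) * (2 * ‖θ' - θ‖ ^ 2 + 2 * ‖z'.snd - z.snd‖ ^ 2) := by gcongr
      _ = _ := by field_simp
  have hg0 : 0 ≤ 1 / (2 * γ) * ‖(θ' - θ) - (z'.snd - z.snd)‖ ^ 2 := by positivity
  have h1 := abs_le.mp hG
  have p1 : 0 ≤ L₂ * ‖z'.snd - z.snd‖ ^ 2 := by positivity
  have p2 : 0 ≤ 1 / γ * ‖z'.fst - z.fst‖ ^ 2 := by positivity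
  have p3 : 0 ≤ 1 / γ * ‖θ' - θ‖ ^ 2 := by positivity
  have p4 : 0 ≤ 1 / γ * ‖z'.snd - z.snd‖ ^ 2 := by positivity
  rw [abs_le]
  constructor <;> nlinarith [h1.1, h1.2]

/-- Strong convexity of `θ ↦ G(x, θ) + ‖θ - y‖² / (2γ)`. -/
theorem Smooth.env_ge (hs : Smooth pb L₁ L₂) (hn : 0 < n) (hL₂ : 0 < L₂)
    (z : Pair dx dy) (θ θ' : Vec dy) :
    pb.envObj γ z θ + inner ℝ (envGradθ (∇ pb.G) γ z θ) (θ' - θ)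
      + (1 / (2 * γ) - L₂) * ‖θ' - θ‖ ^ 2 ≤ pb.envObj γ z θ' := by
  have hG := hs.quadApprox_G hn hL₂ (pt z.fst θ) (pt z.fst θ')
  have hq := env_quad_aux γ θ z.snd θ' z.snd
  rw [pt_sub_pt, norm_pt_sq, inner_pair] at hG
  simp only [pt_fst, pt_snd] at hG
  simp only [Problem.envObj, envGradθ, dirθ, inner_add_left]
  simp only [sub_self, norm_zero, inner_zero_right, sub_zero] at hG hq
  have h1 := abs_le.mp hG
  nlinarith [h1.1, h1.2]

/-- Critical points are the fixed points of θ ↦ y - γ ∇_y G(x, θ), a contraction because γ L₂ < 1.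
Existence thus needs neither coercivity nor compactness. -/
theorem Smooth.exists_envGradθ_eq_zero (hs : Smooth pb L₁ L₂) (hn : 0 < n) (hL₂ : 0 < L₂)
    (hγ : γ ∈ Set.Ioo 0 (1 / (2 * L₂))) (z : Pair dx dy) :
    ∃ θ, envGradθ (∇ pb.G) γ z θ = 0 := by
  have hγ0 := hγ.1
  have hγL : γ * L₂ < 1 := by
    have := hγ.2
    rw [lt_div_iff₀ (by positivity)] at this
    nlinarith
  let T : Vec dy → Vec dy := fun θ => z.snd - γ • (∇ pb.G (pt z.fst θ)).snd
  have hT : ContractingWith (Real.toNNReal (γ * L₂)) T := by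
    refine ⟨by rw [Real.toNNReal_lt_one]; exact hγL, LipschitzWith.of_dist_le_mul fun a b => ?_⟩
    rw [Real.coe_toNNReal _ (by positivity), dist_eq_norm, dist_eq_norm]
    have e : T a - T b = - (γ • (∇ pb.G (pt z.fst a) - ∇ pb.G (pt z.fst b)).snd) := by
      simp only [T, WithLp.sub_snd, smul_sub]; abel
    rw [e, norm_neg, norm_smul, Real.norm_of_nonneg hγ0.le, mul_assoc]
    gcongr
    refine (norm_snd_le _).trans ((hs.lip_G hn hL₂ _ _).trans ?_)
    rw [norm_pt_sub_pt_right]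
  refine ⟨ContractingWith.fixedPoint T hT, ?_⟩
  have hfix : T (ContractingWith.fixedPoint T hT) = _ := hT.fixedPoint_isFixedPt
  set θ := ContractingWith.fixedPoint T hT
  have : θ - z.snd = - (γ • (∇ pb.G (pt z.fst θ)).snd) := by
    nth_rewrite 1 [← hfix]; simp only [T]; abel
  simp only [envGradθ, dirθ]
  rw [this, smul_neg, smul_smul, one_div_mul_cancel hγ0.ne', one_smul, add_neg_cancel]

/-- This margin makes the lower-level problem strongly convex with the non-sharp remainder constant
of G; it is where γ < 1/(2L₂) is needed. -/
theorem half_sub_pos (hL₂ : 0 < L₂) (hγ : γ ∈ Set.Ioo 0 (1 / (2 * L₂))) :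
    0 < 1 / (2 * γ) - L₂ := by
  have h1 := hγ.1
  have h2 := hγ.2
  rw [lt_div_iff₀ (by positivity)] at h2
  rw [sub_pos, lt_div_iff₀ (by positivity)]
  linarith

theorem eta_pos (hL₂ : 0 < L₂) (hγ : γ ∈ Set.Ioo 0 (1 / (2 * L₂))) : 0 < eta L₂ γ := by
  have := half_sub_pos hL₂ hγ
  have h1 := hγ.1
  have : 1 / γ = 2 * (1 / (2 * γ)) := by field_simp
  unfold eta
  linarith

/-- At a critical point the strong convexity inequality loses its linear term, which gives global
minimality and uniqueness together. -/
theorem Smooth.isMinOn_iff_envGradθ (hs : Smooth pb L₁ L₂) (hn : 0 < n) (hL₂ : 0 < L₂)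
    (hγ : γ ∈ Set.Ioo 0 (1 / (2 * L₂))) (z : Pair dx dy) {θ₀ : Vec dy}
    (h₀ : envGradθ (∇ pb.G) γ z θ₀ = 0) (θ : Vec dy) :
    IsMinOn (pb.envObj γ z) Set.univ θ ↔ θ = θ₀ := by
  have hν := half_sub_pos hL₂ hγ
  have key := fun θ' => hs.env_ge (γ := γ) hn hL₂ z θ₀ θ'
  simp only [h₀, inner_zero_left, add_zero] at key
  rw [isMinOn_iff]
  constructor
  · intro h
    have h1 := h θ₀ (Set.mem_univ _)
    have h2 := key θ
    have h3 : (1 / (2 * γ) - L₂) * ‖θ - θ₀‖ ^ 2 ≤ 0 := by linarith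
    have h4 : ‖θ - θ₀‖ ^ 2 ≤ 0 := by
      by_contra hc
      push Not at hc
      have := mul_pos hν hc
      linarith
    have h5 : ‖θ - θ₀‖ = 0 := by nlinarith [norm_nonneg (θ - θ₀)]
    exact sub_eq_zero.mp (norm_eq_zero.mp h5)
  · rintro rfl θ' _
    have : 0 ≤ (1 / (2 * γ) - L₂) * ‖θ' - θ‖ ^ 2 := by positivity
    linarith [key θ']

theorem Smooth.isMinOn_thetaStar (hs : Smooth pb L₁ L₂) (hn : 0 < n) (hL₂ : 0 < L₂)
    (hγ : γ ∈ Set.Ioo 0 (1 / (2 * L₂))) (z : Pair dx dy) :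
    IsMinOn (pb.envObj γ z) Set.univ (pb.thetaStar γ z) := by
  obtain ⟨θ₀, h₀⟩ := hs.exists_envGradθ_eq_zero hn hL₂ hγ z
  exact Classical.epsilon_spec (p := fun θ => IsMinOn (pb.envObj γ z) Set.univ θ)
    ⟨θ₀, (hs.isMinOn_iff_envGradθ hn hL₂ hγ z h₀ θ₀).mpr rfl⟩

theorem Smooth.envGradθ_thetaStar (hs : Smooth pb L₁ L₂) (hn : 0 < n) (hL₂ : 0 < L₂)
    (hγ : γ ∈ Set.Ioo 0 (1 / (2 * L₂))) (z : Pair dx dy) :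
    envGradθ (∇ pb.G) γ z (pb.thetaStar γ z) = 0 := by
  obtain ⟨θ₀, h₀⟩ := hs.exists_envGradθ_eq_zero hn hL₂ hγ z
  rw [(hs.isMinOn_iff_envGradθ hn hL₂ hγ z h₀ _).mp (hs.isMinOn_thetaStar hn hL₂ hγ z)]
  exact h₀

theorem Smooth.isMinOn_iff (hs : Smooth pb L₁ L₂) (hn : 0 < n) (hL₂ : 0 < L₂)
    (hγ : γ ∈ Set.Ioo 0 (1 / (2 * L₂))) (z : Pair dx dy) (θ : Vec dy) :
    IsMinOn (pb.envObj γ z) Set.univ θ ↔ θ = pb.thetaStar γ z :=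
  hs.isMinOn_iff_envGradθ hn hL₂ hγ z (hs.envGradθ_thetaStar hn hL₂ hγ z) θ

theorem Smooth.V_eq (hs : Smooth pb L₁ L₂) (hn : 0 < n) (hL₂ : 0 < L₂)
    (hγ : γ ∈ Set.Ioo 0 (1 / (2 * L₂))) (z : Pair dx dy) :
    pb.V γ z = pb.envObj γ z (pb.thetaStar γ z) := by
  have h := _root_.isMinOn_iff.mp (hs.isMinOn_thetaStar hn hL₂ hγ z)
  refine le_antisymm (ciInf_le ⟨pb.envObj γ z (pb.thetaStar γ z), ?_⟩ _)
    (le_ciInf fun θ => h θ (Set.mem_univ _))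
  rintro _ ⟨θ, rfl⟩
  exact h θ (Set.mem_univ _)

/-- Quadratic growth around the minimizer. Gaps in function value thereby control distances to θ*.
-/
theorem Smooth.V_add_le (hs : Smooth pb L₁ L₂) (hn : 0 < n) (hL₂ : 0 < L₂)
    (hγ : γ ∈ Set.Ioo 0 (1 / (2 * L₂))) (z : Pair dx dy) (θ : Vec dy) :
    pb.V γ z + (1 / (2 * γ) - L₂) * ‖θ - pb.thetaStar γ z‖ ^ 2 ≤ pb.envObj γ z θ := by
  have := hs.env_ge (γ := γ) hn hL₂ z (pb.thetaStar γ z) θ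
  rw [hs.envGradθ_thetaStar hn hL₂ hγ, inner_zero_left, add_zero, ← hs.V_eq hn hL₂ hγ] at this
  exact this

theorem Smooth.V_le_env (hs : Smooth pb L₁ L₂) (hn : 0 < n) (hL₂ : 0 < L₂)
    (hγ : γ ∈ Set.Ioo 0 (1 / (2 * L₂))) (z : Pair dx dy) (θ : Vec dy) :
    pb.V γ z ≤ pb.envObj γ z θ := by
  have := half_sub_pos hL₂ hγ
  have h2 : 0 ≤ (1 / (2 * γ) - L₂) * ‖θ - pb.thetaStar γ z‖ ^ 2 := by positivity
  linarith [hs.V_add_le hn hL₂ hγ z θ]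

/-- At θ = y the proximal term vanishes. Hence G - V_γ is itself a lower-level gap, and it controls
‖y - θ*‖. -/
theorem envObj_snd (z : Pair dx dy) : pb.envObj γ z z.snd = pb.G z := by
  simp only [Problem.envObj, sub_self, norm_zero]
  norm_num
  rfl

theorem Smooth.V_add_le_G (hs : Smooth pb L₁ L₂) (hn : 0 < n) (hL₂ : 0 < L₂)
    (hγ : γ ∈ Set.Ioo 0 (1 / (2 * L₂))) (z : Pair dx dy) :
    pb.V γ z + (1 / (2 * γ) - L₂) * ‖z.snd - pb.thetaStar γ z‖ ^ 2 ≤ pb.G z := by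
  have := hs.V_add_le hn hL₂ hγ z z.snd
  rwa [envObj_snd] at this

theorem Smooth.V_le_G (hs : Smooth pb L₁ L₂) (hn : 0 < n) (hL₂ : 0 < L₂)
    (hγ : γ ∈ Set.Ioo 0 (1 / (2 * L₂))) (z : Pair dx dy) : pb.V γ z ≤ pb.G z := by
  have := hs.V_le_env hn hL₂ hγ z z.snd
  rwa [envObj_snd] at this

/-- Strong monotonicity of the gradient of `θ ↦ G(x, θ) + ‖θ - y‖² / (2γ)`. -/
theorem Smooth.eta_mul_le_inner (hs : Smooth pb L₁ L₂) (hn : 0 < n) (hL₂ : 0 < L₂)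
    (z : Pair dx dy) (θ θ' : Vec dy) :
    eta L₂ γ * ‖θ - θ'‖ ^ 2
      ≤ inner ℝ (envGradθ (∇ pb.G) γ z θ - envGradθ (∇ pb.G) γ z θ') (θ - θ') := by
  have e : envGradθ (∇ pb.G) γ z θ - envGradθ (∇ pb.G) γ z θ'
      = (∇ pb.G (pt z.fst θ) - ∇ pb.G (pt z.fst θ')).snd + (1 / γ) • (θ - θ') := by
    simp only [envGradθ, dirθ, WithLp.sub_snd, smul_sub]; abel
  rw [e, inner_add_left, real_inner_smul_left, real_inner_self_eq_norm_sq]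
  have h1 : |inner ℝ (∇ pb.G (pt z.fst θ) - ∇ pb.G (pt z.fst θ')).snd (θ - θ')|
      ≤ L₂ * ‖θ - θ'‖ * ‖θ - θ'‖ := by
    refine (abs_real_inner_le_norm _ _).trans ?_
    gcongr
    refine (norm_snd_le _).trans ((hs.lip_G hn hL₂ _ _).trans ?_)
    rw [norm_pt_sub_pt_right]
  have h2 := (abs_le.mp h1).1
  unfold eta
  nlinarith

/-- Error bound: strong monotonicity against the zero of the field, then Cauchy-Schwarz and division
by the distance. -/
theorem Smooth.eta_mul_norm_le (hs : Smooth pb L₁ L₂) (hn : 0 < n) (hL₂ : 0 < L₂)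
    (hγ : γ ∈ Set.Ioo 0 (1 / (2 * L₂))) (z : Pair dx dy) (θ : Vec dy) :
    eta L₂ γ * ‖θ - pb.thetaStar γ z‖ ≤ ‖envGradθ (∇ pb.G) γ z θ‖ := by
  have h := hs.eta_mul_le_inner (γ := γ) hn hL₂ z θ (pb.thetaStar γ z)
  rw [hs.envGradθ_thetaStar hn hL₂ hγ, sub_zero] at h
  have h2 := h.trans (real_inner_le_norm _ _)
  rcases (norm_nonneg (θ - pb.thetaStar γ z)).eq_or_lt with h0 | h0
  · rw [← h0]; simp
  · have h3 : (eta L₂ γ * ‖θ - pb.thetaStar γ z‖) * ‖θ - pb.thetaStar γ z‖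
        ≤ ‖envGradθ (∇ pb.G) γ z θ‖ * ‖θ - pb.thetaStar γ z‖ := by nlinarith
    exact le_of_mul_le_mul_right h3 h0

theorem Smooth.norm_envGradθ_le (hs : Smooth pb L₁ L₂) (hn : 0 < n) (hL₂ : 0 < L₂)
    (hγ : γ ∈ Set.Ioo 0 (1 / (2 * L₂))) (z : Pair dx dy) (θ : Vec dy) :
    ‖envGradθ (∇ pb.G) γ z θ‖ ≤ (L₂ + 1 / γ) * ‖θ - pb.thetaStar γ z‖ := by
  have h0 := hs.envGradθ_thetaStar hn hL₂ hγ z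
  have hγ0 := hγ.1
  have e : envGradθ (∇ pb.G) γ z θ
      = (∇ pb.G (pt z.fst θ) - ∇ pb.G (pt z.fst (pb.thetaStar γ z))).snd
        + (1 / γ) • (θ - pb.thetaStar γ z) := by
    rw [← sub_zero (envGradθ (∇ pb.G) γ z θ), ← h0]
    simp only [envGradθ, dirθ, WithLp.sub_snd, smul_sub]; abel
  rw [e, add_mul]
  refine (norm_add_le _ _).trans (add_le_add ?_ ?_)
  · refine (norm_snd_le _).trans ((hs.lip_G hn hL₂ _ _).trans ?_)
    rw [norm_pt_sub_pt_right]
  · rw [norm_smul, Real.norm_of_nonneg (by positivity)]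

theorem Smooth.norm_envGradZ_sub_le (hs : Smooth pb L₁ L₂) (hn : 0 < n) (hL₂ : 0 < L₂)
    (z : Pair dx dy) (θ θ' : Vec dy) :
    ‖envGradZ (∇ pb.G) γ z θ - envGradZ (∇ pb.G) γ z θ'‖ ^ 2
      ≤ (L₂ ^ 2 + 1 / γ ^ 2) * ‖θ - θ'‖ ^ 2 := by
  simp only [envGradZ, pt_sub_pt, norm_pt_sq, ← smul_sub, norm_smul, mul_pow, Real.norm_eq_abs,
    sq_abs, one_div, inv_pow]
  have e : z.snd - θ - (z.snd - θ') = -(θ - θ') := by abel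
  rw [e, norm_neg, add_mul]
  gcongr
  rw [← mul_pow]
  gcongr
  have : (∇ pb.G (pt z.fst θ)).fst - (∇ pb.G (pt z.fst θ')).fst
    = (∇ pb.G (pt z.fst θ) - ∇ pb.G (pt z.fst θ')).fst := rfl
  rw [this]
  refine (norm_fst_le _).trans ((hs.lip_G hn hL₂ _ _).trans ?_)
  rw [norm_pt_sub_pt_right]

/-- Insert the minimizer for z' into the gradient field for z. The residual comes only from the
change of x and y, and the error bound converts it into a distance; Cauchy-Schwarz over the two
components produces the square root. -/
theorem Smooth.thetaStar_lipschitz (hs : Smooth pb L₁ L₂) (hn : 0 < n) (hL₂ : 0 < L₂)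
    (hγ : γ ∈ Set.Ioo 0 (1 / (2 * L₂))) (z z' : Pair dx dy) :
    ‖pb.thetaStar γ z - pb.thetaStar γ z'‖ ≤ Lθ L₂ γ * ‖z - z'‖ := by
  have hη := eta_pos hL₂ hγ
  have hγ0 := hγ.1
  set θ := pb.thetaStar γ z
  set θ' := pb.thetaStar γ z'
  have h1 := hs.eta_mul_norm_le hn hL₂ hγ z θ'
  rw [norm_sub_rev] at h1
  have h0 := hs.envGradθ_thetaStar hn hL₂ hγ z'
  have e : envGradθ (∇ pb.G) γ z θ'
      = (∇ pb.G (pt z.fst θ') - ∇ pb.G (pt z'.fst θ')).snd - (1 / γ) • (z.snd - z'.snd) := by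
    rw [← sub_zero (envGradθ (∇ pb.G) γ z θ'), ← h0]
    simp only [envGradθ, dirθ, WithLp.sub_snd, smul_sub, θ']; abel
  have h2 : ‖envGradθ (∇ pb.G) γ z θ'‖ ≤ L₂ * ‖(z - z').fst‖ + 1 / γ * ‖(z - z').snd‖ := by
    rw [e]
    refine (norm_sub_le _ _).trans (add_le_add ?_ ?_)
    · refine (norm_snd_le _).trans ((hs.lip_G hn hL₂ _ _).trans ?_)
      rw [norm_pt_sub_pt_left]; rfl
    · rw [norm_smul, Real.norm_of_nonneg (by positivity)]; rfl
  have h3 : L₂ * ‖(z - z').fst‖ + 1 / γ * ‖(z - z').snd‖ ≤ √(L₂ ^ 2 + 1 / γ ^ 2) * ‖z - z'‖ := by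
    rw [← Real.sqrt_sq (norm_nonneg (z - z')), ← Real.sqrt_mul (by positivity)]
    apply Real.le_sqrt_of_sq_le
    rw [WithLp.prod_norm_sq_eq_of_L2]
    have e2 : 1 / γ ^ 2 = (1 / γ) ^ 2 := by ring
    rw [e2]
    nlinarith [sq_nonneg (L₂ * ‖(z - z').snd‖ - 1 / γ * ‖(z - z').fst‖)]
  unfold Lθ
  rw [div_mul_eq_mul_div, le_div_iff₀ hη]
  linarith

/-- First-order expansion of the Moreau envelope. -/
theorem Smooth.quadApprox_V (hs : Smooth pb L₁ L₂) (hn : 0 < n) (hL₂ : 0 < L₂)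
    (hγ : γ ∈ Set.Ioo 0 (1 / (2 * L₂))) :
    QuadApprox (pb.V γ) (fun z => envGradZ (∇ pb.G) γ z (pb.thetaStar γ z))
      ((L₂ + 1 / γ) * (1 + Lθ L₂ γ ^ 2)) := by
  intro z z'
  have hγ0 := hγ.1
  have q1 := abs_le.mp (hs.env_quad hn hL₂ hγ0 z z' (pb.thetaStar γ z) (pb.thetaStar γ z))
  have q2 := abs_le.mp (hs.env_quad hn hL₂ hγ0 z z' (pb.thetaStar γ z) (pb.thetaStar γ z'))
  have v1 := hs.V_le_env hn hL₂ hγ z' (pb.thetaStar γ z)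
  have hl : ‖pb.thetaStar γ z' - pb.thetaStar γ z‖ ^ 2 ≤ Lθ L₂ γ ^ 2 * ‖z' - z‖ ^ 2 := by
    rw [← mul_pow]
    gcongr
    exact hs.thetaStar_lipschitz hn hL₂ hγ z' z
  -- Envelope argument: the θ-linear term vanishes at the minimizer, so the movement of θ* enters
  -- only through its square, which is of second order by Lipschitz continuity.
  rw [hs.envGradθ_thetaStar hn hL₂ hγ, inner_zero_left, sub_zero, ← hs.V_eq hn hL₂ hγ] at q1 q2
  rw [← hs.V_eq hn hL₂ hγ] at q2
  rw [sub_self, norm_zero] at q1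
  have hc : 0 < L₂ + 1 / γ := by positivity
  have hl2 : (L₂ + 1 / γ) * ‖pb.thetaStar γ z' - pb.thetaStar γ z‖ ^ 2
    ≤ (L₂ + 1 / γ) * (Lθ L₂ γ ^ 2 * ‖z' - z‖ ^ 2) := by gcongr
  have p : 0 ≤ (L₂ + 1 / γ) * (Lθ L₂ γ ^ 2 * ‖z' - z‖ ^ 2) := by positivity
  rw [abs_le]
  constructor <;> nlinarith [q1.1, q1.2, q2.1, q2.2]

/-- The gradient of `Ψ_μ`. -/
noncomputable def psiGrad (pb : Problem n dx dy Ξf Ξg) (γ μ : ℝ) (z : Pair dx dy) : Pair dx dy :=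
  μ • ∇ pb.F z + ∇ pb.G z - envGradZ (∇ pb.G) γ z (pb.thetaStar γ z)

theorem Smooth.quadApprox_Psi (hs : Smooth pb L₁ L₂) (hn : 0 < n) (hL₁ : 0 ≤ L₁) (hL₂ : 0 < L₂)
    (hγ : γ ∈ Set.Ioo 0 (1 / (2 * L₂))) (μ : ℝ) :
    QuadApprox (pb.Psi γ μ) (psiGrad pb γ μ)
      (|μ| * L₁ + L₂ + (L₂ + 1 / γ) * (1 + Lθ L₂ γ ^ 2)) := by
  have h := (((hs.quadApprox_F hn hL₁).const_mul μ).add (hs.quadApprox_G hn hL₂)).add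
    ((hs.quadApprox_V hn hL₂ hγ).const_mul (-1))
  simp only [abs_neg, abs_one, one_mul] at h
  intro z z'
  have h1 := h z z'
  simp only [psiGrad, Problem.Psi]
  simp only [neg_smul, one_smul, ← sub_eq_add_neg, neg_mul, one_mul] at h1
  exact h1

end Envelope

/-! ### Joint variable `(x, y, θ)` and directions -/

section Directions

variable {dx dy : ℕ}

/-- `ℝ^{dx} × ℝ^{dy} × ℝ^{dy}` with the Euclidean norm. -/
abbrev Tri (dx dy : ℕ) := WithLp 2 (Pair dx dy × Vec dy)

/-- The point `(z, θ)`. -/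
abbrev tri (z : Pair dx dy) (θ : Vec dy) : Tri dx dy := WithLp.toLp 2 (z, θ)

@[simp] theorem tri_fst (z : Pair dx dy) (θ : Vec dy) : (tri z θ).fst = z := rfl

@[simp] theorem tri_snd (z : Pair dx dy) (θ : Vec dy) : (tri z θ).snd = θ := rfl

theorem norm_tri_sq (z : Pair dx dy) (θ : Vec dy) : ‖tri z θ‖ ^ 2 = ‖z‖ ^ 2 + ‖θ‖ ^ 2 :=
  WithLp.prod_norm_sq_eq_of_L2 _

theorem inner_tri (u u' : Tri dx dy) :
    inner ℝ u u' = inner ℝ u.fst u'.fst + inner ℝ u.snd u'.snd := WithLp.prod_inner_apply u u'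

theorem norm_tri_le (z : Pair dx dy) (θ : Vec dy) : ‖tri z θ‖ ≤ ‖z‖ + ‖θ‖ := by
  refine abs_le_of_sq_le_sq' ?_ (by positivity) |>.2
  rw [norm_tri_sq]
  nlinarith [norm_nonneg z, norm_nonneg θ]

theorem norm_pt_le (x : Vec dx) (y : Vec dy) : ‖pt x y‖ ≤ ‖x‖ + ‖y‖ := by
  refine abs_le_of_sq_le_sq' ?_ (by positivity) |>.2
  rw [norm_pt_sq]
  nlinarith [norm_nonneg x, norm_nonneg y]

theorem norm_tri_fst_le (u : Tri dx dy) : ‖u.fst‖ ≤ ‖u‖ := by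
  have := WithLp.prod_norm_sq_eq_of_L2 u
  exact abs_le_of_sq_le_sq' (by nlinarith [sq_nonneg ‖u.snd‖]) (norm_nonneg _) |>.2

theorem norm_tri_snd_le (u : Tri dx dy) : ‖u.snd‖ ≤ ‖u‖ := by
  have := WithLp.prod_norm_sq_eq_of_L2 u
  exact abs_le_of_sq_le_sq' (by nlinarith [sq_nonneg ‖u.fst‖]) (norm_nonneg _) |>.2

theorem tri_sub_tri (z z' : Pair dx dy) (θ θ' : Vec dy) :
    tri z θ - tri z' θ' = tri (z - z') (θ - θ') := rfl

/-- `(x, θ)` as a linear function of `(x, y, θ)`. -/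
def lowerPt (u : Tri dx dy) : Pair dx dy := pt u.fst.fst u.snd

theorem norm_lowerPt_sub_le (u u' : Tri dx dy) : ‖lowerPt u - lowerPt u'‖ ≤ ‖u - u'‖ := by
  refine abs_le_of_sq_le_sq' ?_ (by positivity) |>.2
  rw [WithLp.prod_norm_sq_eq_of_L2 (u - u'), lowerPt, lowerPt, pt_sub_pt, norm_pt_sq]
  have := norm_fst_le (u.fst - u'.fst)
  simp only [WithLp.sub_fst, WithLp.sub_snd] at *
  gcongr

/-- The joint direction `(c D_x, c D_y, D_θ)` in the joint variable. -/
noncomputable def dir (c γ μ : ℝ) (f' g' : Pair dx dy → Pair dx dy) (u : Tri dx dy) : Tri dx dy :=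
  tri (c • (μ • f' u.fst + g' u.fst - envGradZ g' γ u.fst u.snd)) (envGradθ g' γ u.fst u.snd)

theorem dir_add_mu (c γ μ ν : ℝ) (f' g' : Pair dx dy → Pair dx dy) (u : Tri dx dy) :
    dir c γ (μ + ν) f' g' u = dir c γ μ f' g' u + ν • tri (c • f' u.fst) 0 := by
  have e : ∀ (a : Pair dx dy) (b : Vec dy) (d : Pair dx dy), tri a b + ν • tri d (0 : Vec dy)
      = tri (a + ν • d) b := by
    intro a b d
    have : b = b + ν • (0 : Vec dy) := by simp
    conv_rhs => rw [this]
    rfl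
  rw [dir, dir, e]
  congr 2
  rw [smul_comm ν c, ← smul_add]
  congr 1
  rw [add_smul]; abel

/-- A Lipschitz constant of the joint direction. -/
noncomputable def dirLip (L₁ L₂ γ μ₀ c : ℝ) : ℝ :=
  c * (μ₀ * L₁ + 2 * L₂ + 2 / γ) + L₂ + 2 / γ

theorem norm_dir_sub_le {L₁ L₂ γ μ₀ μ c : ℝ} (hL₁ : 0 ≤ L₁) (hL₂ : 0 ≤ L₂) (hγ : 0 < γ)
    (hc : 0 ≤ c) (hμ : 0 ≤ μ) (hμ' : μ ≤ μ₀) {f' g' : Pair dx dy → Pair dx dy}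
    (hf : ∀ z z', ‖f' z - f' z'‖ ≤ L₁ * ‖z - z'‖) (hg : ∀ z z', ‖g' z - g' z'‖ ≤ L₂ * ‖z - z'‖)
    (u u' : Tri dx dy) :
    ‖dir c γ μ f' g' u - dir c γ μ f' g' u'‖ ≤ dirLip L₁ L₂ γ μ₀ c * ‖u - u'‖ := by
  have hz : ‖u.fst - u'.fst‖ ≤ ‖u - u'‖ := norm_tri_fst_le (u - u')
  have hθ : ‖u.snd - u'.snd‖ ≤ ‖u - u'‖ := norm_tri_snd_le (u - u')
  have hy : ‖u.fst.snd - u'.fst.snd‖ ≤ ‖u - u'‖ := (norm_snd_le (u.fst - u'.fst)).trans hz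
  have hl := norm_lowerPt_sub_le u u'
  have hgl := (hg (lowerPt u) (lowerPt u')).trans (mul_le_mul_of_nonneg_left hl hL₂)
  have hyθ : ‖(1 / γ) • (u.fst.snd - u.snd) - (1 / γ) • (u'.fst.snd - u'.snd)‖
      ≤ 2 / γ * ‖u - u'‖ := by
    rw [← smul_sub, norm_smul, Real.norm_of_nonneg (by positivity)]
    have : ‖u.fst.snd - u.snd - (u'.fst.snd - u'.snd)‖ ≤ 2 * ‖u - u'‖ := by
      rw [sub_sub_sub_comm]
      refine (norm_sub_le _ _).trans ?_
      linarith
    calc _ ≤ 1 / γ * (2 * ‖u - u'‖) := by gcongr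
      _ = _ := by ring
  have h1 : ‖envGradZ g' γ u.fst u.snd - envGradZ g' γ u'.fst u'.snd‖
      ≤ (L₂ + 2 / γ) * ‖u - u'‖ := by
    have h0 := (norm_fst_le (g' (lowerPt u) - g' (lowerPt u'))).trans hgl
    rw [WithLp.sub_fst, lowerPt, lowerPt] at h0
    rw [envGradZ, envGradZ, pt_sub_pt, add_mul]
    exact (norm_pt_le _ _).trans (add_le_add h0 hyθ)
  have h2 : ‖envGradθ g' γ u.fst u.snd - envGradθ g' γ u'.fst u'.snd‖
      ≤ (L₂ + 2 / γ) * ‖u - u'‖ := by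
    have e : envGradθ g' γ u.fst u.snd - envGradθ g' γ u'.fst u'.snd
        = (g' (lowerPt u) - g' (lowerPt u')).snd
          - ((1 / γ) • (u.fst.snd - u.snd) - (1 / γ) • (u'.fst.snd - u'.snd)) := by
      simp only [envGradθ, dirθ, lowerPt, WithLp.sub_snd, smul_sub]; abel
    rw [e, add_mul]
    exact (norm_sub_le _ _).trans (add_le_add ((norm_snd_le _).trans hgl) hyθ)
  have h3 : ‖(μ • f' u.fst + g' u.fst - envGradZ g' γ u.fst u.snd)
      - (μ • f' u'.fst + g' u'.fst - envGradZ g' γ u'.fst u'.snd)‖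
      ≤ (μ₀ * L₁ + 2 * L₂ + 2 / γ) * ‖u - u'‖ := by
    have e : (μ • f' u.fst + g' u.fst - envGradZ g' γ u.fst u.snd)
      - (μ • f' u'.fst + g' u'.fst - envGradZ g' γ u'.fst u'.snd)
      = (μ • (f' u.fst - f' u'.fst) + (g' u.fst - g' u'.fst))
        - (envGradZ g' γ u.fst u.snd - envGradZ g' γ u'.fst u'.snd) := by
      rw [smul_sub]; abel
    rw [e]
    refine (norm_sub_le _ _).trans ?_
    have h4 : ‖μ • (f' u.fst - f' u'.fst)‖ ≤ μ₀ * (L₁ * ‖u - u'‖) := by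
      rw [norm_smul, Real.norm_of_nonneg hμ]
      have := (hf u.fst u'.fst).trans (mul_le_mul_of_nonneg_left hz hL₁)
      have := hμ.trans hμ'
      gcongr
    have h5 := (hg u.fst u'.fst).trans (mul_le_mul_of_nonneg_left hz hL₂)
    have h6 := norm_add_le (μ • (f' u.fst - f' u'.fst)) (g' u.fst - g' u'.fst)
    linarith
  rw [dir, dir, tri_sub_tri, ← smul_sub]
  refine (norm_tri_le _ _).trans ?_
  rw [norm_smul, Real.norm_of_nonneg hc]
  have := mul_le_mul_of_nonneg_left h3 hc
  unfold dirLip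
  linarith

variable {n : ℕ}

/-- The direction is affine in the pair of gradient fields, and its remaining part (y - θ)/γ is
common to all agents at a common point. -/
theorem mean_dir (hn : 0 < n) (c γ μ : ℝ) (f' g' : Fin n → Pair dx dy → Pair dx dy)
    (u : Tri dx dy) :
    mean (fun i => dir c γ μ (f' i) (g' i) u)
      = dir c γ μ (fun z => mean fun i => f' i z) (fun z => mean fun i => g' i z) u := by
  have htri : ∀ (a : Fin n → Pair dx dy) (b : Fin n → Vec dy),
      mean (fun i => tri (a i) (b i)) = tri (mean a) (mean b) := by
    intro a b
    have h1 := mean_map (WithLp.fstₗ 2 ℝ (Pair dx dy) (Vec dy)) fun i => tri (a i) (b i)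
    have h2 := mean_map (WithLp.sndₗ 2 ℝ (Pair dx dy) (Vec dy)) fun i => tri (a i) (b i)
    have : ∀ w : Tri dx dy, w = tri w.fst w.snd := fun w => rfl
    rw [this (mean fun i => tri (a i) (b i))]
    congr 2
    · exact h1.symm
    · exact h2.symm
  have hpt : ∀ (a : Fin n → Vec dx) (b : Fin n → Vec dy),
      mean (fun i => pt (a i) (b i)) = pt (mean a) (mean b) := by
    intro a b
    have h1 := mean_map (WithLp.fstₗ 2 ℝ (Vec dx) (Vec dy)) fun i => pt (a i) (b i)
    have h2 := mean_map (WithLp.sndₗ 2 ℝ (Vec dx) (Vec dy)) fun i => pt (a i) (b i)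
    have : ∀ w : Pair dx dy, w = pt w.fst w.snd := fun w => rfl
    rw [this (mean fun i => pt (a i) (b i))]
    congr 2
    · exact h1.symm
    · exact h2.symm
  have hfst : ∀ a : Fin n → Pair dx dy, mean (fun i => (a i).fst) = (mean a).fst := fun a =>
    mean_map (WithLp.fstₗ 2 ℝ (Vec dx) (Vec dy)) a
  have hsnd : ∀ a : Fin n → Pair dx dy, mean (fun i => (a i).snd) = (mean a).snd := fun a =>
    mean_map (WithLp.sndₗ 2 ℝ (Vec dx) (Vec dy)) a
  have hZ : mean (fun i => envGradZ (g' i) γ u.fst u.snd)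
      = envGradZ (fun z => mean fun i => g' i z) γ u.fst u.snd := by
    refine (hpt _ _).trans ?_
    rw [mean_const hn, hfst]
    rfl
  have hθ : mean (fun i => envGradθ (g' i) γ u.fst u.snd)
      = envGradθ (fun z => mean fun i => g' i z) γ u.fst u.snd := by
    refine (mean_add _ _).trans ?_
    rw [mean_const hn, hsnd]
    rfl
  simp only [dir]
  rw [htri, hθ, mean_smul, mean_sub, mean_add, mean_smul, hZ]

end Directions
/-! ### The potential function -/

section Potential

variable {n dx dy : ℕ} {Ξf Ξg : Type*} [MeasurableSpace Ξf] [MeasurableSpace Ξg]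
  {pb : Problem n dx dy Ξf Ξg} {L₁ L₂ γ μ₀ c Flow : ℝ}

/-- Standing assumptions on the objectives and the parameters. -/
structure Regular (pb : Problem n dx dy Ξf Ξg) (L₁ L₂ γ μ₀ c Flow : ℝ) : Prop where
  pos : 0 < n
  nonneg₁ : 0 ≤ L₁
  pos₂ : 0 < L₂
  mem : γ ∈ Set.Ioo 0 (1 / (2 * L₂))
  mu_pos : 0 < μ₀
  c_pos : 0 < c
  c_le : c * (L₂ ^ 2 + 1 / γ ^ 2) ≤ eta L₂ γ ^ 2 / 16
  smooth : Smooth pb L₁ L₂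
  lower : ∀ z, Flow ≤ pb.F z

theorem Regular.gamma_pos (h : Regular pb L₁ L₂ γ μ₀ c Flow) : 0 < γ := h.mem.1

/-- The potential `μ (F - F_low) + G - V_γ + (G(x, θ) + ‖θ - y‖² / (2γ) - V_γ)`. -/
noncomputable def pot (pb : Problem n dx dy Ξf Ξg) (γ Flow μ : ℝ) (u : Tri dx dy) : ℝ :=
  pb.Psi γ μ u.fst - μ * Flow + (pb.envObj γ u.fst u.snd - pb.V γ u.fst)

/-- The gradient with respect to `z` of the lower-level gap. -/
noncomputable def gapGrad (pb : Problem n dx dy Ξf Ξg) (γ : ℝ) (u : Tri dx dy) : Pair dx dy :=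
  envGradZ (∇ pb.G) γ u.fst u.snd - envGradZ (∇ pb.G) γ u.fst (pb.thetaStar γ u.fst)

/-- The gradient of the potential. -/
noncomputable def potGrad (pb : Problem n dx dy Ξf Ξg) (γ μ : ℝ) (u : Tri dx dy) : Tri dx dy :=
  tri (psiGrad pb γ μ u.fst + gapGrad pb γ u) (envGradθ (∇ pb.G) γ u.fst u.snd)

/-- The measure of stationarity `‖∇Ψ_μ(z)‖² + ‖θ - θ*(z)‖²`. -/
noncomputable def stat (pb : Problem n dx dy Ξf Ξg) (γ μ : ℝ) (u : Tri dx dy) : ℝ :=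
  ‖psiGrad pb γ μ u.fst‖ ^ 2 + ‖u.snd - pb.thetaStar γ u.fst‖ ^ 2

theorem stat_nonneg (γ μ : ℝ) (u : Tri dx dy) : 0 ≤ stat pb γ μ u := by
  unfold stat; positivity

theorem Regular.pot_nonneg (h : Regular pb L₁ L₂ γ μ₀ c Flow) {μ : ℝ} (hμ : 0 ≤ μ)
    (u : Tri dx dy) : 0 ≤ pot pb γ Flow μ u := by
  have h1 := h.smooth.V_le_env h.pos h.pos₂ h.mem u.fst u.snd
  have h2 := h.smooth.V_le_G h.pos h.pos₂ h.mem u.fst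
  have h3 := mul_le_mul_of_nonneg_left (h.lower u.fst) hμ
  unfold pot Problem.Psi
  linarith

/-- Since F ≥ F_low, decreasing penalty parameters can only lower the potential. Subtracting μ F_low
in the definition serves this purpose as well as nonnegativity. -/
theorem Regular.pot_mono (h : Regular pb L₁ L₂ γ μ₀ c Flow) {μ μ' : ℝ} (hμ : μ ≤ μ')
    (u : Tri dx dy) : pot pb γ Flow μ u ≤ pot pb γ Flow μ' u := by
  have h3 := mul_nonneg (sub_nonneg.mpr hμ) (sub_nonneg.mpr (h.lower u.fst))
  unfold pot Problem.Psi
  nlinarith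

/-- Smoothness constant of the potential. -/
noncomputable def potConst (L₁ L₂ γ μ₀ : ℝ) : ℝ :=
  μ₀ * L₁ + L₂ + (L₂ + 1 / γ) + 2 * ((L₂ + 1 / γ) * (1 + Lθ L₂ γ ^ 2))

theorem Regular.quadApprox_pot (h : Regular pb L₁ L₂ γ μ₀ c Flow) {μ : ℝ} (hμ : 0 ≤ μ)
    (hμ' : μ ≤ μ₀) :
    QuadApprox (pot pb γ Flow μ) (potGrad pb γ μ) (potConst L₁ L₂ γ μ₀) := by
  intro u u'
  have hγ := h.gamma_pos
  have h1 := abs_le.mp (h.smooth.quadApprox_Psi h.pos h.nonneg₁ h.pos₂ h.mem μ u.fst u'.fst)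
  have h2 := abs_le.mp (h.smooth.env_quad h.pos h.pos₂ hγ u.fst u'.fst u.snd u'.snd)
  have h3 := abs_le.mp (h.smooth.quadApprox_V h.pos h.pos₂ h.mem u.fst u'.fst)
  have hu := WithLp.prod_norm_sq_eq_of_L2 (u' - u)
  rw [WithLp.sub_fst, WithLp.sub_snd] at hu
  rw [inner_tri, potGrad, tri_fst, tri_snd, inner_add_left, gapGrad, inner_sub_left, hu,
    WithLp.sub_fst, WithLp.sub_snd]
  rw [abs_of_nonneg hμ] at h1
  have m1 : μ * L₁ * ‖u'.fst - u.fst‖ ^ 2 ≤ μ₀ * L₁ * ‖u'.fst - u.fst‖ ^ 2 := by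
    have := h.nonneg₁
    gcongr
  have hp := h.pos₂
  have hμ0 := h.mu_pos
  have hL := h.nonneg₁
  have p1 : 0 ≤ (μ₀ * L₁ + L₂ + 2 * ((L₂ + 1 / γ) * (1 + Lθ L₂ γ ^ 2))) * ‖u'.snd - u.snd‖ ^ 2 := by
    positivity
  unfold pot potConst
  rw [abs_le]
  constructor <;> nlinarith [h1.1, h1.2, h2.1, h2.2, h3.1, h3.2]

theorem Regular.norm_gapGrad_sq_le (h : Regular pb L₁ L₂ γ μ₀ c Flow) (u : Tri dx dy) :
    ‖gapGrad pb γ u‖ ^ 2 ≤ (L₂ ^ 2 + 1 / γ ^ 2) * ‖u.snd - pb.thetaStar γ u.fst‖ ^ 2 :=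
  h.smooth.norm_envGradZ_sub_le h.pos h.pos₂ _ _ _

theorem Regular.norm_envGradθ_sq_le (h : Regular pb L₁ L₂ γ μ₀ c Flow) (u : Tri dx dy) :
    ‖envGradθ (∇ pb.G) γ u.fst u.snd‖ ^ 2
      ≤ (L₂ + 1 / γ) ^ 2 * ‖u.snd - pb.thetaStar γ u.fst‖ ^ 2 := by
  rw [← mul_pow]
  gcongr
  exact h.smooth.norm_envGradθ_le h.pos h.pos₂ h.mem _ _

theorem Regular.le_norm_envGradθ_sq (h : Regular pb L₁ L₂ γ μ₀ c Flow) (u : Tri dx dy) :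
    eta L₂ γ ^ 2 * ‖u.snd - pb.thetaStar γ u.fst‖ ^ 2
      ≤ ‖envGradθ (∇ pb.G) γ u.fst u.snd‖ ^ 2 := by
  rw [← mul_pow]
  have := eta_pos h.pos₂ h.mem
  gcongr
  exact h.smooth.eta_mul_norm_le h.pos h.pos₂ h.mem _ _

/-- The algorithm evaluates the envelope gradient at θ in place of θ*(z), so its z-part is ψ - w,
whereas the potential has ψ + w. This pairing makes the mixed terms cancel in the descent estimate.
-/
theorem dir_gradient_eq (c γ μ : ℝ) (u : Tri dx dy) :
    dir c γ μ (∇ pb.F) (∇ pb.G) u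
      = tri (c • (psiGrad pb γ μ u.fst - gapGrad pb γ u)) (envGradθ (∇ pb.G) γ u.fst u.snd) := by
  have e : psiGrad pb γ μ u.fst - gapGrad pb γ u
      = μ • ∇ pb.F u.fst + ∇ pb.G u.fst - envGradZ (∇ pb.G) γ u.fst u.snd := by
    rw [psiGrad, gapGrad]; abel
  rw [dir, e]

/-- Bound of the average direction by the measure of stationarity. -/
theorem Regular.norm_dir_sq_le (h : Regular pb L₁ L₂ γ μ₀ c Flow) (μ : ℝ) (u : Tri dx dy) :
    ‖dir c γ μ (∇ pb.F) (∇ pb.G) u‖ ^ 2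
      ≤ (2 * c ^ 2 + 2 * c ^ 2 * (L₂ ^ 2 + 1 / γ ^ 2) + (L₂ + 1 / γ) ^ 2) * stat pb γ μ u := by
  rw [dir_gradient_eq, norm_tri_sq, norm_smul, mul_pow, Real.norm_eq_abs, sq_abs]
  have h1 := norm_add_sq_le_young 1 one_pos (psiGrad pb γ μ u.fst) (-gapGrad pb γ u)
  rw [norm_neg, ← sub_eq_add_neg] at h1
  have h2 := h.norm_gapGrad_sq_le u
  have h3 := h.norm_envGradθ_sq_le u
  have hγ := h.gamma_pos
  have hL := h.pos₂
  unfold stat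
  set A := ‖psiGrad pb γ μ u.fst‖ ^ 2 with hA
  set e := ‖u.snd - pb.thetaStar γ u.fst‖ ^ 2 with he
  have hA0 : 0 ≤ A := by positivity
  have he0 : 0 ≤ e := by positivity
  have h4 : c ^ 2 * ‖psiGrad pb γ μ u.fst - gapGrad pb γ u‖ ^ 2
      ≤ c ^ 2 * (2 * A + 2 * ((L₂ ^ 2 + 1 / γ ^ 2) * e)) := by
    gcongr
    norm_num at h1
    norm_num at h2
    norm_num
    linarith
  have p1 : 0 ≤ (2 * c ^ 2 * (L₂ ^ 2 + 1 / γ ^ 2) + (L₂ + 1 / γ) ^ 2) * A := by positivity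
  have p2 : 0 ≤ (2 * c ^ 2) * e := by positivity
  linarith

/-- Descent along the perturbed average direction. -/
theorem Regular.inner_potGrad_ge (h : Regular pb L₁ L₂ γ μ₀ c Flow) (μ : ℝ)
    (u v : Tri dx dy) :
    min (c / 2) (eta L₂ γ ^ 2 / 2) * stat pb γ μ u - 1 / min c 1 * ‖v‖ ^ 2
      ≤ inner ℝ (potGrad pb γ μ u) (dir c γ μ (∇ pb.F) (∇ pb.G) u + v) := by
  have hc := h.c_pos
  have hη := eta_pos h.pos₂ h.mem
  have hε : 0 < min c 1 := lt_min hc one_pos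
  set ε := min c 1
  have hεc : ε ≤ c := min_le_left _ _
  have hε1 : ε ≤ 1 := min_le_right _ _
  set g := potGrad pb γ μ u
  set ψ := psiGrad pb γ μ u.fst
  set w := gapGrad pb γ u
  set t := envGradθ (∇ pb.G) γ u.fst u.snd
  have h1 : inner ℝ g (dir c γ μ (∇ pb.F) (∇ pb.G) u) = c * (‖ψ‖ ^ 2 - ‖w‖ ^ 2) + ‖t‖ ^ 2 := by
    rw [dir_gradient_eq, inner_tri]
    change inner ℝ (ψ + w) (c • (ψ - w)) + inner ℝ t t = _
    rw [real_inner_smul_right, inner_add_left, inner_sub_right, inner_sub_right, real_inner_self_eq_norm_sq,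
      real_inner_self_eq_norm_sq, real_inner_self_eq_norm_sq, real_inner_comm ψ w]
    ring
  -- The weight ε = min c 1 is small enough for both blocks of the direction: ε‖ψ‖² and ε‖w‖² are
  -- compared with the factor c, ε‖t‖² with the factor 1.
  have h2 : - (ε / 4 * ‖g‖ ^ 2 + 1 / ε * ‖v‖ ^ 2) ≤ inner ℝ g v := by
    have h3 := (abs_le.mp (abs_real_inner_le_norm g v)).1
    have h4 : 0 ≤ 1 / ε * (ε / 2 * ‖g‖ - ‖v‖) ^ 2 := by positivity
    have h5 : 1 / ε * (ε / 2 * ‖g‖ - ‖v‖) ^ 2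
        = ε / 4 * ‖g‖ ^ 2 + 1 / ε * ‖v‖ ^ 2 - ‖g‖ * ‖v‖ := by field_simp; ring
    linarith
  have h3 : ‖g‖ ^ 2 ≤ 2 * ‖ψ‖ ^ 2 + 2 * ‖w‖ ^ 2 + ‖t‖ ^ 2 := by
    have : ‖g‖ ^ 2 = ‖ψ + w‖ ^ 2 + ‖t‖ ^ 2 := norm_tri_sq _ _
    have h4 := norm_add_sq_le_young 1 one_pos ψ w
    norm_num at h4
    linarith
  have hw := h.norm_gapGrad_sq_le u
  have ht := h.le_norm_envGradθ_sq u
  have hcl := h.c_le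
  rw [inner_add_right, h1]
  unfold stat
  set e := ‖u.snd - pb.thetaStar γ u.fst‖ ^ 2
  have he0 : 0 ≤ e := by positivity
  -- The bound on c_λ enters here. What remains of the θ-part is at least (3/4 - 3/32) η² e, which
  -- exceeds η² e / 2.
  have hcw : c * ‖w‖ ^ 2 ≤ eta L₂ γ ^ 2 / 16 * e := by
    calc c * ‖w‖ ^ 2 ≤ c * ((L₂ ^ 2 + 1 / γ ^ 2) * e) := by gcongr
      _ = c * (L₂ ^ 2 + 1 / γ ^ 2) * e := by ring
      _ ≤ _ := by gcongr
  have q1 : ε / 4 * ‖g‖ ^ 2 ≤ ε / 4 * (2 * ‖ψ‖ ^ 2 + 2 * ‖w‖ ^ 2 + ‖t‖ ^ 2) := by gcongr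
  have q2 : ε * ‖ψ‖ ^ 2 ≤ c * ‖ψ‖ ^ 2 := by gcongr
  have q3 : ε * ‖w‖ ^ 2 ≤ c * ‖w‖ ^ 2 := by gcongr
  have q4 : ε * ‖t‖ ^ 2 ≤ 1 * ‖t‖ ^ 2 := by gcongr
  have m1 : min (c / 2) (eta L₂ γ ^ 2 / 2) * ‖ψ‖ ^ 2 ≤ c / 2 * ‖ψ‖ ^ 2 := by
    gcongr; exact min_le_left _ _
  have m2 : min (c / 2) (eta L₂ γ ^ 2 / 2) * e ≤ eta L₂ γ ^ 2 / 2 * e := by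
    gcongr; exact min_le_right _ _
  have q5 : 0 ≤ eta L₂ γ ^ 2 * e := by positivity
  change _ * (‖ψ‖ ^ 2 + e) - _ ≤ _
  rw [mul_add]
  linarith

/-! ### Continuity and growth -/

/-- Lipschitz continuity with an unspecified constant. -/
def IsLip {E H : Type*} [NormedAddCommGroup E] [NormedAddCommGroup H] (f : E → H) : Prop :=
  ∃ K : ℝ, 0 ≤ K ∧ ∀ u u', ‖f u - f u'‖ ≤ K * ‖u - u'‖

section IsLip

variable {E H H' : Type*} [NormedAddCommGroup E] [NormedAddCommGroup H] [NormedSpace ℝ H]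
  [NormedAddCommGroup H']

theorem IsLip.add {f g : E → H} (hf : IsLip f) (hg : IsLip g) : IsLip fun u => f u + g u := by
  obtain ⟨K, hK, h⟩ := hf
  obtain ⟨K', hK', h'⟩ := hg
  refine ⟨K + K', by positivity, fun u u' => ?_⟩
  rw [add_sub_add_comm, add_mul]
  exact (norm_add_le _ _).trans (add_le_add (h u u') (h' u u'))

theorem IsLip.const_smul {f : E → H} (hf : IsLip f) (a : ℝ) : IsLip fun u => a • f u := by
  obtain ⟨K, hK, h⟩ := hf
  refine ⟨|a| * K, by positivity, fun u u' => ?_⟩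
  rw [← smul_sub, norm_smul, mul_assoc, Real.norm_eq_abs]
  exact mul_le_mul_of_nonneg_left (h u u') (abs_nonneg a)

theorem IsLip.sub {f g : E → H} (hf : IsLip f) (hg : IsLip g) : IsLip fun u => f u - g u := by
  have := hf.add (hg.const_smul (-1))
  simpa [sub_eq_add_neg] using this

theorem IsLip.comp {f : H → H'} {g : E → H} (hf : IsLip f) (hg : IsLip g) :
    IsLip fun u => f (g u) := by
  obtain ⟨K, hK, h⟩ := hf
  obtain ⟨K', hK', h'⟩ := hg
  refine ⟨K * K', by positivity, fun u u' => ?_⟩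
  rw [mul_assoc]
  exact (h _ _).trans (mul_le_mul_of_nonneg_left (h' u u') hK)

theorem IsLip.continuous {f : E → H} (hf : IsLip f) : Continuous f := by
  obtain ⟨K, hK, h⟩ := hf
  have : LipschitzWith K.toNNReal f := LipschitzWith.of_dist_le_mul fun u u' => by
    rw [Real.coe_toNNReal _ hK, dist_eq_norm, dist_eq_norm]; exact h u u'
  exact this.continuous

theorem IsLip.id : IsLip fun u : E => u := ⟨1, zero_le_one, fun u u' => by simp⟩

/-- Lipschitz maps grow at most linearly, and constants are square integrable for a finite measure.
This carries square integrability through all deterministic parts of the algorithm. -/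
theorem IsLip.memLp {Ω : Type*} [MeasurableSpace Ω] {P : Measure Ω} [IsFiniteMeasure P] {f : E → H}
    (hf : IsLip f) {U : Ω → E} (hU : MemLp U 2 P) : MemLp (fun ω => f (U ω)) 2 P := by
  have hcont := hf.continuous
  obtain ⟨K, hK, h⟩ := hf
  have h1 : MemLp (fun ω => K * ‖U ω‖ + ‖f 0‖) 2 P := (hU.norm.const_mul K).add (memLp_const _)
  refine h1.mono (hcont.comp_aestronglyMeasurable hU.1) (Filter.Eventually.of_forall fun ω => ?_)
  rw [Real.norm_of_nonneg (by positivity)]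
  have h2 := h (U ω) 0
  rw [sub_zero] at h2
  calc ‖f (U ω)‖ = ‖(f (U ω) - f 0) + f 0‖ := by rw [sub_add_cancel]
    _ ≤ _ := norm_add_le _ _
    _ ≤ _ := by gcongr

end IsLip

theorem isLip_fst : IsLip fun u : Tri dx dy => u.fst :=
  ⟨1, zero_le_one, fun u u' => by rw [one_mul]; exact norm_tri_fst_le (u - u')⟩

theorem isLip_snd : IsLip fun u : Tri dx dy => u.snd :=
  ⟨1, zero_le_one, fun u u' => by rw [one_mul]; exact norm_tri_snd_le (u - u')⟩

theorem IsLip.tri {E : Type*} [NormedAddCommGroup E] {f : E → Pair dx dy} {g : E → Vec dy}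
    (hf : IsLip f) (hg : IsLip g) : IsLip fun u => tri (f u) (g u) := by
  obtain ⟨K, hK, h⟩ := hf
  obtain ⟨K', hK', h'⟩ := hg
  refine ⟨K + K', by positivity, fun u u' => ?_⟩
  rw [tri_sub_tri, add_mul]
  exact (norm_tri_le _ _).trans (add_le_add (h u u') (h' u u'))

theorem Regular.isLip_F (h : Regular pb L₁ L₂ γ μ₀ c Flow) : IsLip (∇ pb.F) :=
  ⟨L₁, h.nonneg₁, h.smooth.lip_F h.pos h.nonneg₁⟩

theorem Regular.isLip_G (h : Regular pb L₁ L₂ γ μ₀ c Flow) : IsLip (∇ pb.G) :=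
  ⟨L₂, h.pos₂.le, h.smooth.lip_G h.pos h.pos₂⟩

theorem Regular.isLip_thetaStar (h : Regular pb L₁ L₂ γ μ₀ c Flow) : IsLip (pb.thetaStar γ) := by
  refine ⟨Lθ L₂ γ, ?_, h.smooth.thetaStar_lipschitz h.pos h.pos₂ h.mem⟩
  have := eta_pos h.pos₂ h.mem
  unfold Lθ
  positivity

theorem isLip_dir {c γ μ : ℝ} (hc : 0 ≤ c) (hγ : 0 < γ) (hμ : 0 ≤ μ) {f' g' : Pair dx dy → Pair dx dy}
    (hf : IsLip f') (hg : IsLip g') : IsLip (dir c γ μ f' g') := by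
  obtain ⟨K, hK, h⟩ := hf
  obtain ⟨K', hK', h'⟩ := hg
  refine ⟨dirLip K K' γ μ c, ?_, norm_dir_sub_le hK hK' hγ hc hμ le_rfl h h'⟩
  unfold dirLip
  positivity

theorem isLip_envGradZ {γ : ℝ} (hγ : 0 < γ) {g' : Pair dx dy → Pair dx dy} (hg : IsLip g') :
    IsLip fun u : Tri dx dy => envGradZ g' γ u.fst u.snd := by
  -- For c = 1 and μ = 0 the z-part of the direction is g' minus the field in question, which is
  -- therefore recovered by subtraction.
  have h1 := isLip_fst.comp (isLip_dir (c := 1) (μ := 0) zero_le_one hγ le_rfl hg hg)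
  have h2 := (hg.comp isLip_fst).sub h1
  simpa [dir] using h2

theorem Regular.isLip_psiGrad (h : Regular pb L₁ L₂ γ μ₀ c Flow) (μ : ℝ) :
    IsLip (psiGrad pb γ μ) := by
  have h1 := (isLip_envGradZ h.gamma_pos h.isLip_G).comp
    (IsLip.tri (IsLip.id (E := Pair dx dy)) h.isLip_thetaStar)
  exact ((h.isLip_F.const_smul μ).add h.isLip_G).sub h1

theorem Regular.isLip_potGrad (h : Regular pb L₁ L₂ γ μ₀ c Flow) (μ : ℝ) :
    IsLip (potGrad pb γ μ) := by
  have h1 := (isLip_envGradZ h.gamma_pos h.isLip_G).comp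
    (IsLip.tri (IsLip.id (E := Pair dx dy)) h.isLip_thetaStar)
  have h2 := isLip_snd.comp (isLip_dir (c := 1) (μ := 0) zero_le_one h.gamma_pos le_rfl h.isLip_F
    h.isLip_G)
  exact IsLip.tri (((h.isLip_psiGrad μ).comp isLip_fst).add
    ((isLip_envGradZ h.gamma_pos h.isLip_G).sub (h1.comp isLip_fst))) h2

theorem integrable_norm_sq {Ω E : Type*} [MeasurableSpace Ω] {P : Measure Ω}
    [NormedAddCommGroup E] {U : Ω → E} (hU : MemLp U 2 P) : Integrable (fun ω => ‖U ω‖ ^ 2) P :=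
  MemLp.integrable_norm_pow (p := 2) hU two_ne_zero

theorem Regular.integrable_stat (h : Regular pb L₁ L₂ γ μ₀ c Flow) {Ω : Type*} [MeasurableSpace Ω]
    {P : Measure Ω} [IsFiniteMeasure P] (μ : ℝ) {U : Ω → Tri dx dy} (hU : MemLp U 2 P) :
    Integrable (fun ω => stat pb γ μ (U ω)) P :=
  (integrable_norm_sq (((h.isLip_psiGrad μ).comp isLip_fst).memLp hU)).add
    (integrable_norm_sq ((isLip_snd.sub (h.isLip_thetaStar.comp isLip_fst)).memLp hU))

/-- The expansion at 0 gives quadratic growth from above, and nonnegativity makes a lower estimate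
unnecessary. -/
theorem Regular.integrable_pot (h : Regular pb L₁ L₂ γ μ₀ c Flow) {Ω : Type*} [MeasurableSpace Ω]
    {P : Measure Ω} [IsFiniteMeasure P] {μ : ℝ} (hμ : 0 ≤ μ) (hμ' : μ ≤ μ₀) {U : Ω → Tri dx dy}
    (hU : MemLp U 2 P) : Integrable (fun ω => pot pb γ Flow μ (U ω)) P := by
  have hq := h.quadApprox_pot hμ hμ'
  set g := potGrad pb γ μ 0
  set K := potConst L₁ L₂ γ μ₀
  have h1 : Integrable (fun ω => pot pb γ Flow μ 0 + ‖g‖ * ‖U ω‖ + K * ‖U ω‖ ^ 2) P :=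
    ((integrable_const _).add ((hU.integrable one_le_two).norm.const_mul _)).add
      ((integrable_norm_sq hU).const_mul _)
  refine h1.mono (hq.continuous.comp_aestronglyMeasurable hU.1)
    (Filter.Eventually.of_forall fun ω => ?_)
  rw [Real.norm_of_nonneg (h.pot_nonneg hμ _)]
  refine le_trans ?_ (le_abs_self _)
  have h2 := (abs_le.mp (hq 0 (U ω))).2
  rw [sub_zero] at h2
  have h3 := real_inner_le_norm g (U ω)
  change _ - _ - inner ℝ g (U ω) ≤ _ at h2
  linarith

end Potential

/-! ### Coupled recursions -/

section Sequences

open Finset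

theorem mul_sum_add_le_of_contraction {a b : ℕ → ℝ} {β : ℝ}
    (h : ∀ k, a (k + 1) ≤ (1 - β) * a k + b k) (K : ℕ) :
    β * ∑ k ∈ range K, a k + a K ≤ a 0 + ∑ k ∈ range K, b k := by
  induction K with
  | zero => simp
  | succ K ih =>
    rw [sum_range_succ, sum_range_succ]
    linarith [h K]

/-- The telescoped inequality retains a full last term, which for β ≤ 1 pays for one more summand on
the left. Sums of K + 1 errors thus use only K recursions. -/
theorem mul_sum_le_of_contraction {a b : ℕ → ℝ} {β : ℝ} (ha : ∀ k, 0 ≤ a k) (hβ : β ≤ 1)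
    (h : ∀ k, a (k + 1) ≤ (1 - β) * a k + b k) (K : ℕ) :
    β * ∑ k ∈ range (K + 1), a k ≤ a 0 + ∑ k ∈ range K, b k := by
  have h1 := mul_sum_add_le_of_contraction h K
  rw [sum_range_succ]
  nlinarith [ha K]

theorem sum_range_succ_shift_le {X : ℕ → ℝ} (hX : ∀ k, 0 ≤ X k) (K : ℕ) :
    ∑ k ∈ range K, X (k + 1) ≤ ∑ k ∈ range (K + 1), X k := by
  rw [sum_range_succ' X]
  linarith [hX 0]

theorem sum_range_le_succ {X : ℕ → ℝ} (hX : ∀ k, 0 ≤ X k) (K : ℕ) :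
    ∑ k ∈ range K, X k ≤ ∑ k ∈ range (K + 1), X k := by
  rw [sum_range_succ]
  linarith [hX K]

/-- The contribution of the varying penalty parameters. -/
theorem sum_sq_mul_le {C Q : ℝ} {X Z m P : ℕ → ℝ} (hC : 1 ≤ C) (hQ : 0 ≤ Q)
    (hX : ∀ k, 0 ≤ X k) (hP : ∀ k, 0 ≤ P k) (hm0 : ∀ k, 0 ≤ m k)
    (hm : ∀ k : ℕ, ((k : ℝ) + 1) * m k ≤ C)
    (hmsum : ∀ K, ∑ k ∈ range K, m k ≤ C)
    (hZ : ∀ k : ℕ, Z k ≤ k * ∑ j ∈ range k, P j) (K : ℕ) :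
    ∑ k ∈ range K, m k ^ 2 * (Q + X k + Z k)
      ≤ C ^ 2 * (Q + ∑ k ∈ range K, X k + ∑ k ∈ range K, P k) := by
  set R := ∑ k ∈ range K, P k
  have hR : 0 ≤ R := sum_nonneg fun k _ => hP k
  have hmC : ∀ k, m k ≤ C := fun k => by
    have : 0 ≤ (k : ℝ) * m k := mul_nonneg (Nat.cast_nonneg k) (hm0 k)
    linarith [hm k]
  have hterm : ∀ k ∈ range K, m k ^ 2 * (Q + X k + Z k) ≤ C * m k * (Q + R) + C ^ 2 * X k := by
    intro k hk
    have hk' : ∑ j ∈ range k, P j ≤ R :=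
      sum_le_sum_of_subset_of_nonneg (range_mono (mem_range.mp hk).le) fun i _ _ => hP i
    have hZk : Z k ≤ k * R := (hZ k).trans (by gcongr)
    have h0 := hm0 k
    have h1 : m k ^ 2 * Q ≤ C * m k * Q := by
      rw [pow_two]; gcongr; exact hmC k
    have h2 : m k ^ 2 * X k ≤ C ^ 2 * X k := by
      have := hX k
      gcongr
      exact hmC k
    -- One factor m k compensates the growth factor k of the displacement; the other is kept, since
    -- its sum telescopes.
    have h3 : m k ^ 2 * Z k ≤ C * m k * R := by
      calc m k ^ 2 * Z k ≤ m k ^ 2 * (k * R) := by gcongr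
        _ = (k * m k) * m k * R := by ring
        _ ≤ C * m k * R := by
          gcongr
          linarith [hm k]
    linarith
  calc _ ≤ ∑ k ∈ range K, (C * m k * (Q + R) + C ^ 2 * X k) := sum_le_sum hterm
    _ = C * (∑ k ∈ range K, m k) * (Q + R) + C ^ 2 * ∑ k ∈ range K, X k := by
        rw [sum_add_distrib, ← sum_mul, ← mul_sum, ← mul_sum]
    _ ≤ C * C * (Q + R) + C ^ 2 * ∑ k ∈ range K, X k := by
        gcongr; exact hmsum K
    _ = _ := by ring

/-- Elimination of the accumulated tracking error. -/
theorem consensus_sum_bound {C β lam s q K X₀ D₀ SX SS SD Q : ℝ} (hC : 1 ≤ C) (hβ : 0 < β)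
    (hlam : 0 < lam) (hlam1 : lam ≤ 1) (hKs0 : 0 ≤ K * s) (hq0 : 0 ≤ q) (hqK : q ≤ K * s)
    (hSX : 0 ≤ SX) (hSS : 0 ≤ SS) (hQ0 : 0 ≤ Q)
    (hX : β * SX ≤ X₀ + C / β * lam ^ 2 * SD)
    (hD : β * SD ≤ D₀ + C / β * (2 * SX + lam ^ 2 * (SS + SX + q) + K * s
      + C ^ 2 * (Q + SX + C * lam ^ 2 * (SS + SX + q)))) :
    SX ≤ X₀ / β + C * (lam ^ 2 * D₀ / β ^ 3)
      + 6 * C ^ 5 * (lam ^ 2 / β ^ 4) * (SX + lam ^ 2 * SS + K * s + Q) := by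
  have hC0 : 0 < C := by linarith
  -- `M` collects all that drives the tracking error apart from its initial value; powers of C ≥ 1
  -- are rounded up so that one multiple of `M` bounds every term.
  set M := SX + lam ^ 2 * SS + K * s + Q with hM
  have hlam2 : lam ^ 2 ≤ 1 := pow_le_one₀ hlam.le hlam1
  have hR : lam ^ 2 * (SS + SX + q) ≤ lam ^ 2 * SS + SX + K * s := by
    have h1 : lam ^ 2 * SX ≤ 1 * SX := by gcongr
    have h2 : lam ^ 2 * q ≤ 1 * (K * s) := by gcongr
    linarith
  have hC2 : 1 ≤ C ^ 2 := one_le_pow₀ hC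
  have hC3 : C ^ 2 ≤ C ^ 3 := pow_le_pow_right₀ hC (by norm_num)
  have hM0 : 0 ≤ M := by positivity
  have hlS : 0 ≤ lam ^ 2 * SS := by positivity
  have hD' : β * SD ≤ D₀ + 6 * C ^ 4 / β * M := by
    have h1 : 2 * SX + lam ^ 2 * (SS + SX + q) + K * s
        + C ^ 2 * (Q + SX + C * lam ^ 2 * (SS + SX + q)) ≤ 6 * C ^ 3 * M := by
      have h2 : C ^ 2 * (C * lam ^ 2 * (SS + SX + q)) ≤ C ^ 3 * (lam ^ 2 * SS + SX + K * s) := by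
        calc C ^ 2 * (C * lam ^ 2 * (SS + SX + q)) = C ^ 3 * (lam ^ 2 * (SS + SX + q)) := by ring
          _ ≤ _ := by gcongr
      have h3 : 2 * SX + lam ^ 2 * (SS + SX + q) + K * s ≤ 3 * M := by
        rw [hM]; linarith
      have h4 : 3 * M ≤ 3 * C ^ 3 * M := by nlinarith
      have h5 : C ^ 2 * (Q + SX) ≤ C ^ 3 * M := by
        have : Q + SX ≤ M := by rw [hM]; linarith
        gcongr
      have h6 : C ^ 3 * (lam ^ 2 * SS + SX + K * s) ≤ C ^ 3 * M := by
        gcongr; rw [hM]; linarith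
      have h7 : 0 ≤ C ^ 3 * M := by positivity
      linarith
    have h8 : C / β * (2 * SX + lam ^ 2 * (SS + SX + q) + K * s
        + C ^ 2 * (Q + SX + C * lam ^ 2 * (SS + SX + q))) ≤ C / β * (6 * C ^ 3 * M) := by gcongr
    have h9 : C / β * (6 * C ^ 3 * M) = 6 * C ^ 4 / β * M := by ring
    linarith
  have h1 : SD ≤ (D₀ + 6 * C ^ 4 / β * M) / β := by
    rw [le_div_iff₀ hβ]; linarith
  have h2 : SX ≤ (X₀ + C / β * lam ^ 2 * SD) / β := by
    rw [le_div_iff₀ hβ]; linarith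
  have h3 : C / β * lam ^ 2 * SD ≤ C / β * lam ^ 2 * ((D₀ + 6 * C ^ 4 / β * M) / β) := by gcongr
  calc SX ≤ (X₀ + C / β * lam ^ 2 * SD) / β := h2
    _ ≤ (X₀ + C / β * lam ^ 2 * ((D₀ + 6 * C ^ 4 / β * M) / β)) / β := by gcongr
    _ = _ := by field_simp; ring

set_option maxHeartbeats 1000000 in
/-- Final bootstrapping between the accumulated stationarity and consensus errors. -/
theorem bootstrap_bound {C κ β lam y s q K N T₀ X₀ D₀ SX SS SD Q : ℝ} (hC : 1 ≤ C)
    (hκ : κ = 1 / (100 * C ^ 7)) (hβ : 0 < β) (hβ1 : β ≤ 1) (hlam : 0 < lam)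
    (hlamκ : lam ≤ κ * β ^ 4) (hy : y = lam ^ 2 / β ^ 4) (hs : 0 ≤ s) (hN : 1 ≤ N) (hK : 1 ≤ K)
    (hT₀ : 0 ≤ T₀) (hX₀ : 0 ≤ X₀) (hD₀ : 0 ≤ D₀) (hSX : 0 ≤ SX) (hSS : 0 ≤ SS)
    (hq : q = K * s / N) (hQ : Q ≤ C * (D₀ + X₀ + T₀ + s))
    (hT : lam / C * SS ≤ T₀ + C * lam * SX + C * lam ^ 2 * (SS + SX + q))
    (hX : β * SX ≤ X₀ + C / β * lam ^ 2 * SD)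
    (hD : β * SD ≤ D₀ + C / β * (2 * SX + lam ^ 2 * (SS + SX + q) + K * s
      + C ^ 2 * (Q + SX + C * lam ^ 2 * (SS + SX + q)))) (hQ0 : 0 ≤ Q) :
    lam * (SS + SX) ≤ 300 * C ^ 8 * (T₀ + lam * X₀ / β + lam ^ 2 * D₀ / β ^ 3
      + K * lam ^ 2 * s / N + K * lam ^ 3 * s / β ^ 4) := by
  have hC0 : 0 < C := by linarith
  have hκ0 : 0 < κ := by rw [hκ]; positivity
  have hC7 : 1 ≤ C ^ 7 := one_le_pow₀ hC
  have hκC : 100 * C ^ 7 * κ = 1 := by rw [hκ]; field_simp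
  -- The exponent 7 is dictated by the circuit from the stationarity sum through the consensus sum
  -- and back, which costs 24 C⁷κ. All smaller powers are then harmless too.
  have hCκ7 : C ^ 7 * κ = 1 / 100 := by linarith
  have hpow : ∀ j ≤ 7, C ^ j * κ ≤ 1 / 100 := fun j hj => by
    rw [← hCκ7]; gcongr
  have hκ1 : κ ≤ 1 / 100 := by simpa using hpow 0 (by norm_num)
  have hβ4 : β ^ 4 ≤ 1 := pow_le_one₀ hβ.le hβ1
  have hlam_κ : lam ≤ κ := hlamκ.trans (mul_le_of_le_one_right hκ0.le hβ4)
  have hlam1 : lam ≤ 1 := by linarith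
  have hlamβ : lam ≤ β ^ 4 := hlamκ.trans (mul_le_of_le_one_left (by positivity) (by linarith))
  have hlamβ1 : lam ≤ β := hlamβ.trans (by
    calc β ^ 4 ≤ β ^ 1 := pow_le_pow_of_le_one hβ.le hβ1 (by norm_num)
      _ = β := pow_one β)
  have hy0 : 0 ≤ y := by rw [hy]; positivity
  -- The condition lam ≤ κβ⁴ makes y = lam²/β⁴, the gain of the consensus loop, smaller than lam
  -- itself.
  have hyκ : y ≤ κ * lam := by
    rw [hy, div_le_iff₀ (by positivity), pow_two]
    calc lam * lam ≤ (κ * β ^ 4) * lam := by gcongr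
      _ = _ := by ring
  have hyκ2 : y ≤ κ := hyκ.trans (mul_le_of_le_one_right hκ0.le hlam1)
  have hy1 : y ≤ 1 := by linarith
  have hq0 : 0 ≤ q := by rw [hq]; positivity
  have hqK : q ≤ K * s := by
    rw [hq]
    exact div_le_self (by positivity) hN
  have hKs : s ≤ K * s := le_mul_of_one_le_left hs hK
  have hKs0 : 0 ≤ K * s := by positivity
  have hlS : 0 ≤ lam ^ 2 * SS := by positivity
  -- bound of the accumulated consensus error
  set x₀ := X₀ / β with hx₀
  set d₀ := lam ^ 2 * D₀ / β ^ 3 with hd₀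
  have hx0 : 0 ≤ x₀ := by positivity
  have hd0 : 0 ≤ d₀ := by positivity
  have hSX1 : SX ≤ x₀ + C * d₀ + 6 * C ^ 5 * y * (SX + lam ^ 2 * SS + K * s + Q) := by
    rw [hx₀, hd₀, hy]
    exact consensus_sum_bound hC hβ hlam hlam1 hKs0 hq0 hqK hSX hSS hQ0 hX hD
  have hSX2 : SX ≤ 2 * x₀ + 2 * C * d₀ + 12 * C ^ 5 * y * (lam ^ 2 * SS + K * s + Q) := by
    -- First absorption: half of the consensus sum returns to the left-hand side.
    have h1 : 6 * C ^ 5 * y * SX ≤ 1 / 2 * SX := by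
      gcongr
      have : C ^ 5 * y ≤ C ^ 5 * κ := by gcongr
      linarith [hpow 5 (by norm_num)]
    have h2 : 6 * C ^ 5 * y * (SX + lam ^ 2 * SS + K * s + Q)
        = 6 * C ^ 5 * y * SX + 6 * C ^ 5 * y * (lam ^ 2 * SS + K * s + Q) := by ring
    linarith
  set B := T₀ + lam * X₀ / β + d₀ + K * lam ^ 3 * s / β ^ 4 with hB
  have eB : B = T₀ + lam * x₀ + d₀ + lam * y * (K * s) := by
    rw [hB, hx₀, hy]; ring
  have hlx : 0 ≤ lam * x₀ := by positivity
  have hly : 0 ≤ lam * y * (K * s) := by positivity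
  have hB0 : 0 ≤ B := by rw [eB]; positivity
  -- The initial dispersion occurs multiplied by lam · y. Together with lam ≤ β this turns each
  -- initial quantity into its weighted form in `B`.
  have hyQ : lam * y * Q ≤ C * B := by
    have h1 : lam * y * D₀ ≤ d₀ := by
      rw [hd₀, hy, show lam * (lam ^ 2 / β ^ 4) * D₀ = lam ^ 2 * D₀ / β ^ 3 * (lam / β) by
        field_simp]
      have : lam / β ≤ 1 := by rw [div_le_one hβ]; exact hlamβ1
      exact mul_le_of_le_one_right (by positivity) this
    have h2 : lam * y * X₀ ≤ lam * x₀ := by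
      have : y * X₀ ≤ x₀ := by
        rw [hx₀, le_div_iff₀ hβ]
        have : y * β ≤ 1 := mul_le_one₀ hy1 hβ.le hβ1
        calc y * X₀ * β = y * β * X₀ := by ring
          _ ≤ 1 * X₀ := by gcongr
          _ = X₀ := one_mul _
      rw [mul_assoc]
      gcongr
    have h3 : lam * y * T₀ ≤ T₀ := by
      exact mul_le_of_le_one_left hT₀ (mul_le_one₀ hlam1 hy0 hy1)
    have h4 : lam * y * s ≤ lam * y * (K * s) := by gcongr
    calc lam * y * Q ≤ lam * y * (C * (D₀ + X₀ + T₀ + s)) := by gcongr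
      _ = C * (lam * y * D₀ + lam * y * X₀ + lam * y * T₀ + lam * y * s) := by ring
      _ ≤ C * B := by
        gcongr
        rw [eB]; linarith
  have hC5 : C ^ 5 ≤ C ^ 6 := pow_le_pow_right₀ hC (by norm_num)
  have hC16 : C ≤ C ^ 6 := le_self_pow₀ hC (by norm_num)
  have hC06 : 1 ≤ C ^ 6 := one_le_pow₀ hC
  have hlamSX : lam * SX ≤ 28 * C ^ 6 * B + 12 * C ^ 5 * κ * (lam * SS) := by
    have h1 : lam * SX ≤ lam * (2 * x₀ + 2 * C * d₀ + 12 * C ^ 5 * y * (lam ^ 2 * SS + K * s + Q)) := by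
      gcongr
    have h2 : lam * (2 * x₀ + 2 * C * d₀ + 12 * C ^ 5 * y * (lam ^ 2 * SS + K * s + Q))
        = 2 * (lam * x₀) + 2 * C * (lam * d₀) + 12 * C ^ 5 * (y * (lam * lam * (lam * SS)))
          + 12 * C ^ 5 * (lam * y * (K * s)) + 12 * C ^ 5 * (lam * y * Q) := by ring
    have h3 : 2 * C * (lam * d₀) ≤ 2 * C * (1 * B) := by
      gcongr
      rw [eB]; linarith
    have h4 : 12 * C ^ 5 * (lam * y * (K * s)) ≤ 12 * C ^ 5 * B := by
      gcongr
      rw [eB]; linarith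
    have h5 : 12 * C ^ 5 * (lam * y * Q) ≤ 12 * C ^ 5 * (C * B) := by gcongr
    have h6 : 12 * C ^ 5 * (y * (lam * lam * (lam * SS))) ≤ 12 * C ^ 5 * (κ * (1 * 1 * (lam * SS))) := by
      gcongr
    have h7 : 2 * (lam * x₀) ≤ 2 * B := by rw [eB]; linarith
    have h8 : 2 * B ≤ 2 * C ^ 6 * B := by linarith [mul_le_mul_of_nonneg_right hC06 hB0]
    have h9 : 2 * C * B ≤ 2 * C ^ 6 * B := by gcongr
    have h10 : 12 * C ^ 5 * B ≤ 12 * C ^ 6 * B := by gcongr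
    have h11 : 12 * C ^ 5 * (C * B) = 12 * C ^ 6 * B := by ring
    linarith
  -- bound of the accumulated stationarity measure
  have hT1 : lam * SS ≤ C * T₀ + 2 * C ^ 2 * (lam * SX) + C ^ 2 * κ * (lam * SS)
      + C ^ 2 * (lam ^ 2 * q) := by
    have h1 : lam * SS = C * (lam / C * SS) := by field_simp
    have h2 : C * (lam / C * SS) ≤ C * (T₀ + C * lam * SX + C * lam ^ 2 * (SS + SX + q)) := by gcongr
    have h3 : C ^ 2 * (lam * (lam * SS)) ≤ C ^ 2 * (κ * (lam * SS)) := by gcongr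
    have h4 : C ^ 2 * (lam * (lam * SX)) ≤ C ^ 2 * (1 * (lam * SX)) := by gcongr
    linarith
  -- Second absorption: the stationarity sum on the right has total coefficient 24/100 + 1/100 ≤
  -- 1/2.
  have hT2 : lam * SS ≤ 2 * (57 * C ^ 8 * B + C ^ 2 * (lam ^ 2 * q)) := by
    have h0 : 0 ≤ lam * SS := by positivity
    have h1 : 2 * C ^ 2 * (lam * SX)
        ≤ 2 * C ^ 2 * (28 * C ^ 6 * B + 12 * C ^ 5 * κ * (lam * SS)) := by gcongr
    have h2 : 2 * C ^ 2 * (28 * C ^ 6 * B + 12 * C ^ 5 * κ * (lam * SS))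
      = 56 * C ^ 8 * B + 24 * (C ^ 7 * κ) * (lam * SS) := by ring
    rw [hCκ7] at h2
    have h3 : C ^ 2 * κ * (lam * SS) ≤ 1 / 100 * (lam * SS) := by
      gcongr; exact hpow 2 (by norm_num)
    have h4 : C * T₀ ≤ C ^ 8 * B := by
      have : C ≤ C ^ 8 := le_self_pow₀ hC (by norm_num)
      have h5 : T₀ ≤ B := by rw [eB]; linarith
      gcongr
    linarith
  have hlq : lam ^ 2 * q = K * lam ^ 2 * s / N := by rw [hq]; ring
  have hlq0 : 0 ≤ lam ^ 2 * q := by positivity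
  have hC8 : C ^ 2 ≤ C ^ 8 := pow_le_pow_right₀ hC (by norm_num)
  have hC68 : C ^ 6 ≤ C ^ 8 := pow_le_pow_right₀ hC (by norm_num)
  have g1 : 12 * C ^ 5 * κ * (lam * SS) ≤ 12 / 100 * (lam * SS) := by
    have := hpow 5 (by norm_num)
    gcongr
    linarith
  have g2 : 28 * C ^ 6 * B ≤ 28 * C ^ 8 * B := by gcongr
  have g3 : C ^ 2 * (lam ^ 2 * q) ≤ C ^ 8 * (lam ^ 2 * q) := by gcongr
  have g4 : 0 ≤ C ^ 8 * B := by positivity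
  have g5 : 0 ≤ C ^ 8 * (lam ^ 2 * q) := by positivity
  have eF : T₀ + lam * X₀ / β + d₀ + K * lam ^ 2 * s / N + K * lam ^ 3 * s / β ^ 4
      = B + lam ^ 2 * q := by rw [hlq, hB]; ring
  rw [eF]
  linarith

/-- Accumulated errors of a gradient tracking scheme: `T` is the expected potential, `X` the
consensus error, `D` the tracking error, `S` the measure of stationarity, `Z` the squared distance
of the average from its initial value, and `m` the decrements of the penalty parameters. -/
theorem tracking_sum_le {C : ℝ} (hC : 1 ≤ C) {β lam s N Q : ℝ} {T X D S Z m : ℕ → ℝ}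
    (hβ : 0 < β) (hβ1 : β ≤ 1) (hlam : 0 < lam) (hlamκ : lam ≤ 1 / (100 * C ^ 7) * β ^ 4)
    (hs : 0 ≤ s) (hN : 1 ≤ N) (hQ0 : 0 ≤ Q)
    (hT0 : ∀ k, 0 ≤ T k) (hX0 : ∀ k, 0 ≤ X k) (hD0 : ∀ k, 0 ≤ D k) (hS0 : ∀ k, 0 ≤ S k)
    (hm0 : ∀ k, 0 ≤ m k) (hm : ∀ k : ℕ, ((k : ℝ) + 1) * m k ≤ C)
    (hmsum : ∀ K, ∑ k ∈ range K, m k ≤ C)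
    (hT : ∀ k, T (k + 1) ≤ T k - lam / C * S k + C * lam * X k
      + C * lam ^ 2 * (S k + X k + s / N))
    (hX : ∀ k, X (k + 1) ≤ (1 - β) * X k + C / β * lam ^ 2 * D k)
    (hD : ∀ k, D (k + 1) ≤ (1 - β) * D k + C / β * (X k + X (k + 1)
      + lam ^ 2 * (S k + X k + s / N) + s + m k ^ 2 * (Q + X k + Z k)))
    (hZ : ∀ k : ℕ, Z k ≤ k * ∑ j ∈ range k, C * lam ^ 2 * (S j + X j + s / N))
    (hQ : Q ≤ C * (D 0 + X 0 + T 0 + s)) {K : ℕ} (hK : 0 < K) :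
    lam * (∑ k ∈ range K, S k + ∑ k ∈ range K, X k)
      ≤ 300 * C ^ 8 * (T 0 + lam * X 0 / β + lam ^ 2 * D 0 / β ^ 3
      + K * lam ^ 2 * s / N + K * lam ^ 3 * s / β ^ 4) := by
  -- The two contractive recursions are summed over K - 1 steps to bound sums of K terms, whereas
  -- the potential is telescoped over all K steps.
  obtain ⟨K, rfl⟩ : ∃ K', K = K' + 1 := ⟨K - 1, by omega⟩
  have hC0 : 0 < C := by linarith
  have hN0 : 0 < N := by linarith
  have hE0 : ∀ k, 0 ≤ S k + X k + s / N := fun k => by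
    have := hS0 k; have := hX0 k; positivity
  refine bootstrap_bound (y := lam ^ 2 / β ^ 4) (q := ((K + 1 : ℕ) : ℝ) * s / N)
    (SD := ∑ k ∈ range (K + 1), D k) (Q := Q) hC rfl hβ hβ1 hlam hlamκ rfl hs hN
    (by norm_num) (hT0 0) (hX0 0) (hD0 0)
    (sum_nonneg fun k _ => hX0 k) (sum_nonneg fun k _ => hS0 k) rfl hQ ?_ ?_ ?_ hQ0
  · have h1 : ∀ K : ℕ, T K + lam / C * ∑ k ∈ range K, S k ≤ T 0 + C * lam * ∑ k ∈ range K, X k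
        + C * lam ^ 2 * (∑ k ∈ range K, S k + ∑ k ∈ range K, X k + K * s / N) := by
      intro K
      induction K with
      | zero => simp
      | succ K ih =>
        rw [sum_range_succ, sum_range_succ]
        have := hT K
        have e : ((K + 1 : ℕ) : ℝ) * s / N = K * s / N + s / N := by push_cast; ring
        rw [e]
        linarith
    linarith [h1 (K + 1), hT0 (K + 1)]
  · have h1 := mul_sum_le_of_contraction hX0 hβ1 hX K
    have h2 : ∑ k ∈ range K, C / β * lam ^ 2 * D k ≤ C / β * lam ^ 2 * ∑ k ∈ range (K + 1), D k := by
      rw [← mul_sum]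
      exact mul_le_mul_of_nonneg_left (sum_range_le_succ hD0 K) (by positivity)
    linarith
  · have h1 := mul_sum_le_of_contraction hD0 hβ1 hD K
    refine h1.trans ?_
    rw [← mul_sum, sum_add_distrib, sum_add_distrib, sum_add_distrib, sum_add_distrib]
    have e : ∀ K : ℕ, ∑ k ∈ range K, (S k + X k + s / N)
        = ∑ k ∈ range K, S k + ∑ k ∈ range K, X k + K * s / N := by
      intro K
      rw [sum_add_distrib, sum_add_distrib, sum_const, card_range, nsmul_eq_mul]; ring
    have a1 := sum_range_le_succ hX0 K
    have a2 := sum_range_succ_shift_le hX0 K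
    have a3 := sum_range_le_succ hE0 K
    have a4 : ∑ k ∈ range K, s ≤ ((K + 1 : ℕ) : ℝ) * s := by
      rw [sum_const, card_range, nsmul_eq_mul]
      gcongr; norm_num
    have a5 := sum_sq_mul_le (P := fun j => C * lam ^ 2 * (S j + X j + s / N)) hC hQ0 hX0
      (fun k => by have := hE0 k; positivity) hm0 hm hmsum hZ K
    have a6 : ∑ k ∈ range K, lam ^ 2 * (S k + X k + s / N)
        ≤ lam ^ 2 * ∑ k ∈ range (K + 1), (S k + X k + s / N) := by
      rw [← mul_sum]; gcongr
    rw [← mul_sum] at a5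
    have a7 : C ^ 2 * (Q + ∑ k ∈ range K, X k
          + C * lam ^ 2 * ∑ k ∈ range K, (S k + X k + s / N))
        ≤ C ^ 2 * (Q + ∑ k ∈ range (K + 1), X k
          + C * lam ^ 2 * ∑ k ∈ range (K + 1), (S k + X k + s / N)) := by gcongr
    rw [e (K + 1)] at a6 a7
    gcongr
    · linarith
    · exact a5.trans a7

end Sequences

/-! ### The algorithm in the joint variable -/

section Joint

variable {n dx dy : ℕ} {Ξf Ξg : Type*} [MeasurableSpace Ξf] [MeasurableSpace Ξg]

theorem tri_ext {u u' : Tri dx dy} (hx : u.fst.fst = u'.fst.fst) (hy : u.fst.snd = u'.fst.snd)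
    (hθ : u.snd = u'.snd) : u = u' := by
  have : ∀ w : Tri dx dy, w = tri (pt w.fst.fst w.fst.snd) w.snd := fun _ => rfl
  rw [this u, this u', hx, hy, hθ]

/-- The joint iterate of agent `i`. -/
noncomputable def point (s : State n dx dy) (i : Fin n) : Tri dx dy := tri (pt (s.x i) (s.y i)) (s.θ i)

/-- The joint tracker `(c D_x, c D_y, D_θ)` of agent `i`. -/
noncomputable def tracker (c : ℝ) (s : State n dx dy) (i : Fin n) : Tri dx dy :=
  tri (pt (c • s.Dx i) (c • s.Dy i)) (s.Dθ i)

/-- The joint stochastic direction `(c D̂_x, c D̂_y, D̂_θ)` of agent `i`. -/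
noncomputable def estimate (c : ℝ) (s : State n dx dy) (i : Fin n) : Tri dx dy :=
  tri (pt (c • s.Hx i) (c • s.Hy i)) (s.Hθ i)

/-- The joint stochastic direction as a function of the joint iterate and the sample. -/
noncomputable def sampleDir (pb : Problem n dx dy Ξf Ξg) (c γ μ : ℝ) (i : Fin n) (u : Tri dx dy)
    (ξ : Ξf × Ξg) : Tri dx dy :=
  dir c γ μ (∇ fun z => pb.lossF i z ξ.1) (∇ fun z => pb.lossG i z ξ.2) u

/-- The joint exact direction. -/
noncomputable def exactDir (pb : Problem n dx dy Ξf Ξg) (c γ μ : ℝ) (i : Fin n) (u : Tri dx dy) :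
    Tri dx dy :=
  dir c γ μ (∇ (pb.f i)) (∇ (pb.g i)) u

theorem gossip_fst (W : Matrix (Fin n) (Fin n) ℝ) (v : Fin n → Tri dx dy) (i : Fin n) :
    (gossip W v i).fst = gossip W (fun j => (v j).fst) i :=
  (congrFun (gossip_map W (WithLp.fstₗ 2 ℝ (Pair dx dy) (Vec dy)) v) i).symm

theorem gossip_snd (W : Matrix (Fin n) (Fin n) ℝ) (v : Fin n → Tri dx dy) (i : Fin n) :
    (gossip W v i).snd = gossip W (fun j => (v j).snd) i :=
  (congrFun (gossip_map W (WithLp.sndₗ 2 ℝ (Pair dx dy) (Vec dy)) v) i).symm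

theorem gossip_pair_fst (W : Matrix (Fin n) (Fin n) ℝ) (v : Fin n → Pair dx dy) (i : Fin n) :
    (gossip W v i).fst = gossip W (fun j => (v j).fst) i :=
  (congrFun (gossip_map W (WithLp.fstₗ 2 ℝ (Vec dx) (Vec dy)) v) i).symm

theorem gossip_pair_snd (W : Matrix (Fin n) (Fin n) ℝ) (v : Fin n → Pair dx dy) (i : Fin n) :
    (gossip W v i).snd = gossip W (fun j => (v j).snd) i :=
  (congrFun (gossip_map W (WithLp.sndₗ 2 ℝ (Vec dx) (Vec dy)) v) i).symm

theorem spread_tri (v : Fin n → Tri dx dy) :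
    spread v = disp (fun i => (v i).fst.fst) + disp (fun i => (v i).fst.snd)
      + disp (fun i => (v i).snd) := by
  have h1 : (mean v).fst = mean fun i => (v i).fst :=
    (mean_map (WithLp.fstₗ 2 ℝ (Pair dx dy) (Vec dy)) v).symm
  have h2 : (mean v).snd = avg fun i => (v i).snd :=
    (mean_map (WithLp.sndₗ 2 ℝ (Pair dx dy) (Vec dy)) v).symm
  have h3 : (mean v).fst.fst = avg fun i => (v i).fst.fst := by
    rw [h1]; exact (mean_map (WithLp.fstₗ 2 ℝ (Vec dx) (Vec dy)) _).symm
  have h4 : (mean v).fst.snd = avg fun i => (v i).fst.snd := by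
    rw [h1]; exact (mean_map (WithLp.sndₗ 2 ℝ (Vec dx) (Vec dy)) _).symm
  have e : ∀ i, ‖v i - mean v‖ ^ 2 = ‖(v i).fst.fst - avg fun i => (v i).fst.fst‖ ^ 2
      + ‖(v i).fst.snd - avg fun i => (v i).fst.snd‖ ^ 2
      + ‖(v i).snd - avg fun i => (v i).snd‖ ^ 2 := by
    intro i
    rw [WithLp.prod_norm_sq_eq_of_L2, WithLp.prod_norm_sq_eq_of_L2 (v i - mean v).fst, WithLp.sub_fst,
      WithLp.sub_snd, WithLp.sub_fst, WithLp.sub_snd, h2, h3, h4]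
  unfold spread meanSq disp
  simp_rw [e]
  rw [Finset.sum_add_distrib, Finset.sum_add_distrib]
  ring

theorem spread_point (s : State n dx dy) :
    spread (point s) = disp s.x + disp s.y + disp s.θ := spread_tri _

theorem disp_eq_spread {d : ℕ} (v : Fin n → Vec d) : disp v = spread v := rfl

theorem disp_nonneg {d : ℕ} (v : Fin n → Vec d) : 0 ≤ disp v := spread_nonneg v

theorem spread_tracker (c : ℝ) (s : State n dx dy) :
    spread (tracker c s) = c ^ 2 * disp s.Dx + c ^ 2 * disp s.Dy + disp s.Dθ := by
  rw [disp_eq_spread, disp_eq_spread, ← spread_smul, ← spread_smul]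
  exact spread_tri _

theorem mean_point (s : State n dx dy) : mean (point s) = tri (pt (avg s.x) (avg s.y)) (avg s.θ) := by
  have h1 : (mean (point s)).fst = mean fun i => (point s i).fst :=
    (mean_map (WithLp.fstₗ 2 ℝ (Pair dx dy) (Vec dy)) _).symm
  refine tri_ext ?_ ?_ ?_
  · rw [h1]; exact (mean_map (WithLp.fstₗ 2 ℝ (Vec dx) (Vec dy)) _).symm
  · rw [h1]; exact (mean_map (WithLp.sndₗ 2 ℝ (Vec dx) (Vec dy)) _).symm
  · exact (mean_map (WithLp.sndₗ 2 ℝ (Pair dx dy) (Vec dy)) _).symm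

variable {pb : Problem n dx dy Ξf Ξg} {I : Input n dx dy} {a : Fin n → ℕ → Ξf} {b : Fin n → ℕ → Ξg}

theorem estimate_run_succ (c : ℝ) (k : ℕ) (i : Fin n) :
    estimate c (run pb I a b (k + 1)) i
      = sampleDir pb c I.γ (I.μ k) i (point (run pb I a b k) i) (a i k, b i k) := rfl

theorem track_eq_gossip {d : ℕ} (W : Matrix (Fin n) (Fin n) ℝ) (u v w : Fin n → Vec d) :
    track W u v w = gossip W fun i => u i + (v i - w i) := by
  funext i
  simp only [track, gossip, add_sub_assoc]

theorem mix_eq_gossip {d : ℕ} (W : Matrix (Fin n) (Fin n) ℝ) (lam : ℝ) (u v : Fin n → Vec d) :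
    mix W lam u v = gossip W fun i => u i - lam • v i := rfl

theorem tracker_run_succ (c : ℝ) (k : ℕ) :
    tracker c (run pb I a b (k + 1)) = gossip I.W fun i => tracker c (run pb I a b k) i
      + (estimate c (run pb I a b (k + 1)) i - estimate c (run pb I a b k) i) := by
  have key : ∀ {d : ℕ} (u v w : Fin n → Vec d) (i : Fin n),
      c • track I.W u v w i = gossip I.W (fun j => c • u j + (c • v j - c • w j)) i := by
    intro d u v w i
    rw [track_eq_gossip, ← congrFun (gossip_smul I.W c _) i]
    simp only [smul_add, smul_sub]
  funext i
  refine tri_ext ?_ ?_ ?_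
  · rw [gossip_fst, gossip_pair_fst]; exact key _ _ _ i
  · rw [gossip_fst, gossip_pair_snd]; exact key _ _ _ i
  · rw [gossip_snd]; exact congrFun (track_eq_gossip _ _ _ _) i

theorem tracker_run_zero (c : ℝ) : tracker c (run pb I a b 0) = fun _ => 0 := by
  funext i
  refine tri_ext ?_ ?_ rfl
  · exact smul_zero c
  · exact smul_zero c

theorem estimate_run_zero (c : ℝ) : estimate c (run pb I a b 0) = fun _ => 0 := by
  funext i
  refine tri_ext ?_ ?_ rfl
  · exact smul_zero c
  · exact smul_zero c

/-- Because trackers and directions start from 0, the first tracker is one communication round of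
the first directions. This later allows the initial dispersion of ∇f_i to be read from it. -/
theorem tracker_run_one (c : ℝ) :
    tracker c (run pb I a b 1) = gossip I.W (estimate c (run pb I a b 1)) := by
  rw [tracker_run_succ, tracker_run_zero, estimate_run_zero]
  simp only [zero_add, sub_zero]

/-- The invariant of gradient tracking: mixing preserves averages and the increments telescope,
starting from zero on both sides. -/
theorem mean_tracker_run (hcol : ∀ j, ∑ i, I.W i j = 1) (c : ℝ) (k : ℕ) :
    mean (tracker c (run pb I a b k)) = mean (estimate c (run pb I a b k)) := by
  induction k with
  | zero => rw [tracker_run_zero, estimate_run_zero]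
  | succ k ih => rw [tracker_run_succ, mean_gossip hcol, mean_add, mean_sub, ih]; abel

/-- The ratio c of the learning rates is carried by the tracker, so that the three variables move
with one step size. -/
theorem point_run_succ {c lam : ℝ} {k : ℕ} (hx : I.lamx k = c * lam) (hy : I.lamy k = c * lam)
    (hθ : I.lamθ k = lam) :
    point (run pb I a b (k + 1)) = gossip I.W fun i => point (run pb I a b k) i
      + (-lam) • tracker c (run pb I a b (k + 1)) i := by
  have key : ∀ {d : ℕ} (u v : Fin n → Vec d) (i : Fin n), mix I.W (c * lam) u v i
      = gossip I.W (fun j => u j + (-lam) • c • v j) i := by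
    intro d u v i
    have e : ∀ j, (-lam) • c • v j = -((c * lam) • v j) := fun j => by
      rw [smul_smul, neg_mul, neg_smul, mul_comm]
    simp only [mix, gossip, e, ← sub_eq_add_neg]
  funext i
  refine tri_ext ?_ ?_ ?_
  · rw [gossip_fst, gossip_pair_fst]
    refine Eq.trans ?_ (key _ _ i)
    rw [← hx]; rfl
  · rw [gossip_fst, gossip_pair_snd]
    refine Eq.trans ?_ (key _ _ i)
    rw [← hy]; rfl
  · rw [gossip_snd]
    change mix I.W (I.lamθ k) _ _ i = gossip I.W (fun j => _ + (-lam) • _) i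
    rw [hθ, mix_eq_gossip]
    simp only [neg_smul, ← sub_eq_add_neg]
    rfl

theorem mean_point_run_succ {c lam : ℝ} {k : ℕ} (hcol : ∀ j, ∑ i, I.W i j = 1)
    (hx : I.lamx k = c * lam) (hy : I.lamy k = c * lam) (hθ : I.lamθ k = lam) :
    mean (point (run pb I a b (k + 1))) = mean (point (run pb I a b k))
      + (-lam) • mean (estimate c (run pb I a b (k + 1))) := by
  rw [point_run_succ hx hy hθ, mean_gossip hcol, mean_add, mean_smul, mean_tracker_run hcol]

/-- Recursion of the consensus error. -/
theorem spread_point_run_succ_le {ρ c lam : ℝ} {k : ℕ} (hn : 0 < n) (hW : IsMixing I.W ρ)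
    (hx : I.lamx k = c * lam) (hy : I.lamy k = c * lam) (hθ : I.lamθ k = lam) :
    spread (point (run pb I a b (k + 1))) ≤ ρ * spread (point (run pb I a b k))
      + 2 / (1 - ρ) * lam ^ 2 * spread (tracker c (run pb I a b (k + 1))) := by
  have hρ := hW.rho_lt
  rw [point_run_succ hx hy hθ]
  refine (hW.spread_gossip_add_le hn _ _).trans ?_
  rw [mul_assoc]
  gcongr
  refine (hW.spread_gossip_le_self hn _).trans ?_
  rw [spread_smul, neg_sq]

/-- Recursion of the tracking error. -/
theorem spread_tracker_run_succ_le {ρ c : ℝ} {k : ℕ} (hn : 0 < n) (hW : IsMixing I.W ρ) :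
    spread (tracker c (run pb I a b (k + 1))) ≤ ρ * spread (tracker c (run pb I a b k))
      + 2 / (1 - ρ) * spread (gossip I.W fun i =>
        estimate c (run pb I a b (k + 1)) i - estimate c (run pb I a b k) i) := by
  rw [tracker_run_succ]
  exact hW.spread_gossip_add_le hn _ _

end Joint

/-! ### Stochastic estimates -/

section Noise

variable {Ω : Type*} [MeasurableSpace Ω] {P : Measure Ω} [IsProbabilityMeasure P]
  {S Ξ E : Type*} [MeasurableSpace S] [MeasurableSpace Ξ] [NormedAddCommGroup E]
  [InnerProductSpace ℝ E] [FiniteDimensional ℝ E] [MeasurableSpace E] [BorelSpace E]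

/-- Through the lower Lebesgue integral, integrability is a conclusion; Tonelli's theorem can then
be applied before it is known. -/
theorem integrable_and_integral_le_of_lintegral_le {f : Ω → ℝ} (hf : Measurable f)
    (h0 : ∀ ω, 0 ≤ f ω) {C : ℝ} (hC : 0 ≤ C)
    (h : ∫⁻ ω, ENNReal.ofReal (f ω) ∂P ≤ ENNReal.ofReal C) : Integrable f P ∧ ∫ ω, f ω ∂P ≤ C := by
  have hfin : HasFiniteIntegral f P := by
    rw [hasFiniteIntegral_iff_ofReal (Filter.Eventually.of_forall h0)]
    exact h.trans_lt ENNReal.ofReal_lt_top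
  refine ⟨⟨hf.aestronglyMeasurable, hfin⟩, ?_⟩
  rw [integral_eq_lintegral_of_nonneg_ae (Filter.Eventually.of_forall h0) hf.aestronglyMeasurable]
  exact ENNReal.toReal_le_of_le_ofReal hC h

theorem memLp_two_of_integrable_norm_sq {U : Ω → E} (hU : Measurable U)
    (h : Integrable (fun ω => ‖U ω‖ ^ 2) P) : MemLp U 2 P :=
  (memLp_two_iff_integrable_sq_norm hU.aestronglyMeasurable).mpr h

/-- Second moment of an estimator evaluated at an independent random point. -/
theorem memLp_and_integral_norm_sq_le {N : S → Ξ → E} (hN : Measurable (Function.uncurry N))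
    {U : Ω → S} {ξ : Ω → Ξ} (hU : Measurable U) (hξ : Measurable ξ) (hind : IndepFun U ξ P)
    {C : ℝ} (hC : 0 ≤ C) (hint : ∀ s, Integrable (fun x => ‖N s x‖ ^ 2) (P.map ξ))
    (hvar : ∀ s, ∫ x, ‖N s x‖ ^ 2 ∂(P.map ξ) ≤ C) :
    MemLp (fun ω => N (U ω) (ξ ω)) 2 P ∧ ∫ ω, ‖N (U ω) (ξ ω)‖ ^ 2 ∂P ≤ C := by
  have : IsProbabilityMeasure (P.map ξ) := Measure.isProbabilityMeasure_map hξ.aemeasurable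
  have : IsProbabilityMeasure (P.map U) := Measure.isProbabilityMeasure_map hU.aemeasurable
  have hm : Measurable fun ω => N (U ω) (ξ ω) := hN.comp (hU.prodMk hξ)
  have hφ : Measurable fun q : S × Ξ => ENNReal.ofReal (‖N q.1 q.2‖ ^ 2) :=
    (hN.norm.pow_const 2).ennreal_ofReal
  have key : ∫⁻ ω, ENNReal.ofReal (‖N (U ω) (ξ ω)‖ ^ 2) ∂P ≤ ENNReal.ofReal C := by
    have e1 : ∫⁻ ω, ENNReal.ofReal (‖N (U ω) (ξ ω)‖ ^ 2) ∂P
        = ∫⁻ q, ENNReal.ofReal (‖N q.1 q.2‖ ^ 2) ∂(P.map fun ω => (U ω, ξ ω)) :=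
      (lintegral_map hφ (hU.prodMk hξ)).symm
    rw [e1, hind.map_prod_eq_prod_map_map hU.aemeasurable hξ.aemeasurable,
      lintegral_prod _ hφ.aemeasurable]
    calc ∫⁻ s, ∫⁻ x, ENNReal.ofReal (‖N s x‖ ^ 2) ∂(P.map ξ) ∂(P.map U)
        ≤ ∫⁻ s, ENNReal.ofReal C ∂(P.map U) := by
          refine lintegral_mono fun s => ?_
          rw [← ofReal_integral_eq_lintegral_ofReal (hint s)
            (Filter.Eventually.of_forall fun x => by positivity)]
          exact ENNReal.ofReal_le_ofReal (hvar s)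
      _ = ENNReal.ofReal C := by simp
  obtain ⟨h1, h2⟩ := integrable_and_integral_le_of_lintegral_le (hm.norm.pow_const 2)
    (fun ω => by positivity) hC key
  exact ⟨memLp_two_of_integrable_norm_sq hm h1, h2⟩

theorem integrable_inner_of_memLp {U V : Ω → E} (hU : MemLp U 2 P) (hV : MemLp V 2 P) :
    Integrable (fun ω => inner ℝ (U ω) (V ω)) P := by
  refine ((integrable_norm_sq hU).add (integrable_norm_sq hV)).mono (hU.1.inner hV.1)
    (Filter.Eventually.of_forall fun ω => ?_)
  refine (norm_inner_le_norm (U ω) (V ω)).trans (le_trans ?_ (le_abs_self _))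
  simp only [Pi.add_apply]
  nlinarith [sq_nonneg (‖U ω‖ - ‖V ω‖), sq_nonneg ‖U ω‖, sq_nonneg ‖V ω‖]

/-- An unbiased error is orthogonal to whatever is independent of the sample. -/
theorem integral_inner_eq_zero {N : S → Ξ → E} (hN : Measurable (Function.uncurry N))
    {U : Ω → S} {V : Ω → E} {ξ : Ω → Ξ} (hU : Measurable U) (hV : Measurable V) (hξ : Measurable ξ)
    (hind : IndepFun (fun ω => (U ω, V ω)) ξ P)
    (hint : ∀ s, Integrable (N s) (P.map ξ)) (hmean : ∀ s, ∫ x, N s x ∂(P.map ξ) = 0)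
    (hV2 : MemLp V 2 P) (hN2 : MemLp (fun ω => N (U ω) (ξ ω)) 2 P) :
    ∫ ω, inner ℝ (V ω) (N (U ω) (ξ ω)) ∂P = 0 := by
  have : IsProbabilityMeasure (P.map ξ) := Measure.isProbabilityMeasure_map hξ.aemeasurable
  have hUV := hU.prodMk hV
  have : IsProbabilityMeasure (P.map fun ω => (U ω, V ω)) :=
    Measure.isProbabilityMeasure_map hUV.aemeasurable
  have hφ : Measurable fun q : (S × E) × Ξ => inner ℝ q.1.2 (N q.1.1 q.2) := by
    have h1 : Measurable fun q : (S × E) × Ξ => N q.1.1 q.2 :=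
      hN.comp ((measurable_fst.comp measurable_fst).prodMk measurable_snd)
    exact (measurable_snd.comp measurable_fst).inner h1
  have hpair := hUV.prodMk hξ
  have e1 : ∫ ω, inner ℝ (V ω) (N (U ω) (ξ ω)) ∂P
      = ∫ q, inner ℝ q.1.2 (N q.1.1 q.2) ∂(P.map fun ω => ((U ω, V ω), ξ ω)) :=
    (integral_map hpair.aemeasurable hφ.aestronglyMeasurable).symm
  have hi : Integrable (fun q : (S × E) × Ξ => inner ℝ q.1.2 (N q.1.1 q.2))
      (P.map fun ω => ((U ω, V ω), ξ ω)) := by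
    rw [integrable_map_measure hφ.aestronglyMeasurable hpair.aemeasurable]
    exact integrable_inner_of_memLp hV2 hN2
  -- Independence turns the joint law into a product. Integrating the sample first, with the other
  -- variables frozen, leaves the mean of the error, which is 0.
  rw [hind.map_prod_eq_prod_map_map hUV.aemeasurable hξ.aemeasurable] at e1 hi
  rw [e1, integral_prod _ hi]
  refine integral_eq_zero_of_ae (Filter.Eventually.of_forall fun q => ?_)
  change ∫ x, inner ℝ q.2 (N q.1 x) ∂(P.map ξ) = 0
  rw [integral_inner (hint q.1), hmean, inner_zero_right]

/-- The average of orthogonal errors. -/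
theorem integral_norm_mean_sq_le {n : ℕ} (hn : 0 < n) {s : Fin n → Ω → E}
    (hs : ∀ i, MemLp (s i) 2 P) {C : ℝ} (hC : ∀ i, ∫ ω, ‖s i ω‖ ^ 2 ∂P ≤ C)
    (horth : ∀ i j, i ≠ j → ∫ ω, inner ℝ (s i ω) (s j ω) ∂P = 0) :
    ∫ ω, ‖mean fun i => s i ω‖ ^ 2 ∂P ≤ C / n := by
  have hn' : (0 : ℝ) < n := by positivity
  have e : ∀ ω, ‖mean fun i => s i ω‖ ^ 2
      = ((n : ℝ)⁻¹) ^ 2 * ∑ i, ∑ j, inner ℝ (s i ω) (s j ω) := by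
    intro ω
    rw [mean, norm_smul, mul_pow, Real.norm_of_nonneg (by positivity),
      ← real_inner_self_eq_norm_sq (∑ i, s i ω), sum_inner]
    simp_rw [inner_sum]
  simp_rw [e]
  rw [integral_const_mul, integral_finsetSum _ fun i _ => integrable_finsetSum _ fun j _ =>
    integrable_inner_of_memLp (hs i) (hs j)]
  have e2 : ∀ i, ∫ ω, ∑ j, inner ℝ (s i ω) (s j ω) ∂P ≤ C := by
    intro i
    rw [integral_finsetSum _ fun j _ => integrable_inner_of_memLp (hs i) (hs j),
      Finset.sum_eq_single i]
    · simp_rw [real_inner_self_eq_norm_sq]; exact hC i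
    · intro j _ hj; exact horth i j hj.symm
    · simp
  calc ((n : ℝ)⁻¹) ^ 2 * ∑ i, ∫ ω, ∑ j, inner ℝ (s i ω) (s j ω) ∂P
      ≤ ((n : ℝ)⁻¹) ^ 2 * ∑ _i : Fin n, C := by gcongr with i; exact e2 i
    _ = C / n := by
      simp only [Finset.sum_const, Finset.card_univ, Fintype.card_fin, nsmul_eq_mul]
      field_simp

theorem memLp_mean {n : ℕ} {s : Fin n → Ω → E} (hs : ∀ i, MemLp (s i) 2 P) :
    MemLp (fun ω => mean fun i => s i ω) 2 P :=
  (memLp_finsetSum Finset.univ fun i _ => hs i).const_smul _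

theorem memLp_gossip {n : ℕ} (W : Matrix (Fin n) (Fin n) ℝ) {s : Fin n → Ω → E}
    (hs : ∀ i, MemLp (s i) 2 P) (i : Fin n) :
    MemLp (fun ω => gossip W (fun j => s j ω) i) 2 P :=
  memLp_finsetSum Finset.univ fun j _ => (hs j).const_smul _

theorem integrable_meanSq {n : ℕ} {s : Fin n → Ω → E} (hs : ∀ i, MemLp (s i) 2 P) :
    Integrable (fun ω => meanSq fun i => s i ω) P :=
  (integrable_finsetSum _ fun i _ => integrable_norm_sq (hs i)).const_mul _

theorem integrable_spread {n : ℕ} {s : Fin n → Ω → E} (hs : ∀ i, MemLp (s i) 2 P) :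
    Integrable (fun ω => spread fun i => s i ω) P :=
  integrable_meanSq (s := fun i ω => s i ω - mean fun j => s j ω) fun i =>
    (hs i).sub (memLp_mean hs)

theorem integral_meanSq_le {n : ℕ} (hn : 0 < n) {s : Fin n → Ω → E}
    (hs : ∀ i, MemLp (s i) 2 P) {C : ℝ} (hC : ∀ i, ∫ ω, ‖s i ω‖ ^ 2 ∂P ≤ C) :
    ∫ ω, meanSq (fun i => s i ω) ∂P ≤ C := by
  have hn' : (0 : ℝ) < n := by positivity
  simp only [meanSq]
  rw [integral_const_mul, integral_finsetSum _ fun i _ => integrable_norm_sq (hs i)]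
  calc (n : ℝ)⁻¹ * ∑ i, ∫ ω, ‖s i ω‖ ^ 2 ∂P ≤ (n : ℝ)⁻¹ * ∑ _i : Fin n, C := by
        gcongr with i; exact hC i
    _ = C := by simp [hn'.ne']

end Noise

/-! ### Measurability and independence of the iterates -/

section Measurability

variable {n dx dy : ℕ} {Ξf Ξg : Type*} [MeasurableSpace Ξf] [MeasurableSpace Ξg]

theorem measurable_tri : Measurable fun q : Pair dx dy × Vec dy => tri q.1 q.2 :=
  WithLp.measurable_toLp 2 (Pair dx dy × Vec dy)

theorem measurable_pt : Measurable fun q : Vec dx × Vec dy => pt q.1 q.2 :=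
  WithLp.measurable_toLp 2 (Vec dx × Vec dy)

theorem measurable_fst_pair : Measurable fun z : Pair dx dy => z.fst :=
  measurable_fst.comp (WithLp.measurable_ofLp 2 (Vec dx × Vec dy))

theorem measurable_snd_pair : Measurable fun z : Pair dx dy => z.snd :=
  measurable_snd.comp (WithLp.measurable_ofLp 2 (Vec dx × Vec dy))

theorem measurable_fst_tri : Measurable fun z : Tri dx dy => z.fst :=
  measurable_fst.comp (WithLp.measurable_ofLp 2 (Pair dx dy × Vec dy))

theorem measurable_snd_tri : Measurable fun z : Tri dx dy => z.snd :=
  measurable_snd.comp (WithLp.measurable_ofLp 2 (Pair dx dy × Vec dy))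

/-- Joint measurability of the sample gradients. -/
structure MeasurableGrads (pb : Problem n dx dy Ξf Ξg) : Prop where
  f : ∀ i, Measurable fun q : Pair dx dy × Ξf => ∇ (fun z => pb.lossF i z q.2) q.1
  g : ∀ i, Measurable fun q : Pair dx dy × Ξg => ∇ (fun z => pb.lossG i z q.2) q.1

variable {pb : Problem n dx dy Ξf Ξg}

theorem MeasurableGrads.sampleDir (h : MeasurableGrads pb) (c γ μ : ℝ) (i : Fin n) :
    Measurable (Function.uncurry (sampleDir pb c γ μ i)) := by
  have z : Measurable fun q : Tri dx dy × (Ξf × Ξg) => q.1.fst :=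
    measurable_fst_tri.comp measurable_fst
  have θ : Measurable fun q : Tri dx dy × (Ξf × Ξg) => q.1.snd :=
    measurable_snd_tri.comp measurable_fst
  have x := measurable_fst_pair.comp z
  have y := measurable_snd_pair.comp z
  have ξ : Measurable fun q : Tri dx dy × (Ξf × Ξg) => q.2.1 := measurable_fst.comp measurable_snd
  have ζ : Measurable fun q : Tri dx dy × (Ξf × Ξg) => q.2.2 := measurable_snd.comp measurable_snd
  have f1 := (h.f i).comp (z.prodMk ξ)
  have g1 := (h.g i).comp (z.prodMk ζ)
  have g2 := (h.g i).comp ((measurable_pt.comp (x.prodMk θ)).prodMk ζ)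
  have e1 := measurable_pt.comp ((measurable_fst_pair.comp g2).prodMk ((y.sub θ).const_smul (1 / γ)))
  have e2 := (measurable_snd_pair.comp g2).add ((θ.sub y).const_smul (1 / γ))
  exact measurable_tri.comp (((((f1.const_smul μ).add g1).sub e1).const_smul c).prodMk e2)

theorem measurable_gossip {Ω E : Type*} [MeasurableSpace Ω] [NormedAddCommGroup E]
    [InnerProductSpace ℝ E] [FiniteDimensional ℝ E] [MeasurableSpace E] [BorelSpace E]
    (W : Matrix (Fin n) (Fin n) ℝ) {s : Fin n → Ω → E}
    (hs : ∀ i, Measurable (s i)) (i : Fin n) :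
    Measurable fun ω => gossip W (fun j => s j ω) i :=
  Finset.measurable_fun_sum Finset.univ fun j _ => (hs j).const_smul _

theorem measurable_add_smul {Ω E : Type*} [MeasurableSpace Ω] [NormedAddCommGroup E]
    [InnerProductSpace ℝ E] [FiniteDimensional ℝ E] [MeasurableSpace E] [BorelSpace E] (a : ℝ)
    {u v : Ω → E} (hu : Measurable u) (hv : Measurable v) : Measurable fun ω => u ω + a • v ω :=
  hu.add (hv.const_smul a)

variable {I : Input n dx dy} {Ω : Type*} {ξf : Fin n → ℕ → Ω → Ξf} {ξg : Fin n → ℕ → Ω → Ξg}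

/-- Parameters of the joint recursion with constant learning rates `c lam`, `c lam`, `lam`. -/
structure ConstRates (I : Input n dx dy) (c lam : ℝ) : Prop where
  x : ∀ k, I.lamx k = c * lam
  y : ∀ k, I.lamy k = c * lam
  θ : ∀ k, I.lamθ k = lam

/-- The joint iterate, tracker and direction depend measurably on the samples drawn so far. -/
theorem measurable_iter [MeasurableSpace Ω] (h : MeasurableGrads pb) {c lam : ℝ}
    (hI : ConstRates I c lam) (k : ℕ)
    (hξ : ∀ i j, j < k → Measurable fun ω => (ξf i j ω, ξg i j ω)) (i : Fin n) :
    Measurable (fun ω => point (iter pb I ξf ξg k ω) i) ∧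
    Measurable (fun ω => tracker c (iter pb I ξf ξg k ω) i) ∧
    Measurable (fun ω => estimate c (iter pb I ξf ξg k ω) i) := by
  induction k generalizing i with
  | zero =>
    have e : (fun ω => point (iter pb I ξf ξg 0 ω) i)
        = fun _ => tri (pt (I.x₀ i) (I.y₀ i)) (I.θ₀ i) := rfl
    refine ⟨by rw [e]; exact measurable_const, ?_, ?_⟩
    · simp only [iter, tracker_run_zero]; exact measurable_const
    · simp only [iter, estimate_run_zero]; exact measurable_const
  | succ k ih =>
    have ih := ih fun i j hj => hξ i j (by omega)
    have h3 : ∀ i, Measurable (fun ω => estimate c (iter pb I ξf ξg (k + 1) ω) i) := fun i => by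
      have e : (fun ω => estimate c (iter pb I ξf ξg (k + 1) ω) i)
          = fun ω => Function.uncurry (SunDSBO.sampleDir pb c I.γ (I.μ k) i)
            (point (iter pb I ξf ξg k ω) i, (ξf i k ω, ξg i k ω)) :=
        funext fun ω => estimate_run_succ c k i
      rw [e]
      exact (h.sampleDir c I.γ (I.μ k) i).comp ((ih i).1.prodMk (hξ i k (by omega)))
    have h2 : ∀ i, Measurable (fun ω => tracker c (iter pb I ξf ξg (k + 1) ω) i) := fun i => by
      simp only [iter, tracker_run_succ]
      exact measurable_gossip I.W (fun i => (ih i).2.1.add ((h3 i).sub (ih i).2.2)) i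
    refine ⟨?_, h2 i, h3 i⟩
    have h4 : ∀ i, Measurable fun ω => point (iter pb I ξf ξg k ω) i
        + (-lam) • tracker c (iter pb I ξf ξg (k + 1) ω) i := fun i =>
      measurable_add_smul (-lam) (ih i).1 (h2 i)
    have e : (fun ω => point (iter pb I ξf ξg (k + 1) ω) i)
        = fun ω => gossip I.W (fun i => point (iter pb I ξf ξg k ω) i
          + (-lam) • tracker c (iter pb I ξf ξg (k + 1) ω) i) i :=
      funext fun ω => congrFun (point_run_succ (hI.x k) (hI.y k) (hI.θ k)) i
    rw [e]
    exact measurable_gossip I.W h4 i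

/-- The σ-algebra generated by the samples with index in `S`. -/
@[reducible]
def sampleSigma (ξf : Fin n → ℕ → Ω → Ξf) (ξg : Fin n → ℕ → Ω → Ξg) (S : Set (Fin n × ℕ)) :
    MeasurableSpace Ω :=
  ⨆ q ∈ S, MeasurableSpace.comap (fun ω => (ξf q.1 q.2 ω, ξg q.1 q.2 ω)) inferInstance

theorem measurable_sampleSigma {S : Set (Fin n × ℕ)} {i : Fin n} {j : ℕ} (h : (i, j) ∈ S) :
    Measurable[sampleSigma ξf ξg S] fun ω => (ξf i j ω, ξg i j ω) := by
  rw [measurable_iff_comap_le]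
  exact le_iSup₂_of_le (f := fun (q : Fin n × ℕ) (_ : q ∈ S) =>
    MeasurableSpace.comap (fun ω => (ξf q.1 q.2 ω, ξg q.1 q.2 ω)) inferInstance) (i, j) h le_rfl

variable [MeasurableSpace Ω] {P : Measure Ω}

theorem IsSampling.measurable_pair (hs : IsSampling pb P ξf ξg) (i : Fin n) (j : ℕ) :
    Measurable fun ω => (ξf i j ω, ξg i j ω) := (hs.measurable_f i j).prodMk (hs.measurable_g i j)

/-- Disjoint blocks of an independent family are independent. Measurability for the σ-algebra of a
block replaces an explicit formula for `U` in terms of the samples. -/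
theorem IsSampling.indepFun (hs : IsSampling pb P ξf ξg) {S : Set (Fin n × ℕ)} {i : Fin n} {k : ℕ}
    (hik : (i, k) ∉ S) {E : Type*} [MeasurableSpace E] {U : Ω → E}
    (hU : Measurable[sampleSigma ξf ξg S] U) :
    IndepFun U (fun ω => (ξf i k ω, ξg i k ω)) P := by
  have h1 := (iIndepFun_iff_iIndep _ _ _).mp hs.indep
  have h2 := indep_iSup_of_disjoint (fun q => (hs.measurable_pair q.1 q.2).comap_le) h1
    (S := S) (T := {(i, k)}) (by simpa using hik)
  rw [IndepFun_iff_Indep]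
  refine indep_of_indep_of_le_left (indep_of_indep_of_le_right h2 ?_) hU.comap_le
  simp

end Measurability

/-! ### The error of the stochastic directions -/

theorem measurable_norm_sub_sq {α E : Type*} [MeasurableSpace α] [NormedAddCommGroup E]
    [MeasurableSpace E] [BorelSpace E] [SecondCountableTopology E] {f : α → E} (hf : Measurable f)
    (x : E) : Measurable fun a => ‖f a - x‖ ^ 2 :=
  (hf.sub_const x).norm.pow_const 2

theorem integral_linear_comb_eq_zero {α E E' : Type*} [MeasurableSpace α] {ν : Measure α}
    [NormedAddCommGroup E] [InnerProductSpace ℝ E] [FiniteDimensional ℝ E]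
    [NormedAddCommGroup E'] [InnerProductSpace ℝ E'] [FiniteDimensional ℝ E']
    (A B : E →ₗ[ℝ] E') (r s : ℝ) {a b d : α → E} (ha : Integrable a ν) (hb : Integrable b ν)
    (hd : Integrable d ν) (ha0 : ∫ x, a x ∂ν = 0) (hb0 : ∫ x, b x ∂ν = 0)
    (hd0 : ∫ x, d x ∂ν = 0) :
    Integrable (fun x => A (r • a x + s • b x) + B (d x)) ν ∧
    ∫ x, A (r • a x + s • b x) + B (d x) ∂ν = 0 := by
  have i1 : Integrable (fun x => r • a x + s • b x) ν := (ha.smul r).add (hb.smul s)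
  have e1 : ∫ x, r • a x + s • b x ∂ν = 0 := by
    refine (integral_add (f := fun x => r • a x) (g := fun x => s • b x) (ha.smul r)
      (hb.smul s)).trans ?_
    rw [integral_smul, integral_smul, ha0, hb0, smul_zero, smul_zero, add_zero]
  have i2 : Integrable (fun x => A (r • a x + s • b x)) ν :=
    (LinearMap.toContinuousLinearMap A).integrable_comp i1
  have i3 : Integrable (fun x => B (d x)) ν :=
    (LinearMap.toContinuousLinearMap B).integrable_comp hd
  have e2 : ∫ x, A (r • a x + s • b x) ∂ν = 0 := by
    refine ((LinearMap.toContinuousLinearMap A).integral_comp_comm i1).trans ?_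
    rw [e1, map_zero]
  have e3 : ∫ x, B (d x) ∂ν = 0 := by
    refine ((LinearMap.toContinuousLinearMap B).integral_comp_comm hd).trans ?_
    rw [hd0, map_zero]
  exact ⟨i2.add i3, by rw [integral_add i2 i3, e2, e3, add_zero]⟩

theorem integral_le_of_le_comb {α : Type*} [MeasurableSpace α] {ν : Measure α} {r s t A B D : ℝ}
    (hr : 0 ≤ r) (hs : 0 ≤ s) (ht : 0 ≤ t) {f a b d : α → ℝ} (hf : Measurable f)
    (hf0 : ∀ x, 0 ≤ f x) (ha : Integrable a ν) (hb : Integrable b ν) (hd : Integrable d ν)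
    (haA : ∫ x, a x ∂ν ≤ A) (hbB : ∫ x, b x ∂ν ≤ B) (hdD : ∫ x, d x ∂ν ≤ D)
    (h : ∀ x, f x ≤ r * a x + s * b x + t * d x) :
    Integrable f ν ∧ ∫ x, f x ∂ν ≤ r * A + s * B + t * D := by
  have i2 : Integrable (fun x => r * a x + s * b x) ν := (ha.const_mul r).add (hb.const_mul s)
  have i3 : Integrable (fun x => r * a x + s * b x + t * d x) ν := i2.add (hd.const_mul t)
  have hI : Integrable f ν := i3.mono' hf.aestronglyMeasurable
    (Filter.Eventually.of_forall fun x => by rw [Real.norm_of_nonneg (hf0 x)]; exact h x)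
  refine ⟨hI, (integral_mono hI i3 h).trans ?_⟩
  rw [integral_add i2 (hd.const_mul t), integral_add (ha.const_mul r) (hb.const_mul s),
    integral_const_mul, integral_const_mul, integral_const_mul]
  gcongr

section DirectionNoise

variable {n dx dy : ℕ} {Ξf Ξg : Type*} [MeasurableSpace Ξf] [MeasurableSpace Ξg]
  {pb : Problem n dx dy Ξf Ξg}

/-- The error of the joint stochastic direction. -/
noncomputable def dirNoise (pb : Problem n dx dy Ξf Ξg) (c γ μ : ℝ) (i : Fin n) (u : Tri dx dy)
    (ξ : Ξf × Ξg) : Tri dx dy :=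
  sampleDir pb c γ μ i u ξ - exactDir pb c γ μ i u

/-- The embedding `z ↦ (z, 0)`. -/
noncomputable def upperEmb : Pair dx dy →ₗ[ℝ] Tri dx dy where
  toFun z := tri z 0
  map_add' _ _ := tri_ext rfl rfl (zero_add _).symm
  map_smul' r _ := tri_ext rfl rfl (smul_zero r).symm

/-- The effect on the joint direction of the lower-level gradient at `(x, θ)`. -/
noncomputable def lowerEmb (c : ℝ) : Pair dx dy →ₗ[ℝ] Tri dx dy where
  toFun v := tri (pt ((-c) • v.fst) 0) v.snd
  map_add' _ _ := tri_ext (smul_add _ _ _) (zero_add _).symm rfl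
  map_smul' r _ := tri_ext (smul_comm _ _ _) (smul_zero r).symm rfl

theorem norm_upperEmb_sq (z : Pair dx dy) : ‖upperEmb z‖ ^ 2 = ‖z‖ ^ 2 := by
  refine (norm_tri_sq z 0).trans ?_
  simp

theorem norm_lowerEmb_sq_le (c : ℝ) (v : Pair dx dy) :
    ‖lowerEmb c v‖ ^ 2 ≤ (c ^ 2 + 1) * ‖v‖ ^ 2 := by
  refine (norm_tri_sq _ _).le.trans ?_
  rw [norm_pt_sq, norm_smul, mul_pow, norm_neg, Real.norm_eq_abs, sq_abs, norm_zero,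
    WithLp.prod_norm_sq_eq_of_L2 v]
  nlinarith [sq_nonneg ‖v.fst‖, mul_nonneg (sq_nonneg c) (sq_nonneg ‖v.snd‖)]

/-- The terms in y - θ are exact and cancel. What is left is linear in three gradient errors: of f_i
and g_i at (x, y), and of g_i at (x, θ). -/
theorem dirNoise_eq (c γ μ : ℝ) (i : Fin n) (u : Tri dx dy) (ξ : Ξf × Ξg) :
    dirNoise pb c γ μ i u ξ
      = upperEmb ((c * μ) • (∇ (fun z => pb.lossF i z ξ.1) u.fst - ∇ (pb.f i) u.fst)
          + c • (∇ (fun z => pb.lossG i z ξ.2) u.fst - ∇ (pb.g i) u.fst))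
        + lowerEmb c (∇ (fun z => pb.lossG i z ξ.2) (lowerPt u) - ∇ (pb.g i) (lowerPt u)) := by
  set F := ∇ (fun z => pb.lossF i z ξ.1)
  set F' := ∇ (pb.f i)
  set G := ∇ (fun z => pb.lossG i z ξ.2)
  set G' := ∇ (pb.g i)
  change dir c γ μ F G u - dir c γ μ F' G' u = _
  refine tri_ext ?_ ?_ ?_
  · change c • (μ • (F u.fst).fst + (G u.fst).fst - (G (lowerPt u)).fst)
      - c • (μ • (F' u.fst).fst + (G' u.fst).fst - (G' (lowerPt u)).fst)
      = ((c * μ) • ((F u.fst).fst - (F' u.fst).fst) + c • ((G u.fst).fst - (G' u.fst).fst))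
        + (-c) • ((G (lowerPt u)).fst - (G' (lowerPt u)).fst)
    module
  · change c • (μ • (F u.fst).snd + (G u.fst).snd - (1 / γ) • (u.fst.snd - u.snd))
      - c • (μ • (F' u.fst).snd + (G' u.fst).snd - (1 / γ) • (u.fst.snd - u.snd))
      = ((c * μ) • ((F u.fst).snd - (F' u.fst).snd) + c • ((G u.fst).snd - (G' u.fst).snd)) + 0
    module
  · change ((G (lowerPt u)).snd + (1 / γ) • (u.snd - u.fst.snd))
      - ((G' (lowerPt u)).snd + (1 / γ) • (u.snd - u.fst.snd))
      = 0 + ((G (lowerPt u)).snd - (G' (lowerPt u)).snd)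
    module

/-- The three errors are separated by the triangle inequality alone: the same lower-level sample is
used at two points, and the two samples of one pair may be dependent. -/
theorem norm_dirNoise_sq_le (c γ μ : ℝ) (i : Fin n) (u : Tri dx dy) (ξ : Ξf × Ξg) :
    ‖dirNoise pb c γ μ i u ξ‖ ^ 2
      ≤ 4 * (c * μ) ^ 2 * ‖∇ (pb.f i) u.fst - ∇ (fun z => pb.lossF i z ξ.1) u.fst‖ ^ 2
        + 4 * c ^ 2 * ‖∇ (pb.g i) u.fst - ∇ (fun z => pb.lossG i z ξ.2) u.fst‖ ^ 2
        + 2 * (c ^ 2 + 1)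
          * ‖∇ (pb.g i) (lowerPt u) - ∇ (fun z => pb.lossG i z ξ.2) (lowerPt u)‖ ^ 2 := by
  rw [dirNoise_eq, norm_sub_rev (∇ (pb.f i) u.fst), norm_sub_rev (∇ (pb.g i) u.fst),
    norm_sub_rev (∇ (pb.g i) (lowerPt u))]
  set a := ∇ (fun z => pb.lossF i z ξ.1) u.fst - ∇ (pb.f i) u.fst
  set b := ∇ (fun z => pb.lossG i z ξ.2) u.fst - ∇ (pb.g i) u.fst
  set d := ∇ (fun z => pb.lossG i z ξ.2) (lowerPt u) - ∇ (pb.g i) (lowerPt u)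
  have h1 := norm_add_sq_le_young 1 one_pos (upperEmb ((c * μ) • a + c • b)) (lowerEmb c d)
  have h2 := norm_add_sq_le_young 1 one_pos ((c * μ) • a) (c • b)
  have h3 := norm_lowerEmb_sq_le c d
  rw [norm_upperEmb_sq] at h1
  rw [norm_smul, norm_smul, mul_pow, mul_pow, Real.norm_eq_abs, Real.norm_eq_abs, sq_abs,
    sq_abs] at h2
  rw [inv_one, one_add_one_eq_two] at h1 h2
  linarith

/-- Variance constant of the joint direction. -/
noncomputable def noiseConst (μ₀ c : ℝ) : ℝ := 4 * (c * μ₀) ^ 2 + 6 * c ^ 2 + 2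

theorem noiseConst_nonneg (μ₀ c : ℝ) : 0 ≤ noiseConst μ₀ c := by unfold noiseConst; positivity

variable {ν : Measure (Ξf × Ξg)} {δf δg : ℝ}

theorem measurable_sq_dirNoise (hm : MeasurableGrads pb) (c γ μ : ℝ) (i : Fin n) (u : Tri dx dy) :
    Measurable fun ξ => ‖dirNoise pb c γ μ i u ξ‖ ^ 2 := by
  have h3 : Measurable fun ξ : Ξf × Ξg => sampleDir pb c γ μ i u ξ :=
    (hm.sampleDir c γ μ i).of_uncurry_left
  exact measurable_norm_sub_sq h3 (exactDir pb c γ μ i u)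

/-- Each of the three squared errors involves one component of the pair, so only the marginals of ν
enter, whatever its joint law. -/
theorem integrable_sq_dirNoise (i : Fin n) (hf : IsOracle (pb.lossF i) (pb.distF i) δf)
    (hg : IsOracle (pb.lossG i) (pb.distG i) δg) (h1 : ν.map Prod.fst = pb.distF i)
    (h2 : ν.map Prod.snd = pb.distG i) (hm : MeasurableGrads pb) {c γ μ μ₀ : ℝ} (hμ : 0 ≤ μ)
    (hμ' : μ ≤ μ₀) (u : Tri dx dy) :
    Integrable (fun ξ => ‖dirNoise pb c γ μ i u ξ‖ ^ 2) ν ∧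
    ∫ ξ, ‖dirNoise pb c γ μ i u ξ‖ ^ 2 ∂ν ≤ noiseConst μ₀ c * (δf ^ 2 + δg ^ 2) := by
  have tF : ∀ z, Integrable (fun ξ : Ξf × Ξg => ‖∇ (pb.f i) z - ∇ (fun z => pb.lossF i z ξ.1) z‖ ^ 2) ν
      ∧ ∫ ξ, ‖∇ (pb.f i) z - ∇ (fun z => pb.lossF i z ξ.1) z‖ ^ 2 ∂ν ≤ δf ^ 2 := by
    intro z
    have a := hf.integrable_sq z
    have b := hf.variance_le z
    rw [← h1] at a b
    have hφ := a.aestronglyMeasurable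
    rw [integral_map measurable_fst.aemeasurable hφ] at b
    rw [integrable_map_measure hφ measurable_fst.aemeasurable] at a
    simp only [h1] at a b
    exact ⟨a, b⟩
  have tG : ∀ z, Integrable (fun ξ : Ξf × Ξg => ‖∇ (pb.g i) z - ∇ (fun z => pb.lossG i z ξ.2) z‖ ^ 2) ν
      ∧ ∫ ξ, ‖∇ (pb.g i) z - ∇ (fun z => pb.lossG i z ξ.2) z‖ ^ 2 ∂ν ≤ δg ^ 2 := by
    intro z
    have a := hg.integrable_sq z
    have b := hg.variance_le z
    rw [← h2] at a b
    have hφ := a.aestronglyMeasurable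
    rw [integral_map measurable_snd.aemeasurable hφ] at b
    rw [integrable_map_measure hφ measurable_snd.aemeasurable] at a
    simp only [h2] at a b
    exact ⟨a, b⟩
  have hb := fun ξ => norm_dirNoise_sq_le (pb := pb) c γ μ i u ξ
  have key := integral_le_of_le_comb (by positivity) (by positivity) (by positivity)
    (measurable_sq_dirNoise hm c γ μ i u) (fun ξ => sq_nonneg _) (tF u.fst).1 (tG u.fst).1
    (tG (lowerPt u)).1 (tF u.fst).2 (tG u.fst).2 (tG (lowerPt u)).2 hb
  refine ⟨key.1, key.2.trans ?_⟩
  have m1 : 4 * (c * μ) ^ 2 * δf ^ 2 ≤ 4 * (c * μ₀) ^ 2 * δf ^ 2 := by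
    have e : (c * μ) ^ 2 ≤ (c * μ₀) ^ 2 := by
      rw [mul_pow, mul_pow]; gcongr
    gcongr
  have p1 : 0 ≤ (6 * c ^ 2 + 2) * δf ^ 2 := by positivity
  have p2 : 0 ≤ 4 * (c * μ₀) ^ 2 * δg ^ 2 := by positivity
  unfold noiseConst
  linarith

theorem integral_dirNoise [IsProbabilityMeasure ν] (i : Fin n)
    (hf : IsOracle (pb.lossF i) (pb.distF i) δf)
    (hg : IsOracle (pb.lossG i) (pb.distG i) δg) (h1 : ν.map Prod.fst = pb.distF i)
    (h2 : ν.map Prod.snd = pb.distG i) {c γ μ : ℝ} (u : Tri dx dy) :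
    Integrable (dirNoise pb c γ μ i u) ν ∧ ∫ ξ, dirNoise pb c γ μ i u ξ ∂ν = 0 := by
  have tF : ∀ z, Integrable (fun ξ : Ξf × Ξg => ∇ (fun z => pb.lossF i z ξ.1) z - ∇ (pb.f i) z) ν
      ∧ ∫ ξ : Ξf × Ξg, (∇ (fun z => pb.lossF i z ξ.1) z - ∇ (pb.f i) z) ∂ν = 0 := by
    intro z
    have a := hf.integrable_grad z
    have b := hf.unbiased z
    rw [← h1] at a
    have hφ := a.aestronglyMeasurable
    have b' : ∫ ξ, ∇ (fun z' => pb.lossF i z' ξ) z ∂(ν.map Prod.fst) = ∇ (pb.f i) z := by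
      rw [h1]; exact b
    rw [integral_map measurable_fst.aemeasurable hφ] at b'
    rw [integrable_map_measure hφ measurable_fst.aemeasurable] at a
    have a' : Integrable (fun ξ : Ξf × Ξg => ∇ (fun z => pb.lossF i z ξ.1) z) ν := a
    refine ⟨a'.sub (integrable_const _), ?_⟩
    rw [integral_sub a' (integrable_const _), b']
    simp
  have tG : ∀ z, Integrable (fun ξ : Ξf × Ξg => ∇ (fun z => pb.lossG i z ξ.2) z - ∇ (pb.g i) z) ν
      ∧ ∫ ξ : Ξf × Ξg, (∇ (fun z => pb.lossG i z ξ.2) z - ∇ (pb.g i) z) ∂ν = 0 := by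
    intro z
    have a := hg.integrable_grad z
    have b := hg.unbiased z
    rw [← h2] at a
    have hφ := a.aestronglyMeasurable
    have b' : ∫ ξ, ∇ (fun z' => pb.lossG i z' ξ) z ∂(ν.map Prod.snd) = ∇ (pb.g i) z := by
      rw [h2]; exact b
    rw [integral_map measurable_snd.aemeasurable hφ] at b'
    rw [integrable_map_measure hφ measurable_snd.aemeasurable] at a
    have a' : Integrable (fun ξ : Ξf × Ξg => ∇ (fun z => pb.lossG i z ξ.2) z) ν := a
    refine ⟨a'.sub (integrable_const _), ?_⟩
    rw [integral_sub a' (integrable_const _), b']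
    simp
  have key := integral_linear_comb_eq_zero upperEmb (lowerEmb c) (c * μ) c (tF u.fst).1
    (tG u.fst).1 (tG (lowerPt u)).1 (tF u.fst).2 (tG u.fst).2 (tG (lowerPt u)).2
  have e : dirNoise pb c γ μ i u = _ := funext fun ξ => dirNoise_eq c γ μ i u ξ
  rw [e]
  exact key

end DirectionNoise

/-! ### Pathwise estimates -/

theorem gossip_add_smul_add {n : ℕ} {E : Type*} [NormedAddCommGroup E] [InnerProductSpace ℝ E]
    (W : Matrix (Fin n) (Fin n) ℝ) (r : ℝ) (a b d : Fin n → E) :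
    gossip W (fun i => a i + (r • b i + d i))
      = fun i => gossip W a i + (r • gossip W b i + gossip W d i) := by
  rw [gossip_add W a fun i => r • b i + d i, gossip_add W (fun i => r • b i) d, gossip_smul]

section Pathwise

variable {n dx dy : ℕ} {Ξf Ξg : Type*} [MeasurableSpace Ξf] [MeasurableSpace Ξg]
  {pb : Problem n dx dy Ξf Ξg} {L₁ L₂ γ μ₀ c Flow : ℝ}

/-- The average of the exact local directions. -/
noncomputable def drift (pb : Problem n dx dy Ξf Ξg) (c γ μ : ℝ) (u : Fin n → Tri dx dy) :
    Tri dx dy :=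
  mean fun i => exactDir pb c γ μ i (u i)

/-- The constant in the bound of the average direction by the measure of stationarity. -/
noncomputable def dirConst (L₂ γ c : ℝ) : ℝ :=
  2 * c ^ 2 + 2 * c ^ 2 * (L₂ ^ 2 + 1 / γ ^ 2) + (L₂ + 1 / γ) ^ 2

theorem dirConst_nonneg (L₂ γ c : ℝ) : 0 ≤ dirConst L₂ γ c := by unfold dirConst; positivity

theorem Regular.potConst_nonneg (h : Regular pb L₁ L₂ γ μ₀ c Flow) :
    0 ≤ potConst L₁ L₂ γ μ₀ := by
  have := h.nonneg₁
  have := h.pos₂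
  have := h.gamma_pos
  have := h.mu_pos
  unfold potConst
  positivity

theorem Regular.norm_exactDir_sub_le (h : Regular pb L₁ L₂ γ μ₀ c Flow) {μ : ℝ} (hμ : 0 ≤ μ)
    (hμ' : μ ≤ μ₀) (i : Fin n) (u u' : Tri dx dy) :
    ‖exactDir pb c γ μ i u - exactDir pb c γ μ i u'‖ ^ 2
      ≤ dirLip L₁ L₂ γ μ₀ c ^ 2 * ‖u - u'‖ ^ 2 := by
  rw [← mul_pow]
  exact pow_le_pow_left₀ (norm_nonneg _) (norm_dir_sub_le h.nonneg₁ h.pos₂.le h.gamma_pos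
    h.c_pos.le hμ hμ' (h.smooth.lip_f i) (h.smooth.lip_g i) u u') 2

theorem Regular.isLip_exactDir (h : Regular pb L₁ L₂ γ μ₀ c Flow) {μ : ℝ} (hμ : 0 ≤ μ) (i : Fin n) :
    IsLip (exactDir pb c γ μ i) :=
  isLip_dir h.c_pos.le h.gamma_pos hμ ⟨L₁, h.nonneg₁, h.smooth.lip_f i⟩
    ⟨L₂, h.pos₂.le, h.smooth.lip_g i⟩

/-- If all agents stood at the average, their mean direction would be that of F and G. The Lipschitz
bound and Jensen's inequality measure the discrepancy by the consensus error. -/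
theorem Regular.norm_drift_sub_sq_le (h : Regular pb L₁ L₂ γ μ₀ c Flow) {μ : ℝ} (hμ : 0 ≤ μ)
    (hμ' : μ ≤ μ₀) (u : Fin n → Tri dx dy) :
    ‖drift pb c γ μ u - dir c γ μ (∇ pb.F) (∇ pb.G) (mean u)‖ ^ 2
      ≤ dirLip L₁ L₂ γ μ₀ c ^ 2 * spread u := by
  have e : dir c γ μ (∇ pb.F) (∇ pb.G) (mean u)
      = mean fun i => exactDir pb c γ μ i (mean u) := by
    rw [h.smooth.gradient_F h.pos h.nonneg₁, h.smooth.gradient_G h.pos h.pos₂]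
    exact (mean_dir h.pos c γ μ _ _ _).symm
  rw [e, drift, ← mean_sub]
  exact (norm_mean_sq_le h.pos _).trans
    (meanSq_mono fun i => h.norm_exactDir_sub_le hμ hμ' i (u i) (mean u))

theorem norm_add_sq_le_two {E : Type*} [NormedAddCommGroup E] [InnerProductSpace ℝ E] (x y : E) :
    ‖x + y‖ ^ 2 ≤ 2 * ‖x‖ ^ 2 + 2 * ‖y‖ ^ 2 := by
  have := norm_add_sq_le_young 1 one_pos x y
  rwa [inv_one, one_add_one_eq_two] at this

theorem norm_sub_sq_le_two {E : Type*} [NormedAddCommGroup E] [InnerProductSpace ℝ E] (x y : E) :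
    ‖x - y‖ ^ 2 ≤ 2 * ‖x‖ ^ 2 + 2 * ‖y‖ ^ 2 := by
  have := norm_add_sq_le_two x (-y)
  rwa [norm_neg, ← sub_eq_add_neg] at this

theorem Regular.norm_drift_sq_le (h : Regular pb L₁ L₂ γ μ₀ c Flow) {μ : ℝ} (hμ : 0 ≤ μ)
    (hμ' : μ ≤ μ₀) (u : Fin n → Tri dx dy) :
    ‖drift pb c γ μ u‖ ^ 2 ≤ 2 * dirLip L₁ L₂ γ μ₀ c ^ 2 * spread u
      + 2 * dirConst L₂ γ c * stat pb γ μ (mean u) := by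
  have h1 := norm_add_sq_le_two (drift pb c γ μ u - dir c γ μ (∇ pb.F) (∇ pb.G) (mean u))
    (dir c γ μ (∇ pb.F) (∇ pb.G) (mean u))
  rw [sub_add_cancel] at h1
  have h2 := h.norm_drift_sub_sq_le hμ hμ' u
  have h3 := h.norm_dir_sq_le μ (mean u)
  rw [← dirConst] at h3
  linarith

/-- Squared length of an average step with error `e`. -/
theorem Regular.norm_drift_add_sq_le (h : Regular pb L₁ L₂ γ μ₀ c Flow) {μ : ℝ} (hμ : 0 ≤ μ)
    (hμ' : μ ≤ μ₀) (u : Fin n → Tri dx dy) (e : Tri dx dy) :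
    ‖drift pb c γ μ u + e‖ ^ 2 ≤ 4 * dirLip L₁ L₂ γ μ₀ c ^ 2 * spread u
      + 4 * dirConst L₂ γ c * stat pb γ μ (mean u) + 2 * ‖e‖ ^ 2 := by
  have h1 := norm_add_sq_le_two (drift pb c γ μ u) e
  have h2 := h.norm_drift_sq_le hμ hμ' u
  linarith

theorem QuadApprox.step_le {E : Type*} [NormedAddCommGroup E] [InnerProductSpace ℝ E]
    {f : E → ℝ} {g : E → E} {C : ℝ} (h : QuadApprox f g C) (u v : E) (r : ℝ) :
    f (u + (-r) • v) ≤ f u - r * inner ℝ (g u) v + C * r ^ 2 * ‖v‖ ^ 2 := by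
  have h1 := (abs_le.mp (h u (u + (-r) • v))).2
  rw [add_sub_cancel_left, inner_smul_right, norm_smul, mul_pow, Real.norm_eq_abs, sq_abs,
    neg_sq] at h1
  linarith

/-- Descent of the potential in one iteration. -/
theorem Regular.pot_step_le (h : Regular pb L₁ L₂ γ μ₀ c Flow) {μ μ' : ℝ} (hμ : 0 ≤ μ)
    (hμ₀ : μ ≤ μ₀) (hμ' : μ' ≤ μ) {lam : ℝ} (hlam : 0 ≤ lam) (u : Fin n → Tri dx dy)
    (e : Tri dx dy) :
    pot pb γ Flow μ' (mean u + (-lam) • (drift pb c γ μ u + e))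
      ≤ pot pb γ Flow μ (mean u) - lam * min (c / 2) (eta L₂ γ ^ 2 / 2) * stat pb γ μ (mean u)
        + lam * (1 / min c 1) * dirLip L₁ L₂ γ μ₀ c ^ 2 * spread u
        - lam * inner ℝ (potGrad pb γ μ (mean u)) e
        + potConst L₁ L₂ γ μ₀ * lam ^ 2 * (4 * dirLip L₁ L₂ γ μ₀ c ^ 2 * spread u
          + 4 * dirConst L₂ γ c * stat pb γ μ (mean u) + 2 * ‖e‖ ^ 2) := by
  -- The change of the penalty parameter is removed first, so that the expansion uses one fixed
  -- potential.
  refine (h.pot_mono hμ' _).trans ?_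
  refine ((h.quadApprox_pot hμ hμ₀).step_le _ _ _).trans ?_
  set d := dir c γ μ (∇ pb.F) (∇ pb.G) (mean u)
  have h1 := h.inner_potGrad_ge μ (mean u) (drift pb c γ μ u - d)
  rw [add_sub_cancel] at h1
  have h2 := h.norm_drift_sub_sq_le hμ hμ₀ u
  have h3 : 0 < min c 1 := lt_min h.c_pos one_pos
  have h4 : 1 / min c 1 * ‖drift pb c γ μ u - d‖ ^ 2
      ≤ 1 / min c 1 * (dirLip L₁ L₂ γ μ₀ c ^ 2 * spread u) := by gcongr
  have h5 := mul_le_mul_of_nonneg_left (h1.trans' (sub_le_sub_left h4 _)) hlam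
  have h6 := h.norm_drift_add_sq_le hμ hμ₀ u e
  have h7 := mul_le_mul_of_nonneg_left h6
    (mul_nonneg h.potConst_nonneg (sq_nonneg lam))
  rw [inner_add_right]
  linarith

/-! ### Dispersion of the upper-level gradients -/

/-- The contribution of the upper-level objective to the local direction. -/
noncomputable def upperDir (pb : Problem n dx dy Ξf Ξg) (c : ℝ) (i : Fin n) (u : Tri dx dy) :
    Tri dx dy :=
  tri (c • ∇ (pb.f i) u.fst) 0

/-- Directions are affine in μ. An increment splits into a part of Lipschitz size and a penalty part
proportional to ∇f_i, for which no uniform bound is available. -/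
theorem exactDir_sub_mu (c γ μ μ' : ℝ) (i : Fin n) (u u' : Tri dx dy) :
    exactDir pb c γ μ' i u' - exactDir pb c γ μ i u
      = (exactDir pb c γ μ' i u' - exactDir pb c γ μ' i u) + (μ' - μ) • upperDir pb c i u := by
  have h1 := dir_add_mu c γ μ (μ' - μ) (∇ (pb.f i)) (∇ (pb.g i)) u
  rw [add_sub_cancel] at h1
  have h2 : exactDir pb c γ μ' i u = exactDir pb c γ μ i u + (μ' - μ) • upperDir pb c i u := h1
  rw [h2]
  abel

theorem Smooth.norm_upperDir_sub_le (hs : Smooth pb L₁ L₂) (i : Fin n) (u u' : Tri dx dy) :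
    ‖upperDir pb c i u - upperDir pb c i u'‖ ^ 2 ≤ c ^ 2 * L₁ ^ 2 * ‖u - u'‖ ^ 2 := by
  have e : upperDir pb c i u - upperDir pb c i u'
      = tri (c • (∇ (pb.f i) u.fst - ∇ (pb.f i) u'.fst)) 0 := by
    rw [upperDir, upperDir, tri_sub_tri, smul_sub, sub_zero]
  have h1 := pow_le_pow_left₀ (norm_nonneg _) (hs.lip_f i u.fst u'.fst) 2
  have h2 := pow_le_pow_left₀ (norm_nonneg _) (norm_tri_fst_le (u - u')) 2
  rw [e, norm_tri_sq, norm_smul, norm_zero, mul_pow, Real.norm_eq_abs, sq_abs]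
  rw [mul_pow] at h1
  calc _ = c ^ 2 * ‖∇ (pb.f i) u.fst - ∇ (pb.f i) u'.fst‖ ^ 2 := by ring
    _ ≤ c ^ 2 * (L₁ ^ 2 * ‖u.fst - u'.fst‖ ^ 2) := by gcongr
    _ ≤ c ^ 2 * (L₁ ^ 2 * ‖u - u'‖ ^ 2) := by gcongr; exact norm_tri_fst_le (u - u')
    _ = _ := by ring

variable {W : Matrix (Fin n) (Fin n) ℝ} {ρ : ℝ}

/-- The unbounded heterogeneity of ∇f_i is transported to a reference configuration, later the
initial one, at a Lipschitz cost. The communication round is kept on the reference term, because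
only the mixed gradients are visible in the first tracker. -/
theorem spread_gossip_upperDir_le (hs : Smooth pb L₁ L₂) (hn : 0 < n) (hW : IsMixing W ρ)
    (u u' : Fin n → Tri dx dy) :
    spread (gossip W fun i => upperDir pb c i (u i))
      ≤ 2 * spread (gossip W fun i => upperDir pb c i (u' i))
        + 2 * (c ^ 2 * L₁ ^ 2)
          * (2 * spread u + 2 * spread u' + ‖mean u - mean u'‖ ^ 2) := by
  have e : (gossip W fun i => upperDir pb c i (u i))
      = fun i => gossip W (fun i => upperDir pb c i (u' i)) i
        + gossip W (fun i => upperDir pb c i (u i) - upperDir pb c i (u' i)) i := by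
    rw [gossip_sub]
    exact funext fun i => (add_sub_cancel _ _).symm
  rw [e]
  refine (spread_add_le _ _).trans ?_
  rw [mul_assoc 2 (c ^ 2 * L₁ ^ 2)]
  refine add_le_add le_rfl (mul_le_mul_of_nonneg_left ?_ two_pos.le)
  refine (hW.spread_gossip_le_self hn _).trans ((spread_le_meanSq hn _).trans ?_)
  refine (meanSq_mono fun i => hs.norm_upperDir_sub_le i (u i) (u' i)).trans ?_
  exact mul_le_mul_of_nonneg_left (meanSq_sub_le_spread hn u u') (by positivity)

/-- The increment of the local directions after one communication round. -/
theorem Regular.spread_gossip_increment_le (h : Regular pb L₁ L₂ γ μ₀ c Flow)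
    (hW : IsMixing W ρ) {μ μ' : ℝ} (hμ : 0 ≤ μ') (hμ' : μ' ≤ μ₀)
    (u u' s s' : Fin n → Tri dx dy) :
    spread (gossip W fun i => (exactDir pb c γ μ' i (u' i) + s' i)
        - (exactDir pb c γ μ i (u i) + s i))
      ≤ 2 * dirLip L₁ L₂ γ μ₀ c ^ 2 * (2 * spread u' + 2 * spread u + ‖mean u' - mean u‖ ^ 2)
        + 4 * (μ - μ') ^ 2 * spread (gossip W fun i => upperDir pb c i (u i))
        + 8 * (meanSq s' + meanSq s) := by
  have hn := h.pos
  have e : (gossip W fun i => (exactDir pb c γ μ' i (u' i) + s' i)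
        - (exactDir pb c γ μ i (u i) + s i))
      = fun i => gossip W (fun i => exactDir pb c γ μ' i (u' i) - exactDir pb c γ μ' i (u i)) i
        + ((μ' - μ) • gossip W (fun i => upperDir pb c i (u i)) i
          + gossip W (fun i => s' i - s i) i) := by
    rw [← gossip_add_smul_add]
    refine congrArg (gossip W) (funext fun i => ?_)
    rw [add_sub_add_comm, exactDir_sub_mu, add_assoc]
  rw [e]
  refine (spread_add_le _ _).trans ?_
  have h1 := spread_add_le (fun i => (μ' - μ) • gossip W (fun i => upperDir pb c i (u i)) i)
    (fun i => gossip W (fun i => s' i - s i) i)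
  rw [spread_smul, (by ring : (μ' - μ) ^ 2 = (μ - μ') ^ 2)] at h1
  have h2 : spread (fun i => gossip W (fun i => s' i - s i) i) ≤ 2 * meanSq s' + 2 * meanSq s :=
    (hW.spread_gossip_le_self hn _).trans ((spread_le_meanSq hn _).trans (meanSq_sub_le s' s))
  have h3 : spread (fun i => gossip W
        (fun i => exactDir pb c γ μ' i (u' i) - exactDir pb c γ μ' i (u i)) i)
      ≤ dirLip L₁ L₂ γ μ₀ c ^ 2 * (2 * spread u' + 2 * spread u + ‖mean u' - mean u‖ ^ 2) := by
    refine (hW.spread_gossip_le_self hn _).trans ((spread_le_meanSq hn _).trans ?_)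
    refine (meanSq_mono fun i => h.norm_exactDir_sub_le hμ hμ' i (u' i) (u i)).trans ?_
    exact mul_le_mul_of_nonneg_left (meanSq_sub_le_spread hn u' u) (sq_nonneg _)
  linarith

/-- Recovers the upper-level part of a direction from the direction. -/
noncomputable def upperPart (c : ℝ) : Tri dx dy →ₗ[ℝ] Tri dx dy where
  toFun w := tri (pt w.fst.fst (w.fst.snd - c • w.snd)) 0
  map_add' w w' := tri_ext rfl
    (show (w.fst.snd + w'.fst.snd) - c • (w.snd + w'.snd)
      = (w.fst.snd - c • w.snd) + (w'.fst.snd - c • w'.snd) by rw [smul_add]; abel)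
    (add_zero _).symm
  map_smul' r w := tri_ext rfl
    (show r • w.fst.snd - c • r • w.snd = r • (w.fst.snd - c • w.snd) by
      rw [smul_sub, smul_comm])
    (smul_zero r).symm

theorem norm_upperPart_sq_le (c : ℝ) (w : Tri dx dy) :
    ‖upperPart c w‖ ^ 2 ≤ (2 + 2 * c ^ 2) * ‖w‖ ^ 2 := by
  have h1 : ‖upperPart c w‖ ^ 2 = ‖w.fst.fst‖ ^ 2 + ‖w.fst.snd - c • w.snd‖ ^ 2 := by
    refine (norm_tri_sq _ _).trans ?_
    rw [norm_pt_sq, norm_zero]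
    ring
  have h2 := norm_sub_sq_le_two w.fst.snd (c • w.snd)
  rw [norm_smul, mul_pow, Real.norm_eq_abs, sq_abs] at h2
  have h3 := WithLp.prod_norm_sq_eq_of_L2 w
  have h4 := WithLp.prod_norm_sq_eq_of_L2 w.fst
  have p1 := sq_nonneg ‖w.fst.fst‖
  have p2 : 0 ≤ c ^ 2 * ‖w.fst.fst‖ ^ 2 := by positivity
  have p3 : 0 ≤ c ^ 2 * ‖w.fst.snd‖ ^ 2 := by positivity
  have p4 := sq_nonneg ‖w.snd‖
  rw [h1, h3, h4]
  linarith

/-- The lower-level part of a direction that `upperPart` leaves over. -/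
noncomputable def lowerPart (pb : Problem n dx dy Ξf Ξg) (c : ℝ) (i : Fin n) (u : Tri dx dy) :
    Tri dx dy :=
  tri (c • (∇ (pb.g i) u.fst - ∇ (pb.g i) (lowerPt u))) 0

/-- In D_y - D_θ the terms (y - θ)/γ cancel, and in D_x they are absent. This leaves μ∇f_i plus the
difference of ∇g_i at (x, y) and (x, θ). -/
theorem smul_upperDir (c γ μ : ℝ) (i : Fin n) (u : Tri dx dy) :
    μ • upperDir pb c i u = upperPart c (exactDir pb c γ μ i u) - lowerPart pb c i u := by
  set F := ∇ (pb.f i) u.fst with hF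
  set G := ∇ (pb.g i) u.fst with hG
  set G' := ∇ (pb.g i) (lowerPt u) with hG'
  refine tri_ext ?_ ?_ ?_
  · change μ • c • F.fst = c • (μ • F.fst + G.fst - G'.fst) - c • (G.fst - G'.fst)
    module
  · change μ • c • F.snd = (c • (μ • F.snd + G.snd - (1 / γ) • (u.fst.snd - u.snd))
      - c • (G'.snd + (1 / γ) • (u.snd - u.fst.snd))) - c • (G.snd - G'.snd)
    module
  · change μ • (0 : Vec dy) = 0 - 0
    rw [smul_zero, sub_zero]

/-- The difference between the upper-level variable and the lower-level one. -/
noncomputable def lag : Tri dx dy →ₗ[ℝ] Vec dy where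
  toFun w := w.fst.snd - w.snd
  map_add' w w' := show (w.fst.snd + w'.fst.snd) - (w.snd + w'.snd) = _ by abel
  map_smul' r w := (smul_sub r w.fst.snd w.snd).symm

theorem norm_lag_sq_le (w : Tri dx dy) : ‖lag w‖ ^ 2 ≤ 2 * ‖w‖ ^ 2 := by
  have h1 : ‖lag w‖ ^ 2 ≤ _ := norm_sub_sq_le_two w.fst.snd w.snd
  have h3 := WithLp.prod_norm_sq_eq_of_L2 w
  have h4 := WithLp.prod_norm_sq_eq_of_L2 w.fst
  have := sq_nonneg ‖w.fst.fst‖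
  rw [h3, h4]
  linarith

theorem Smooth.norm_lowerPart_sq_le (hs : Smooth pb L₁ L₂) (i : Fin n) (u : Tri dx dy) :
    ‖lowerPart pb c i u‖ ^ 2 ≤ c ^ 2 * L₂ ^ 2 * ‖lag u‖ ^ 2 := by
  have h1 := pow_le_pow_left₀ (norm_nonneg _) (hs.lip_g i u.fst (lowerPt u)) 2
  have h2 : ‖u.fst - lowerPt u‖ ^ 2 = ‖lag u‖ ^ 2 := by
    have : u.fst - lowerPt u = pt (u.fst.fst - u.fst.fst) (u.fst.snd - u.snd) := rfl
    rw [this, norm_pt_sq, sub_self, norm_zero]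
    change _ + ‖u.fst.snd - u.snd‖ ^ 2 = ‖u.fst.snd - u.snd‖ ^ 2
    ring
  rw [mul_pow, h2] at h1
  rw [lowerPart, norm_tri_sq, norm_smul, norm_zero, mul_pow, Real.norm_eq_abs, sq_abs, mul_assoc]
  calc _ = c ^ 2 * ‖∇ (pb.g i) u.fst - ∇ (pb.g i) (lowerPt u)‖ ^ 2 := by ring
    _ ≤ _ := by gcongr

/-- The potential controls the distance between the two lower-level variables. -/
theorem Regular.norm_lag_sq_le_pot (h : Regular pb L₁ L₂ γ μ₀ c Flow) {μ : ℝ} (hμ : 0 ≤ μ)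
    (u : Tri dx dy) :
    ‖lag u‖ ^ 2 ≤ 2 / (1 / (2 * γ) - L₂) * pot pb γ Flow μ u := by
  have h0 := half_sub_pos h.pos₂ h.mem
  set r := 1 / (2 * γ) - L₂
  set t := pb.thetaStar γ u.fst
  have h1 := h.smooth.V_add_le h.pos h.pos₂ h.mem u.fst u.snd
  have h2 := h.smooth.V_add_le_G h.pos h.pos₂ h.mem u.fst
  have h3 := mul_le_mul_of_nonneg_left (h.lower u.fst) hμ
  have h4 : ‖lag u‖ ^ 2 ≤ 2 * ‖u.fst.snd - t‖ ^ 2 + 2 * ‖u.snd - t‖ ^ 2 := by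
    have : lag u = (u.fst.snd - t) - (u.snd - t) := (sub_sub_sub_cancel_right _ _ _).symm
    rw [this]
    exact norm_sub_sq_le_two _ _
  rw [div_mul_eq_mul_div, le_div_iff₀ h0]
  have h5 := mul_le_mul_of_nonneg_right h4 h0.le
  unfold pot Problem.Psi
  linarith

/-- Solve `smul_upperDir` for the upper-level part. The mixed direction is the first tracker up to
noise, and the lower-level remainder is Lipschitz in y - θ, whose deviations the consensus error
bounds and whose average the potential bounds. -/
theorem Regular.sq_mul_spread_gossip_upperDir_le (h : Regular pb L₁ L₂ γ μ₀ c Flow)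
    (hW : IsMixing W ρ) {μ : ℝ} (hμ : 0 ≤ μ) (u s : Fin n → Tri dx dy) :
    μ ^ 2 * spread (gossip W fun i => upperDir pb c i (u i))
      ≤ (8 + 8 * c ^ 2) * (spread (gossip W fun i => exactDir pb c γ μ i (u i) + s i) + meanSq s)
        + 2 * (c ^ 2 * L₂ ^ 2) * (2 * spread u
          + 2 / (1 / (2 * γ) - L₂) * pot pb γ Flow μ (mean u)) := by
  have hn := h.pos
  rw [← spread_smul, ← gossip_smul]
  simp_rw [smul_upperDir c γ μ]
  rw [gossip_sub]
  refine (spread_sub_le _ _).trans ?_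
  rw [gossip_map W (upperPart c)]
  have h1 := spread_map_le (upperPart c) (norm_upperPart_sq_le c)
    (gossip W fun i => exactDir pb c γ μ i (u i))
  have h2 : spread (gossip W fun i => exactDir pb c γ μ i (u i))
      ≤ 2 * spread (gossip W fun i => exactDir pb c γ μ i (u i) + s i) + 2 * meanSq s := by
    have e : (gossip W fun i => exactDir pb c γ μ i (u i))
        = fun i => gossip W (fun i => exactDir pb c γ μ i (u i) + s i) i - gossip W s i := by
      rw [gossip_add]
      exact funext fun i => (add_sub_cancel_right _ _).symm
    rw [e]
    refine (spread_sub_le _ _).trans ?_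
    have := (hW.spread_gossip_le_self hn s).trans (spread_le_meanSq hn s)
    linarith
  have h3 : spread (gossip W fun i => lowerPart pb c i (u i))
      ≤ c ^ 2 * L₂ ^ 2 * (2 * spread u + 2 / (1 / (2 * γ) - L₂) * pot pb γ Flow μ (mean u)) := by
    refine (hW.spread_gossip_le_self hn _).trans ((spread_le_meanSq hn _).trans ?_)
    refine (meanSq_mono fun i => h.smooth.norm_lowerPart_sq_le i (u i)).trans ?_
    refine mul_le_mul_of_nonneg_left ?_ (by positivity)
    rw [meanSq_eq hn, mean_map]
    exact add_le_add (spread_map_le lag norm_lag_sq_le u) (h.norm_lag_sq_le_pot hμ _)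
  have h4 := h1.trans (mul_le_mul_of_nonneg_left h2 (by positivity))
  linarith

end Pathwise

/-! ### The run of the algorithm as a stochastic process -/

section Iterates

variable {n dx dy : ℕ} {Ξf Ξg Ω : Type*} [MeasurableSpace Ξf] [MeasurableSpace Ξg]
  {pb : Problem n dx dy Ξf Ξg} {I : Input n dx dy} {ξf : Fin n → ℕ → Ω → Ξf}
  {ξg : Fin n → ℕ → Ω → Ξg} {L₁ L₂ μ₀ c Flow ρ lam δf δg : ℝ}

/-- A run of the algorithm with constant learning rates and decreasing penalty parameters, under
the assumptions of the convergence theorem. -/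
structure IsRun [MeasurableSpace Ω] (pb : Problem n dx dy Ξf Ξg) (I : Input n dx dy)
    (P : Measure Ω) (ξf : Fin n → ℕ → Ω → Ξf) (ξg : Fin n → ℕ → Ω → Ξg)
    (L₁ L₂ μ₀ c Flow ρ lam δf δg : ℝ) : Prop where
  regular : Regular pb L₁ L₂ I.γ μ₀ c Flow
  oracleF : ∀ i, IsOracle (pb.lossF i) (pb.distF i) δf
  oracleG : ∀ i, IsOracle (pb.lossG i) (pb.distG i) δg
  sampling : IsSampling pb P ξf ξg
  mixing : IsMixing I.W ρ
  rates : ConstRates I c lam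
  lam_pos : 0 < lam
  mu_nonneg : ∀ k, 0 ≤ I.μ k
  mu_anti : ∀ k, I.μ (k + 1) ≤ I.μ k
  mu_zero : I.μ 0 = μ₀

/-- The error of the joint direction of agent `i` in iteration `k`. -/
noncomputable def noise (pb : Problem n dx dy Ξf Ξg) (I : Input n dx dy) (ξf : Fin n → ℕ → Ω → Ξf)
    (ξg : Fin n → ℕ → Ω → Ξg) (c : ℝ) (k : ℕ) (i : Fin n) (ω : Ω) : Tri dx dy :=
  dirNoise pb c I.γ (I.μ k) i (point (iter pb I ξf ξg k ω) i) (ξf i k ω, ξg i k ω)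

theorem estimate_iter_succ (k : ℕ) (ω : Ω) : estimate c (iter pb I ξf ξg (k + 1) ω)
    = fun i => exactDir pb c I.γ (I.μ k) i (point (iter pb I ξf ξg k ω) i)
      + noise pb I ξf ξg c k i ω :=
  funext fun _ => (add_sub_cancel _ _).symm

theorem measurable_sub_comp_fst {E E' Ξ : Type*} [MeasurableSpace Ξ] [TopologicalSpace E]
    [MeasurableSpace E] [OpensMeasurableSpace E] [NormedAddCommGroup E'] [MeasurableSpace E']
    [BorelSpace E'] [SecondCountableTopology E'] {f : E → Ξ → E'} {g : E → E'}
    (hf : Measurable (Function.uncurry f)) (hg : Continuous g) :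
    Measurable (Function.uncurry fun u ξ => f u ξ - g u) :=
  hf.sub (hg.measurable.comp measurable_fst)

theorem Regular.measurable_dirNoise {γ : ℝ} (h : Regular pb L₁ L₂ γ μ₀ c Flow)
    (hm : MeasurableGrads pb) {μ : ℝ} (hμ : 0 ≤ μ) (i : Fin n) :
    Measurable (Function.uncurry (dirNoise pb c γ μ i)) :=
  measurable_sub_comp_fst (hm.sampleDir c γ μ i) (h.isLip_exactDir hμ i).continuous

theorem measurable_mean {E : Type*} [MeasurableSpace Ω] [NormedAddCommGroup E]
    [InnerProductSpace ℝ E] [FiniteDimensional ℝ E] [MeasurableSpace E] [BorelSpace E]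
    {s : Fin n → Ω → E} (hs : ∀ i, Measurable (s i)) :
    Measurable fun ω => mean fun i => s i ω :=
  (Finset.measurable_fun_sum Finset.univ fun j _ => hs j).const_smul _

theorem Regular.measurable_noise [mΩ : MeasurableSpace Ω] (h : Regular pb L₁ L₂ I.γ μ₀ c Flow)
    (hm : MeasurableGrads pb) (hI : ConstRates I c lam) (hμ : ∀ k, 0 ≤ I.μ k) (k : ℕ) (i : Fin n)
    (hξ : ∀ i j, j < k → Measurable fun ω => (ξf i j ω, ξg i j ω))
    (hik : Measurable fun ω => (ξf i k ω, ξg i k ω)) : Measurable (noise pb I ξf ξg c k i) := by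
  have e : noise pb I ξf ξg c k i = fun ω => Function.uncurry (dirNoise pb c I.γ (I.μ k) i)
      (point (iter pb I ξf ξg k ω) i, (ξf i k ω, ξg i k ω)) := rfl
  rw [e]
  exact (h.measurable_dirNoise hm (hμ k) i).comp ((measurable_iter hm hI k hξ i).1.prodMk hik)

theorem Regular.measurable_point_noise [mΩ : MeasurableSpace Ω]
    (h : Regular pb L₁ L₂ I.γ μ₀ c Flow)
    (hm : MeasurableGrads pb) (hI : ConstRates I c lam) (hμ : ∀ k, 0 ≤ I.μ k) (k : ℕ) (i j : Fin n)
    (hξ : ∀ i j, j < k → Measurable fun ω => (ξf i j ω, ξg i j ω))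
    (hik : Measurable fun ω => (ξf i k ω, ξg i k ω)) :
    Measurable fun ω => (point (iter pb I ξf ξg k ω) j, noise pb I ξf ξg c k i ω) :=
  (measurable_iter hm hI k hξ j).1.prodMk (h.measurable_noise hm hI hμ k i hξ hik)

theorem measurable_comp_mean {E E' : Type*} [MeasurableSpace Ω] [NormedAddCommGroup E]
    [InnerProductSpace ℝ E] [FiniteDimensional ℝ E] [MeasurableSpace E] [BorelSpace E]
    [TopologicalSpace E'] [MeasurableSpace E'] [BorelSpace E'] {g : E → E'} (hg : Continuous g)
    {s : Fin n → Ω → E} (hs : ∀ i, Measurable (s i)) :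
    Measurable fun ω => g (mean fun i => s i ω) :=
  hg.measurable.comp (measurable_mean hs)

theorem Regular.measurable_point_potGrad [mΩ : MeasurableSpace Ω]
    (h : Regular pb L₁ L₂ I.γ μ₀ c Flow)
    (hm : MeasurableGrads pb) (hI : ConstRates I c lam) (k : ℕ) (j : Fin n)
    (hξ : ∀ i j, j < k → Measurable fun ω => (ξf i j ω, ξg i j ω)) :
    Measurable fun ω => (point (iter pb I ξf ξg k ω) j,
      potGrad pb I.γ (I.μ k) (mean (point (iter pb I ξf ξg k ω)))) :=
  (measurable_iter hm hI k hξ j).1.prodMk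
    (measurable_comp_mean (h.isLip_potGrad (I.μ k)).continuous
      fun i => (measurable_iter hm hI k hξ i).1)

variable [MeasurableSpace Ω] {P : Measure Ω} [IsProbabilityMeasure P]

theorem IsRun.measurableGrads (h : IsRun pb I P ξf ξg L₁ L₂ μ₀ c Flow ρ lam δf δg) :
    MeasurableGrads pb :=
  ⟨fun i => (h.oracleF i).measurable_grad, fun i => (h.oracleG i).measurable_grad⟩

theorem IsRun.mu_le (h : IsRun pb I P ξf ξg L₁ L₂ μ₀ c Flow ρ lam δf δg) (k : ℕ) : I.μ k ≤ μ₀ := by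
  rw [← h.mu_zero]
  exact antitone_nat_of_succ_le h.mu_anti (Nat.zero_le k)

theorem IsRun.map_fst (h : IsRun pb I P ξf ξg L₁ L₂ μ₀ c Flow ρ lam δf δg) (i : Fin n) (k : ℕ) :
    (P.map fun ω => (ξf i k ω, ξg i k ω)).map Prod.fst = pb.distF i := by
  rw [Measure.map_map measurable_fst (h.sampling.measurable_pair i k)]
  exact h.sampling.law_f i k

theorem IsRun.map_snd (h : IsRun pb I P ξf ξg L₁ L₂ μ₀ c Flow ρ lam δf δg) (i : Fin n) (k : ℕ) :
    (P.map fun ω => (ξf i k ω, ξg i k ω)).map Prod.snd = pb.distG i := by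
  rw [Measure.map_map measurable_snd (h.sampling.measurable_pair i k)]
  exact h.sampling.law_g i k

/-- Bound of the second moment of the error of one local direction. -/
noncomputable def noiseLevel (μ₀ c δf δg : ℝ) : ℝ := noiseConst μ₀ c * (δf ^ 2 + δg ^ 2)

theorem noiseLevel_nonneg (μ₀ c δf δg : ℝ) : 0 ≤ noiseLevel μ₀ c δf δg :=
  mul_nonneg (noiseConst_nonneg _ _) (by positivity)

/-- Iterates of step k depend only on samples of earlier steps; `measurable_iter` is applied with
`Ω` carrying the σ-algebra of those samples. -/
theorem IsRun.indepFun_point (h : IsRun pb I P ξf ξg L₁ L₂ μ₀ c Flow ρ lam δf δg) (k : ℕ)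
    (i : Fin n) :
    IndepFun (fun ω => point (iter pb I ξf ξg k ω) i) (fun ω => (ξf i k ω, ξg i k ω)) P :=
  h.sampling.indepFun (S := {q | q.2 < k}) (fun hq => lt_irrefl k hq)
    (@measurable_iter n dx dy Ξf Ξg _ _ pb I Ω ξf ξg (sampleSigma ξf ξg _) h.measurableGrads c lam
      h.rates k (fun _ _ hj => measurable_sampleSigma hj) i).1

/-- Take the block of all samples except the one agent j draws at step k. It determines both the
iterate of j and the error of another agent at the same step. -/
theorem IsRun.indepFun_point_noise (h : IsRun pb I P ξf ξg L₁ L₂ μ₀ c Flow ρ lam δf δg) (k : ℕ)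
    {i j : Fin n} (hij : i ≠ j) :
    IndepFun (fun ω => (point (iter pb I ξf ξg k ω) j, noise pb I ξf ξg c k i ω))
      (fun ω => (ξf j k ω, ξg j k ω)) P :=
  h.sampling.indepFun (S := {q | q ≠ (j, k)}) (fun hq => hq rfl)
    (h.regular.measurable_point_noise (mΩ := sampleSigma ξf ξg _) h.measurableGrads h.rates
      h.mu_nonneg k i j
      (fun _ _ hl => measurable_sampleSigma (fun e => hl.ne (congrArg Prod.snd e)))
      (measurable_sampleSigma (fun e => hij (congrArg Prod.fst e))))

theorem IsRun.indepFun_point_potGrad (h : IsRun pb I P ξf ξg L₁ L₂ μ₀ c Flow ρ lam δf δg) (k : ℕ)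
    (j : Fin n) :
    IndepFun (fun ω => (point (iter pb I ξf ξg k ω) j,
      potGrad pb I.γ (I.μ k) (mean (point (iter pb I ξf ξg k ω)))))
      (fun ω => (ξf j k ω, ξg j k ω)) P :=
  h.sampling.indepFun (S := {q | q.2 < k}) (fun hq => lt_irrefl k hq)
    (h.regular.measurable_point_potGrad (mΩ := sampleSigma ξf ξg _) h.measurableGrads h.rates k j
      (fun _ _ hl => measurable_sampleSigma hl))

theorem IsRun.measurable_point (h : IsRun pb I P ξf ξg L₁ L₂ μ₀ c Flow ρ lam δf δg) (k : ℕ)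
    (i : Fin n) : Measurable fun ω => point (iter pb I ξf ξg k ω) i :=
  (measurable_iter h.measurableGrads h.rates k (fun i j _ => h.sampling.measurable_pair i j) i).1

theorem IsRun.noise_second_moment (h : IsRun pb I P ξf ξg L₁ L₂ μ₀ c Flow ρ lam δf δg) (k : ℕ)
    (i : Fin n) : MemLp (noise pb I ξf ξg c k i) 2 P ∧
      ∫ ω, ‖noise pb I ξf ξg c k i ω‖ ^ 2 ∂P ≤ noiseLevel μ₀ c δf δg := by
  have key := fun u => integrable_sq_dirNoise i (h.oracleF i) (h.oracleG i) (h.map_fst i k)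
    (h.map_snd i k) h.measurableGrads (c := c) (γ := I.γ) (h.mu_nonneg k) (h.mu_le k) u
  exact memLp_and_integral_norm_sq_le
    (h.regular.measurable_dirNoise h.measurableGrads (h.mu_nonneg k) i) (h.measurable_point k i)
    (h.sampling.measurable_pair i k) (h.indepFun_point k i) (noiseLevel_nonneg _ _ _ _)
    (fun u => (key u).1) (fun u => (key u).2)

theorem IsRun.memLp_noise (h : IsRun pb I P ξf ξg L₁ L₂ μ₀ c Flow ρ lam δf δg) (k : ℕ)
    (i : Fin n) : MemLp (noise pb I ξf ξg c k i) 2 P := (h.noise_second_moment k i).1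

/-- An error is orthogonal to whatever is independent of its sample. -/
theorem IsRun.integral_inner_noise (h : IsRun pb I P ξf ξg L₁ L₂ μ₀ c Flow ρ lam δf δg) (k : ℕ)
    (j : Fin n) {V : Ω → Tri dx dy} (hV : Measurable V) (hV2 : MemLp V 2 P)
    (hind : IndepFun (fun ω => (point (iter pb I ξf ξg k ω) j, V ω))
      (fun ω => (ξf j k ω, ξg j k ω)) P) :
    ∫ ω, inner ℝ (V ω) (noise pb I ξf ξg c k j ω) ∂P = 0 := by
  have : IsProbabilityMeasure (P.map fun ω => (ξf j k ω, ξg j k ω)) :=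
    Measure.isProbabilityMeasure_map (h.sampling.measurable_pair j k).aemeasurable
  have key := fun u => integral_dirNoise j (h.oracleF j) (h.oracleG j) (h.map_fst j k)
    (h.map_snd j k) (c := c) (γ := I.γ) (μ := I.μ k) u
  exact integral_inner_eq_zero
    (h.regular.measurable_dirNoise h.measurableGrads (h.mu_nonneg k) j) (h.measurable_point k j) hV
    (h.sampling.measurable_pair j k) hind (fun u => (key u).1) (fun u => (key u).2) hV2
    (h.memLp_noise k j)

theorem IsRun.measurable_noise (h : IsRun pb I P ξf ξg L₁ L₂ μ₀ c Flow ρ lam δf δg) (k : ℕ)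
    (i : Fin n) : Measurable (noise pb I ξf ξg c k i) :=
  h.regular.measurable_noise h.measurableGrads h.rates h.mu_nonneg k i
    (fun i j _ => h.sampling.measurable_pair i j) (h.sampling.measurable_pair i k)

/-- Errors of different agents are orthogonal, so only the diagonal terms survive. This is the
source of the linear speedup in n. -/
theorem IsRun.integral_norm_mean_noise_sq_le
    (h : IsRun pb I P ξf ξg L₁ L₂ μ₀ c Flow ρ lam δf δg) (k : ℕ) :
    ∫ ω, ‖mean fun i => noise pb I ξf ξg c k i ω‖ ^ 2 ∂P ≤ noiseLevel μ₀ c δf δg / n :=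
  integral_norm_mean_sq_le h.regular.pos (h.memLp_noise k) (fun i => (h.noise_second_moment k i).2)
    fun i _ hij => h.integral_inner_noise k _ (h.measurable_noise k i) (h.memLp_noise k i)
      (h.indepFun_point_noise k hij)

theorem integral_inner_mean_eq_zero {E : Type*} [NormedAddCommGroup E] [InnerProductSpace ℝ E]
    [FiniteDimensional ℝ E] [MeasurableSpace E] [BorelSpace E]
    {V : Ω → E} {s : Fin n → Ω → E} (hV : MemLp V 2 P) (hs : ∀ i, MemLp (s i) 2 P)
    (h : ∀ i, ∫ ω, inner ℝ (V ω) (s i ω) ∂P = 0) :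
    Integrable (fun ω => inner ℝ (V ω) (mean fun i => s i ω)) P ∧
    ∫ ω, inner ℝ (V ω) (mean fun i => s i ω) ∂P = 0 := by
  have e : (fun ω => inner ℝ (V ω) (mean fun i => s i ω))
      = fun ω => (n : ℝ)⁻¹ * ∑ i, inner ℝ (V ω) (s i ω) := by
    funext ω
    rw [mean, inner_smul_right, inner_sum]
  have hi : ∀ i, Integrable (fun ω => inner ℝ (V ω) (s i ω)) P := fun i =>
    integrable_inner_of_memLp hV (hs i)
  rw [e]
  refine ⟨(integrable_finsetSum _ fun i _ => hi i).const_mul _, ?_⟩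
  rw [integral_const_mul, integral_finsetSum _ fun i _ => hi i]
  simp [h]

theorem memLp_add_sub {E : Type*} [NormedAddCommGroup E] {u v w : Ω → E} (hu : MemLp u 2 P)
    (hv : MemLp v 2 P) (hw : MemLp w 2 P) : MemLp (fun ω => u ω + (v ω - w ω)) 2 P :=
  hu.add (hv.sub hw)

theorem memLp_add_smul {E : Type*} [NormedAddCommGroup E] [InnerProductSpace ℝ E] (a : ℝ)
    {u v : Ω → E} (hu : MemLp u 2 P) (hv : MemLp v 2 P) : MemLp (fun ω => u ω + a • v ω) 2 P :=
  hu.add (hv.const_smul a)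

/-- The iterates, trackers and directions are square integrable. -/
theorem IsRun.memLp (h : IsRun pb I P ξf ξg L₁ L₂ μ₀ c Flow ρ lam δf δg) (k : ℕ) :
    (∀ i, MemLp (fun ω => point (iter pb I ξf ξg k ω) i) 2 P) ∧
    (∀ i, MemLp (fun ω => tracker c (iter pb I ξf ξg k ω) i) 2 P) ∧
    (∀ i, MemLp (fun ω => estimate c (iter pb I ξf ξg k ω) i) 2 P) := by
  induction k with
  | zero =>
    refine ⟨fun i => ?_, fun i => ?_, fun i => ?_⟩
    · have e : (fun ω => point (iter pb I ξf ξg 0 ω) i)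
          = fun _ => tri (pt (I.x₀ i) (I.y₀ i)) (I.θ₀ i) := rfl
      rw [e]; exact memLp_const _
    · simp only [iter, tracker_run_zero]; exact memLp_const _
    · simp only [iter, estimate_run_zero]; exact memLp_const _
  | succ k ih =>
    have h3 : ∀ i, MemLp (fun ω => estimate c (iter pb I ξf ξg (k + 1) ω) i) 2 P := fun i => by
      have e : (fun ω => estimate c (iter pb I ξf ξg (k + 1) ω) i)
          = fun ω => exactDir pb c I.γ (I.μ k) i (point (iter pb I ξf ξg k ω) i)
            + noise pb I ξf ξg c k i ω := funext fun ω => congrFun (estimate_iter_succ k ω) i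
      rw [e]
      exact ((h.regular.isLip_exactDir (h.mu_nonneg k) i).memLp (ih.1 i)).add (h.memLp_noise k i)
    have h2 : ∀ i, MemLp (fun ω => tracker c (iter pb I ξf ξg (k + 1) ω) i) 2 P := fun i => by
      simp only [iter, tracker_run_succ]
      exact memLp_gossip I.W (fun i => memLp_add_sub (ih.2.1 i) (h3 i) (ih.2.2 i)) i
    refine ⟨fun i => ?_, h2, h3⟩
    have e : (fun ω => point (iter pb I ξf ξg (k + 1) ω) i)
        = fun ω => gossip I.W (fun i => point (iter pb I ξf ξg k ω) i
          + (-lam) • tracker c (iter pb I ξf ξg (k + 1) ω) i) i :=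
      funext fun ω => congrFun (point_run_succ (h.rates.x k) (h.rates.y k) (h.rates.θ k)) i
    rw [e]
    exact memLp_gossip I.W (fun i => memLp_add_smul (-lam) (ih.1 i) (h2 i)) i

theorem IsRun.integral_inner_potGrad_noise
    (h : IsRun pb I P ξf ξg L₁ L₂ μ₀ c Flow ρ lam δf δg) (k : ℕ) :
    Integrable (fun ω => inner ℝ (potGrad pb I.γ (I.μ k) (mean (point (iter pb I ξf ξg k ω))))
      (mean fun i => noise pb I ξf ξg c k i ω)) P ∧
    ∫ ω, inner ℝ (potGrad pb I.γ (I.μ k) (mean (point (iter pb I ξf ξg k ω))))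
      (mean fun i => noise pb I ξf ξg c k i ω) ∂P = 0 := by
  have hξ : ∀ i j, j < k → Measurable fun ω => (ξf i j ω, ξg i j ω) :=
    fun i j _ => h.sampling.measurable_pair i j
  have hV : MemLp (fun ω => potGrad pb I.γ (I.μ k) (mean (point (iter pb I ξf ξg k ω)))) 2 P :=
    (h.regular.isLip_potGrad (I.μ k)).memLp (memLp_mean (h.memLp k).1)
  refine integral_inner_mean_eq_zero hV (h.memLp_noise k) fun i => ?_
  exact h.integral_inner_noise k i (measurable_comp_mean (h.regular.isLip_potGrad (I.μ k)).continuous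
    (h.measurable_point k)) hV (h.indepFun_point_potGrad k i)

end Iterates

/-! ### Recursions in expectation -/

/-- Passes a pathwise inequality to expectations. Seven slots suffice for the longest recursion;
shorter ones fill up with zeros. -/
theorem integral_le_comb {Ω : Type*} [MeasurableSpace Ω] {P : Measure Ω}
    {f a₁ a₂ a₃ a₄ a₅ a₆ a₇ : Ω → ℝ} {r₁ r₂ r₃ r₄ r₅ r₆ r₇ : ℝ} (hf : Integrable f P)
    (h₁ : Integrable a₁ P) (h₂ : Integrable a₂ P) (h₃ : Integrable a₃ P) (h₄ : Integrable a₄ P)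
    (h₅ : Integrable a₅ P) (h₆ : Integrable a₆ P) (h₇ : Integrable a₇ P)
    (h : ∀ ω, f ω ≤ r₁ * a₁ ω + r₂ * a₂ ω + r₃ * a₃ ω + r₄ * a₄ ω + r₅ * a₅ ω + r₆ * a₆ ω
      + r₇ * a₇ ω) :
    ∫ ω, f ω ∂P ≤ r₁ * ∫ ω, a₁ ω ∂P + r₂ * ∫ ω, a₂ ω ∂P + r₃ * ∫ ω, a₃ ω ∂P + r₄ * ∫ ω, a₄ ω ∂P
      + r₅ * ∫ ω, a₅ ω ∂P + r₆ * ∫ ω, a₆ ω ∂P + r₇ * ∫ ω, a₇ ω ∂P := by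
  have i₂ : Integrable (fun ω => r₁ * a₁ ω + r₂ * a₂ ω) P := (h₁.const_mul r₁).add (h₂.const_mul r₂)
  have i₃ : Integrable (fun ω => r₁ * a₁ ω + r₂ * a₂ ω + r₃ * a₃ ω) P := i₂.add (h₃.const_mul r₃)
  have i₄ : Integrable (fun ω => r₁ * a₁ ω + r₂ * a₂ ω + r₃ * a₃ ω + r₄ * a₄ ω) P :=
    i₃.add (h₄.const_mul r₄)
  have i₅ : Integrable (fun ω => r₁ * a₁ ω + r₂ * a₂ ω + r₃ * a₃ ω + r₄ * a₄ ω + r₅ * a₅ ω) P :=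
    i₄.add (h₅.const_mul r₅)
  have i₆ : Integrable (fun ω => r₁ * a₁ ω + r₂ * a₂ ω + r₃ * a₃ ω + r₄ * a₄ ω + r₅ * a₅ ω
    + r₆ * a₆ ω) P := i₅.add (h₆.const_mul r₆)
  have i₇ : Integrable (fun ω => r₁ * a₁ ω + r₂ * a₂ ω + r₃ * a₃ ω + r₄ * a₄ ω + r₅ * a₅ ω
    + r₆ * a₆ ω + r₇ * a₇ ω) P := i₆.add (h₇.const_mul r₇)
  refine (integral_mono hf i₇ h).trans ?_
  rw [integral_add i₆ (h₇.const_mul r₇), integral_add i₅ (h₆.const_mul r₆),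
    integral_add i₄ (h₅.const_mul r₅), integral_add i₃ (h₄.const_mul r₄),
    integral_add i₂ (h₃.const_mul r₃), integral_add (h₁.const_mul r₁) (h₂.const_mul r₂)]
  simp only [integral_const_mul]
  exact le_rfl

/-- Telescoping and Cauchy-Schwarz. The factor k is the growth that the decay of μ_k - μ_{k+1} must
later offset. -/
theorem norm_sub_sq_le_sum {E : Type*} [NormedAddCommGroup E] (a : ℕ → E) (k : ℕ) :
    ‖a k - a 0‖ ^ 2 ≤ k * ∑ j ∈ Finset.range k, ‖a (j + 1) - a j‖ ^ 2 := by
  rw [← Finset.sum_range_sub]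
  calc ‖∑ j ∈ Finset.range k, (a (j + 1) - a j)‖ ^ 2
      ≤ (∑ j ∈ Finset.range k, ‖a (j + 1) - a j‖) ^ 2 := by gcongr; exact norm_sum_le _ _
    _ ≤ _ := by
      have := sq_sum_le_card_mul_sum_sq (s := Finset.range k) (f := fun j => ‖a (j + 1) - a j‖)
      rwa [Finset.card_range] at this

section Recursions

variable {n dx dy : ℕ} {Ξf Ξg Ω : Type*} [MeasurableSpace Ξf] [MeasurableSpace Ξg]
  {pb : Problem n dx dy Ξf Ξg} {I : Input n dx dy} {ξf : Fin n → ℕ → Ω → Ξf}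
  {ξg : Fin n → ℕ → Ω → Ξg} {L₁ L₂ μ₀ c Flow ρ lam δf δg : ℝ}
  [MeasurableSpace Ω] {P : Measure Ω} [IsProbabilityMeasure P]

/-- Expected potential at the average iterate. -/
noncomputable def expPot (pb : Problem n dx dy Ξf Ξg) (I : Input n dx dy) (P : Measure Ω)
    (ξf : Fin n → ℕ → Ω → Ξf) (ξg : Fin n → ℕ → Ω → Ξg) (Flow : ℝ) (k : ℕ) : ℝ :=
  ∫ ω, pot pb I.γ Flow (I.μ k) (mean (point (iter pb I ξf ξg k ω))) ∂P

/-- Expected measure of stationarity at the average iterate. -/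
noncomputable def expStat (pb : Problem n dx dy Ξf Ξg) (I : Input n dx dy) (P : Measure Ω)
    (ξf : Fin n → ℕ → Ω → Ξf) (ξg : Fin n → ℕ → Ω → Ξg) (k : ℕ) : ℝ :=
  ∫ ω, stat pb I.γ (I.μ k) (mean (point (iter pb I ξf ξg k ω))) ∂P

/-- Expected consensus error. -/
noncomputable def expSpread (pb : Problem n dx dy Ξf Ξg) (I : Input n dx dy) (P : Measure Ω)
    (ξf : Fin n → ℕ → Ω → Ξf) (ξg : Fin n → ℕ → Ω → Ξg) (k : ℕ) : ℝ :=
  ∫ ω, spread (point (iter pb I ξf ξg k ω)) ∂P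

/-- Expected tracking error of iteration `k`. -/
noncomputable def expTrack (pb : Problem n dx dy Ξf Ξg) (I : Input n dx dy) (P : Measure Ω)
    (ξf : Fin n → ℕ → Ω → Ξf) (ξg : Fin n → ℕ → Ω → Ξg) (c : ℝ) (k : ℕ) : ℝ :=
  ∫ ω, spread (tracker c (iter pb I ξf ξg (k + 1) ω)) ∂P

/-- Expected squared displacement of the average iterate. -/
noncomputable def expShift (pb : Problem n dx dy Ξf Ξg) (I : Input n dx dy) (P : Measure Ω)
    (ξf : Fin n → ℕ → Ω → Ξf) (ξg : Fin n → ℕ → Ω → Ξg) (k : ℕ) : ℝ :=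
  ∫ ω, ‖mean (point (iter pb I ξf ξg k ω)) - mean (point (iter pb I ξf ξg 0 ω))‖ ^ 2 ∂P

/-- Bound of the expected squared average direction. -/
noncomputable def stepBound (pb : Problem n dx dy Ξf Ξg) (I : Input n dx dy) (P : Measure Ω)
    (ξf : Fin n → ℕ → Ω → Ξf) (ξg : Fin n → ℕ → Ω → Ξg) (L₁ L₂ μ₀ c δf δg : ℝ) (k : ℕ) : ℝ :=
  4 * dirLip L₁ L₂ I.γ μ₀ c ^ 2 * expSpread pb I P ξf ξg k
    + 4 * dirConst L₂ I.γ c * expStat pb I P ξf ξg k + 2 * (noiseLevel μ₀ c δf δg / n)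

/-- The initial joint iterates. -/
noncomputable def initPoint (I : Input n dx dy) (i : Fin n) : Tri dx dy :=
  tri (pt (I.x₀ i) (I.y₀ i)) (I.θ₀ i)

theorem point_iter_zero (ω : Ω) : point (iter pb I ξf ξg 0 ω) = initPoint I := rfl

theorem expSpread_zero : expSpread pb I P ξf ξg 0 = spread (initPoint I) := by
  unfold expSpread
  simp_rw [point_iter_zero]
  simp

theorem expPot_zero :
    expPot pb I P ξf ξg Flow 0 = pot pb I.γ Flow (I.μ 0) (mean (initPoint I)) := by
  unfold expPot
  simp_rw [point_iter_zero]
  simp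

theorem expSpread_nonneg (k : ℕ) : 0 ≤ expSpread pb I P ξf ξg k :=
  integral_nonneg fun _ => spread_nonneg _

theorem expTrack_nonneg (k : ℕ) : 0 ≤ expTrack pb I P ξf ξg c k :=
  integral_nonneg fun _ => spread_nonneg _

theorem expStat_nonneg (k : ℕ) : 0 ≤ expStat pb I P ξf ξg k :=
  integral_nonneg fun _ => stat_nonneg _ _ _

theorem IsRun.expPot_nonneg (h : IsRun pb I P ξf ξg L₁ L₂ μ₀ c Flow ρ lam δf δg) (k : ℕ) :
    0 ≤ expPot pb I P ξf ξg Flow k :=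
  integral_nonneg fun _ => h.regular.pot_nonneg (h.mu_nonneg k) _

theorem IsRun.memLp_mean_point (h : IsRun pb I P ξf ξg L₁ L₂ μ₀ c Flow ρ lam δf δg) (k : ℕ) :
    MemLp (fun ω => mean (point (iter pb I ξf ξg k ω))) 2 P := memLp_mean (h.memLp k).1

theorem IsRun.memLp_mean_noise (h : IsRun pb I P ξf ξg L₁ L₂ μ₀ c Flow ρ lam δf δg) (k : ℕ) :
    MemLp (fun ω => mean fun i => noise pb I ξf ξg c k i ω) 2 P := memLp_mean (h.memLp_noise k)

theorem IsRun.integrable_spread_point (h : IsRun pb I P ξf ξg L₁ L₂ μ₀ c Flow ρ lam δf δg)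
    (k : ℕ) : Integrable (fun ω => spread (point (iter pb I ξf ξg k ω))) P :=
  integrable_spread (h.memLp k).1

theorem IsRun.integrable_spread_tracker (h : IsRun pb I P ξf ξg L₁ L₂ μ₀ c Flow ρ lam δf δg)
    (k : ℕ) : Integrable (fun ω => spread (tracker c (iter pb I ξf ξg k ω))) P :=
  integrable_spread (h.memLp k).2.1

theorem IsRun.integrable_norm_mean_noise_sq
    (h : IsRun pb I P ξf ξg L₁ L₂ μ₀ c Flow ρ lam δf δg) (k : ℕ) :
    Integrable (fun ω => ‖mean fun i => noise pb I ξf ξg c k i ω‖ ^ 2) P :=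
  integrable_norm_sq (h.memLp_mean_noise k)

theorem memLp_sub_two {E : Type*} [NormedAddCommGroup E] {u v : Ω → E} (hu : MemLp u 2 P)
    (hv : MemLp v 2 P) : Integrable (fun ω => ‖u ω - v ω‖ ^ 2) P :=
  integrable_norm_sq (hu.sub hv)

theorem IsRun.integrable_shift (h : IsRun pb I P ξf ξg L₁ L₂ μ₀ c Flow ρ lam δf δg) (k l : ℕ) :
    Integrable (fun ω => ‖mean (point (iter pb I ξf ξg k ω))
      - mean (point (iter pb I ξf ξg l ω))‖ ^ 2) P :=
  memLp_sub_two (h.memLp_mean_point k) (h.memLp_mean_point l)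

theorem IsRun.mean_point_succ (h : IsRun pb I P ξf ξg L₁ L₂ μ₀ c Flow ρ lam δf δg) (k : ℕ)
    (ω : Ω) : mean (point (iter pb I ξf ξg (k + 1) ω)) = mean (point (iter pb I ξf ξg k ω))
      + (-lam) • (drift pb c I.γ (I.μ k) (point (iter pb I ξf ξg k ω))
        + mean fun i => noise pb I ξf ξg c k i ω) := by
  have h1 : mean (estimate c (iter pb I ξf ξg (k + 1) ω))
      = drift pb c I.γ (I.μ k) (point (iter pb I ξf ξg k ω))
        + mean fun i => noise pb I ξf ξg c k i ω := by
    rw [estimate_iter_succ, mean_add]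
    rfl
  rw [← h1]
  exact mean_point_run_succ h.mixing.col_sum (h.rates.x k) (h.rates.y k) (h.rates.θ k)

theorem IsRun.integral_shift_succ_le (h : IsRun pb I P ξf ξg L₁ L₂ μ₀ c Flow ρ lam δf δg) (k : ℕ) :
    ∫ ω, ‖mean (point (iter pb I ξf ξg (k + 1) ω)) - mean (point (iter pb I ξf ξg k ω))‖ ^ 2 ∂P
      ≤ lam ^ 2 * stepBound pb I P ξf ξg L₁ L₂ μ₀ c δf δg k := by
  have hi0 : Integrable (fun _ : Ω => (0 : ℝ)) P := integrable_const 0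
  have key := integral_le_comb (r₁ := lam ^ 2 * (4 * dirLip L₁ L₂ I.γ μ₀ c ^ 2))
    (r₂ := lam ^ 2 * (4 * dirConst L₂ I.γ c)) (r₃ := lam ^ 2 * 2) (r₄ := 0) (r₅ := 0) (r₆ := 0)
    (r₇ := 0) (h.integrable_shift (k + 1) k) (h.integrable_spread_point k)
    (h.regular.integrable_stat (I.μ k) (h.memLp_mean_point k)) (h.integrable_norm_mean_noise_sq k)
    hi0 hi0 hi0 hi0 (fun ω => by
      rw [h.mean_point_succ, add_sub_cancel_left, norm_smul, mul_pow, Real.norm_eq_abs, sq_abs,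
        neg_sq]
      have h1 := h.regular.norm_drift_add_sq_le (h.mu_nonneg k) (h.mu_le k)
        (point (iter pb I ξf ξg k ω)) (mean fun i => noise pb I ξf ξg c k i ω)
      have h2 := mul_le_mul_of_nonneg_left h1 (sq_nonneg lam)
      linarith)
  have h3 := mul_le_mul_of_nonneg_left (h.integral_norm_mean_noise_sq_le k)
    (by positivity : 0 ≤ lam ^ 2 * 2)
  rw [← expSpread, ← expStat] at key
  unfold stepBound
  linarith

/-- The gradient of the potential at step k is independent of the samples of that step, so the
linear noise term has mean zero. Noise survives only with lam² and the variance divided by n. -/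
theorem IsRun.expPot_succ_le (h : IsRun pb I P ξf ξg L₁ L₂ μ₀ c Flow ρ lam δf δg) (k : ℕ) :
    expPot pb I P ξf ξg Flow (k + 1) ≤ expPot pb I P ξf ξg Flow k
      - lam * min (c / 2) (eta L₂ I.γ ^ 2 / 2) * expStat pb I P ξf ξg k
      + lam * (1 / min c 1) * dirLip L₁ L₂ I.γ μ₀ c ^ 2 * expSpread pb I P ξf ξg k
      + potConst L₁ L₂ I.γ μ₀ * lam ^ 2 * stepBound pb I P ξf ξg L₁ L₂ μ₀ c δf δg k := by
  have hi0 : Integrable (fun _ : Ω => (0 : ℝ)) P := integrable_const 0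
  have hin := h.integral_inner_potGrad_noise k
  have key := integral_le_comb (r₁ := 1)
    (r₂ := -(lam * min (c / 2) (eta L₂ I.γ ^ 2 / 2))
      + potConst L₁ L₂ I.γ μ₀ * lam ^ 2 * (4 * dirConst L₂ I.γ c))
    (r₃ := lam * (1 / min c 1) * dirLip L₁ L₂ I.γ μ₀ c ^ 2
      + potConst L₁ L₂ I.γ μ₀ * lam ^ 2 * (4 * dirLip L₁ L₂ I.γ μ₀ c ^ 2))
    (r₄ := -lam) (r₅ := potConst L₁ L₂ I.γ μ₀ * lam ^ 2 * 2) (r₆ := 0) (r₇ := 0)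
    (h.regular.integrable_pot (h.mu_nonneg (k + 1)) (h.mu_le (k + 1)) (h.memLp_mean_point (k + 1)))
    (h.regular.integrable_pot (h.mu_nonneg k) (h.mu_le k) (h.memLp_mean_point k))
    (h.regular.integrable_stat (I.μ k) (h.memLp_mean_point k)) (h.integrable_spread_point k)
    hin.1 (h.integrable_norm_mean_noise_sq k) hi0 hi0 (fun ω => by
      rw [h.mean_point_succ]
      have h1 := h.regular.pot_step_le (h.mu_nonneg k) (h.mu_le k) (h.mu_anti k) h.lam_pos.le
        (point (iter pb I ξf ξg k ω)) (mean fun i => noise pb I ξf ξg c k i ω)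
      linarith)
  rw [hin.2, ← expSpread, ← expStat, ← expPot, ← expPot] at key
  have h3 := mul_le_mul_of_nonneg_left (h.integral_norm_mean_noise_sq_le k)
    (mul_nonneg (mul_nonneg h.regular.potConst_nonneg (sq_nonneg lam)) two_pos.le)
  unfold stepBound
  linarith

theorem IsRun.expSpread_succ_le (h : IsRun pb I P ξf ξg L₁ L₂ μ₀ c Flow ρ lam δf δg) (k : ℕ) :
    expSpread pb I P ξf ξg (k + 1) ≤ ρ * expSpread pb I P ξf ξg k
      + 2 / (1 - ρ) * lam ^ 2 * expTrack pb I P ξf ξg c k := by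
  have hi0 : Integrable (fun _ : Ω => (0 : ℝ)) P := integrable_const 0
  have key := integral_le_comb (r₁ := ρ) (r₂ := 2 / (1 - ρ) * lam ^ 2) (r₃ := 0) (r₄ := 0)
    (r₅ := 0) (r₆ := 0) (r₇ := 0) (h.integrable_spread_point (k + 1)) (h.integrable_spread_point k)
    (h.integrable_spread_tracker (k + 1)) hi0 hi0 hi0 hi0 hi0 (fun ω => by
      have h1 : spread (point (iter pb I ξf ξg (k + 1) ω)) ≤ ρ * spread (point (iter pb I ξf ξg k ω))
          + 2 / (1 - ρ) * lam ^ 2 * spread (tracker c (iter pb I ξf ξg (k + 1) ω)) :=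
        spread_point_run_succ_le h.regular.pos h.mixing (h.rates.x k) (h.rates.y k) (h.rates.θ k)
      linarith)
  rw [← expSpread, ← expSpread, ← expTrack] at key
  linarith

theorem IsRun.expShift_le (h : IsRun pb I P ξf ξg L₁ L₂ μ₀ c Flow ρ lam δf δg) (k : ℕ) :
    expShift pb I P ξf ξg k
      ≤ k * ∑ j ∈ Finset.range k, lam ^ 2 * stepBound pb I P ξf ξg L₁ L₂ μ₀ c δf δg j := by
  have hi : ∀ j, Integrable (fun ω => ‖mean (point (iter pb I ξf ξg (j + 1) ω))
      - mean (point (iter pb I ξf ξg j ω))‖ ^ 2) P := fun j => h.integrable_shift (j + 1) j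
  have h1 := integral_mono (h.integrable_shift k 0)
    ((integrable_finsetSum (Finset.range k) fun j _ => hi j).const_mul (k : ℝ))
    fun ω => norm_sub_sq_le_sum (fun j => mean (point (iter pb I ξf ξg j ω))) k
  rw [integral_const_mul, integral_finsetSum _ fun j _ => hi j] at h1
  refine h1.trans ?_
  gcongr with j
  exact h.integral_shift_succ_le j

theorem IsRun.integral_meanSq_noise_le (h : IsRun pb I P ξf ξg L₁ L₂ μ₀ c Flow ρ lam δf δg)
    (k : ℕ) : ∫ ω, meanSq (fun i => noise pb I ξf ξg c k i ω) ∂P ≤ noiseLevel μ₀ c δf δg :=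
  integral_meanSq_le h.regular.pos (h.memLp_noise k) fun i => (h.noise_second_moment k i).2

theorem IsRun.integrable_meanSq_noise (h : IsRun pb I P ξf ξg L₁ L₂ μ₀ c Flow ρ lam δf δg)
    (k : ℕ) : Integrable (fun ω => meanSq (fun i => noise pb I ξf ξg c k i ω)) P :=
  integrable_meanSq (h.memLp_noise k)

/-- Unlike in the averages, the noise enters per agent, without lam² or 1/n; after summation it
produces the term with (1-ρ)⁻⁴. The penalty increment is compared with the initial points, hence the
displacement `expShift`. -/
theorem IsRun.expTrack_succ_le (h : IsRun pb I P ξf ξg L₁ L₂ μ₀ c Flow ρ lam δf δg) (k : ℕ) :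
    expTrack pb I P ξf ξg c (k + 1) ≤ ρ * expTrack pb I P ξf ξg c k
      + 2 / (1 - ρ) * (2 * dirLip L₁ L₂ I.γ μ₀ c ^ 2 * (2 * expSpread pb I P ξf ξg (k + 1)
          + 2 * expSpread pb I P ξf ξg k + lam ^ 2 * stepBound pb I P ξf ξg L₁ L₂ μ₀ c δf δg k)
        + 4 * (I.μ k - I.μ (k + 1)) ^ 2
          * (2 * spread (gossip I.W fun i => upperDir pb c i (initPoint I i))
            + 2 * (c ^ 2 * L₁ ^ 2) * (2 * expSpread pb I P ξf ξg k + 2 * expSpread pb I P ξf ξg 0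
              + expShift pb I P ξf ξg k))
        + 16 * noiseLevel μ₀ c δf δg) := by
  have hβ : 0 < 1 - ρ := by have := h.mixing.rho_lt; linarith
  have hr : 0 < 2 / (1 - ρ) := by positivity
  set r := 2 / (1 - ρ)
  set d := dirLip L₁ L₂ I.γ μ₀ c ^ 2
  have hd : 0 ≤ d := sq_nonneg _
  set m := (I.μ k - I.μ (k + 1)) ^ 2
  have hm : 0 ≤ m := sq_nonneg _
  set q := spread (gossip I.W fun i => upperDir pb c i (initPoint I i))
  have key := integral_le_comb (r₁ := ρ) (r₂ := r * (2 * d * 2))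
    (r₃ := r * (2 * d * 2) + r * (4 * m * (2 * (c ^ 2 * L₁ ^ 2) * 2))) (r₄ := r * (2 * d))
    (r₅ := r * (4 * m)) (r₆ := r * (4 * m * (2 * (c ^ 2 * L₁ ^ 2)))) (r₇ := r * 8)
    (h.integrable_spread_tracker (k + 2)) (h.integrable_spread_tracker (k + 1))
    (h.integrable_spread_point (k + 1)) (h.integrable_spread_point k) (h.integrable_shift (k + 1) k)
    (integrable_const (2 * q + 2 * (c ^ 2 * L₁ ^ 2) * (2 * spread (initPoint I))))
    (h.integrable_shift k 0)
    ((h.integrable_meanSq_noise (k + 1)).add (h.integrable_meanSq_noise k)) (fun ω => by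
      have h1 : spread (tracker c (iter pb I ξf ξg (k + 2) ω))
          ≤ ρ * spread (tracker c (iter pb I ξf ξg (k + 1) ω))
            + r * spread (gossip I.W fun i =>
              estimate c (iter pb I ξf ξg (k + 2) ω) i - estimate c (iter pb I ξf ξg (k + 1) ω) i) :=
        spread_tracker_run_succ_le h.regular.pos h.mixing
      have h2 := h.regular.spread_gossip_increment_le h.mixing (μ := I.μ k) (h.mu_nonneg (k + 1))
        (h.mu_le (k + 1)) (point (iter pb I ξf ξg k ω)) (point (iter pb I ξf ξg (k + 1) ω))
        (fun i => noise pb I ξf ξg c k i ω) (fun i => noise pb I ξf ξg c (k + 1) i ω)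
      have h3 := spread_gossip_upperDir_le h.regular.smooth h.regular.pos h.mixing (c := c)
        (point (iter pb I ξf ξg k ω)) (point (iter pb I ξf ξg 0 ω))
      have h4 := mul_le_mul_of_nonneg_left h3 (mul_nonneg (by norm_num : (0 : ℝ) ≤ 4) hm)
      rw [estimate_iter_succ, estimate_iter_succ] at h1
      have h5 := mul_le_mul_of_nonneg_left (h2.trans (add_le_add_left (add_le_add_right h4 _) _)) hr.le
      have h6 : spread (gossip I.W fun i => upperDir pb c i (point (iter pb I ξf ξg 0 ω) i)) = q := rfl
      have h7 : spread (point (iter pb I ξf ξg 0 ω)) = spread (initPoint I) := rfl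
      rw [h6, h7] at h5
      simp only [Pi.add_apply]
      linarith)
  have e1 : ∫ ω, ((fun ω => meanSq fun i => noise pb I ξf ξg c (k + 1) i ω)
        + fun ω => meanSq fun i => noise pb I ξf ξg c k i ω) ω ∂P
      ≤ 2 * noiseLevel μ₀ c δf δg := by
    refine (integral_add (h.integrable_meanSq_noise (k + 1)) (h.integrable_meanSq_noise k)).trans_le ?_
    linarith [h.integral_meanSq_noise_le (k + 1), h.integral_meanSq_noise_le k]
  have e2 := mul_le_mul_of_nonneg_left e1 (by positivity : 0 ≤ r * 8)
  have e3 := mul_le_mul_of_nonneg_left (h.integral_shift_succ_le k)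
    (by positivity : 0 ≤ r * (2 * d))
  rw [← expSpread, ← expSpread, ← expShift, integral_const, probReal_univ, one_smul] at key
  rw [expSpread_zero]
  unfold expTrack
  linarith

/-- The initial dispersion of the upper-level gradients after one communication round. -/
theorem IsRun.spread_gossip_upperDir_init_le
    (h : IsRun pb I P ξf ξg L₁ L₂ μ₀ c Flow ρ lam δf δg) :
    μ₀ ^ 2 * spread (gossip I.W fun i => upperDir pb c i (initPoint I i))
      ≤ (8 + 8 * c ^ 2) * (expTrack pb I P ξf ξg c 0 + noiseLevel μ₀ c δf δg)
        + 2 * (c ^ 2 * L₂ ^ 2) * (2 * expSpread pb I P ξf ξg 0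
          + 2 / (1 / (2 * I.γ) - L₂) * expPot pb I P ξf ξg Flow 0) := by
  have hi0 : Integrable (fun _ : Ω => (0 : ℝ)) P := integrable_const 0
  set B := 2 * (c ^ 2 * L₂ ^ 2) * (2 * expSpread pb I P ξf ξg 0
          + 2 / (1 / (2 * I.γ) - L₂) * expPot pb I P ξf ξg Flow 0) with hB
  have key := integral_le_comb (r₁ := 8 + 8 * c ^ 2) (r₂ := 8 + 8 * c ^ 2) (r₃ := 1) (r₄ := 0)
    (r₅ := 0) (r₆ := 0) (r₇ := 0)
    (integrable_const (μ₀ ^ 2 * spread (gossip I.W fun i => upperDir pb c i (initPoint I i))))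
    (h.integrable_spread_tracker 1) (h.integrable_meanSq_noise 0) (integrable_const B)
    hi0 hi0 hi0 hi0 (fun ω => by
      have h1 := h.regular.sq_mul_spread_gossip_upperDir_le h.mixing (h.mu_nonneg 0)
        (point (iter pb I ξf ξg 0 ω)) (fun i => noise pb I ξf ξg c 0 i ω)
      have h2 : tracker c (iter pb I ξf ξg 1 ω) = gossip I.W (estimate c (iter pb I ξf ξg (0 + 1) ω)) :=
        tracker_run_one c
      rw [estimate_iter_succ] at h2
      rw [← h2, point_iter_zero, ← expPot_zero (P := P) (ξf := ξf) (ξg := ξg),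
        ← expSpread_zero (P := P) (ξf := ξf) (ξg := ξg) (pb := pb), ← hB, h.mu_zero] at h1
      linarith)
  rw [integral_const, integral_const, probReal_univ, one_smul, one_smul] at key
  have h3 := mul_le_mul_of_nonneg_left (h.integral_meanSq_noise_le 0)
    (by positivity : 0 ≤ 8 + 8 * c ^ 2)
  unfold expTrack
  linarith

end Recursions

/-! ### Summed bounds for a run -/

/-- The constant in the bound `stepBound_le`. -/
noncomputable def stepConst (L₁ L₂ γ μ₀ c : ℝ) : ℝ :=
  4 * dirLip L₁ L₂ γ μ₀ c ^ 2 + 4 * dirConst L₂ γ c + 2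

/-- A common constant for all recursions. -/
noncomputable def trackConst (L₁ L₂ γ μ₀ c : ℝ) : ℝ :=
  3 + 1 / min (c / 2) (eta L₂ γ ^ 2 / 2) + 1 / min c 1 * dirLip L₁ L₂ γ μ₀ c ^ 2
    + potConst L₁ L₂ γ μ₀ * stepConst L₁ L₂ γ μ₀ c
    + 2 * (4 * dirLip L₁ L₂ γ μ₀ c ^ 2 + 2 * dirLip L₁ L₂ γ μ₀ c ^ 2 * stepConst L₁ L₂ γ μ₀ c
      + 4 * (2 + 4 * (c ^ 2 * L₁ ^ 2)) + 16)
    + stepConst L₁ L₂ γ μ₀ c + μ₀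
    + ((8 + 8 * c ^ 2) / μ₀ ^ 2 + 4 * (c ^ 2 * L₂ ^ 2) / μ₀ ^ 2
      + 4 * (c ^ 2 * L₂ ^ 2) / (1 / (2 * γ) - L₂) / μ₀ ^ 2)

/-- What the recursions need from the constant. -/
structure TrackBounds (C L₁ L₂ γ μ₀ c : ℝ) : Prop where
  one_le : 1 ≤ C
  two_le : 2 ≤ C
  inv_le : 1 / C ≤ min (c / 2) (eta L₂ γ ^ 2 / 2)
  drift_le : 1 / min c 1 * dirLip L₁ L₂ γ μ₀ c ^ 2 ≤ C
  pot_le : potConst L₁ L₂ γ μ₀ * stepConst L₁ L₂ γ μ₀ c ≤ C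
  track_le : 2 * (4 * dirLip L₁ L₂ γ μ₀ c ^ 2 + 2 * dirLip L₁ L₂ γ μ₀ c ^ 2 * stepConst L₁ L₂ γ μ₀ c
      + 4 * (2 + 4 * (c ^ 2 * L₁ ^ 2)) + 16) ≤ C
  step_le : stepConst L₁ L₂ γ μ₀ c ≤ C
  mu_le : μ₀ ≤ C
  init_le : 1 + ((8 + 8 * c ^ 2) / μ₀ ^ 2 + 4 * (c ^ 2 * L₂ ^ 2) / μ₀ ^ 2
      + 4 * (c ^ 2 * L₂ ^ 2) / (1 / (2 * γ) - L₂) / μ₀ ^ 2) ≤ C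

/-- The constant is a sum of nonnegative quantities, so each requirement follows by dropping the
others. -/
theorem trackBounds {L₁ L₂ γ μ₀ c : ℝ} (hL₁ : 0 ≤ L₁) (hL₂ : 0 < L₂)
    (hγ : γ ∈ Set.Ioo 0 (1 / (2 * L₂))) (hμ : 0 < μ₀) (hc : 0 < c) :
    TrackBounds (trackConst L₁ L₂ γ μ₀ c) L₁ L₂ γ μ₀ c := by
  have hη := eta_pos hL₂ hγ
  have hr := half_sub_pos hL₂ hγ
  have hγ0 := hγ.1
  have hp : 0 ≤ potConst L₁ L₂ γ μ₀ := by unfold potConst; positivity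
  have ha : 0 < min (c / 2) (eta L₂ γ ^ 2 / 2) := by positivity
  have hb : 0 < min c 1 := by positivity
  have hq := dirConst_nonneg L₂ γ c
  have hs : 0 ≤ stepConst L₁ L₂ γ μ₀ c := by unfold stepConst; positivity
  have t1 : 0 ≤ 1 / min (c / 2) (eta L₂ γ ^ 2 / 2) := by positivity
  have t2 : 0 ≤ 1 / min c 1 * dirLip L₁ L₂ γ μ₀ c ^ 2 := by positivity
  have t3 : 0 ≤ potConst L₁ L₂ γ μ₀ * stepConst L₁ L₂ γ μ₀ c := by positivity
  have t4 : 0 ≤ 2 * (4 * dirLip L₁ L₂ γ μ₀ c ^ 2 + 2 * dirLip L₁ L₂ γ μ₀ c ^ 2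
    * stepConst L₁ L₂ γ μ₀ c + 4 * (2 + 4 * (c ^ 2 * L₁ ^ 2)) + 16) := by positivity
  have t5 : 0 ≤ (8 + 8 * c ^ 2) / μ₀ ^ 2 + 4 * (c ^ 2 * L₂ ^ 2) / μ₀ ^ 2
      + 4 * (c ^ 2 * L₂ ^ 2) / (1 / (2 * γ) - L₂) / μ₀ ^ 2 := by positivity
  constructor
  case inv_le =>
    rw [one_div_le (by unfold trackConst; linarith) ha]
    unfold trackConst
    linarith
  all_goals unfold trackConst; linarith

/-- Collects the terms of the recursion of the tracking error. -/
theorem track_terms_le {C d e l X X' X₀ Z m Q s b E B β : ℝ} (hβ : 0 < β) (hd : 0 ≤ d) (he : 0 ≤ e)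
    (hl : 0 ≤ l) (hX : 0 ≤ X) (hX' : 0 ≤ X') (hX₀ : 0 ≤ X₀) (hZ : 0 ≤ Z) (hm : 0 ≤ m) (hQ : 0 ≤ Q)
    (hs : 0 ≤ s) (hb : 0 ≤ b) (hE : 0 ≤ E) (hB : B ≤ b * (e * E))
    (hC : 2 * (4 * d + 2 * d * e + 4 * (2 + 4 * l) + 16) ≤ C) :
    2 / β * (2 * d * (2 * X' + 2 * X + B) + 4 * m * (2 * Q + 2 * l * (2 * X + 2 * X₀ + Z)) + 16 * s)
      ≤ C / β * (X + X' + b * E + s + m * (Q + X₀ + X + Z)) := by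
  set R := X + X' + b * E + s + m * (Q + X₀ + X + Z) with hRdef
  have p1 : 0 ≤ b * E := by positivity
  have p2 : 0 ≤ m * (Q + X₀ + X + Z) := by positivity
  have s1 := mul_le_mul_of_nonneg_left (by linarith : X + X' ≤ R) (by positivity : 0 ≤ 4 * d)
  have s2 := mul_le_mul_of_nonneg_left (hB.trans_eq (mul_left_comm _ _ _))
    (by positivity : 0 ≤ 2 * d)
  have s3 := mul_le_mul_of_nonneg_left (by linarith : b * E ≤ R) (by positivity : 0 ≤ 2 * d * e)
  have s4 := mul_le_mul_of_nonneg_left (by linarith : m * (Q + X₀ + X + Z) ≤ R)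
    (by positivity : 0 ≤ 4 * (2 + 4 * l))
  have s5 : 4 * m * (2 * Q + 2 * l * (2 * X + 2 * X₀ + Z))
      ≤ 4 * (2 + 4 * l) * (m * (Q + X₀ + X + Z)) := by
    have : 0 ≤ 4 * m * (4 * l * Q + 2 * l * Z + 2 * (X₀ + X + Z)) := by positivity
    linarith
  have hR : 0 ≤ R := by positivity
  have b1 : 2 * d * (2 * X' + 2 * X + B) + 4 * m * (2 * Q + 2 * l * (2 * X + 2 * X₀ + Z)) + 16 * s
      ≤ (4 * d + 2 * d * e + 4 * (2 + 4 * l) + 16) * R := by linarith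
  have b2 := mul_le_mul_of_nonneg_right hC hR
  have b3 := mul_le_mul_of_nonneg_left (b1.trans (by linarith :
    _ ≤ C * R / 2)) (by positivity : 0 ≤ 2 / β)
  refine b3.trans_eq ?_
  field_simp

/-- Collects the terms of the bound of the initial dispersion. -/
theorem init_terms_le {C c l r μ Q X T D s : ℝ} (hl : 0 ≤ l) (hr : 0 < r) (hμ : 0 < μ)
    (hX : 0 ≤ X) (hT : 0 ≤ T) (hD : 0 ≤ D) (hs : 0 ≤ s)
    (h : μ ^ 2 * Q ≤ (8 + 8 * c ^ 2) * (D + s) + 2 * l * (2 * X + 2 / r * T))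
    (hC : 1 + ((8 + 8 * c ^ 2) / μ ^ 2 + 4 * l / μ ^ 2 + 4 * l / r / μ ^ 2) ≤ C) :
    Q + X ≤ C * (D + X + T + s) := by
  refine le_trans ?_ (mul_le_mul_of_nonneg_right hC (by positivity))
  rw [← le_div_iff₀' (by positivity)] at h
  set y₁ := (8 + 8 * c ^ 2) / μ ^ 2 with hy₁
  set y₂ := 4 * l / μ ^ 2 with hy₂
  set y₃ := 4 * l / r / μ ^ 2 with hy₃
  have e : ((8 + 8 * c ^ 2) * (D + s) + 2 * l * (2 * X + 2 / r * T)) / μ ^ 2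
      = y₁ * (D + s) + y₂ * X + y₃ * T := by
    rw [hy₁, hy₂, hy₃]; field_simp; ring
  rw [e] at h
  have q1 : 0 ≤ y₁ := by positivity
  have q2 : 0 ≤ y₂ := by positivity
  have q3 : 0 ≤ y₃ := by positivity
  have z1 : 0 ≤ (1 + y₂ + y₃) * (D + s) := by positivity
  have z2 : 0 ≤ (y₁ + y₃) * X := by positivity
  have z3 : 0 ≤ (1 + y₁ + y₂) * T := by positivity
  linarith

section Sums

variable {n dx dy : ℕ} {Ξf Ξg Ω : Type*} [MeasurableSpace Ξf] [MeasurableSpace Ξg]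
  {pb : Problem n dx dy Ξf Ξg} {I : Input n dx dy} {ξf : Fin n → ℕ → Ω → Ξf}
  {ξg : Fin n → ℕ → Ω → Ξg} {L₁ L₂ μ₀ c Flow ρ lam δf δg : ℝ}
  [MeasurableSpace Ω] {P : Measure Ω} [IsProbabilityMeasure P]

theorem stepBound_le (k : ℕ) :
    stepBound pb I P ξf ξg L₁ L₂ μ₀ c δf δg k ≤ stepConst L₁ L₂ I.γ μ₀ c
      * (expStat pb I P ξf ξg k + expSpread pb I P ξf ξg k + noiseLevel μ₀ c δf δg / n) := by
  have hS := expStat_nonneg (pb := pb) (I := I) (P := P) (ξf := ξf) (ξg := ξg) k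
  have hX := expSpread_nonneg (pb := pb) (I := I) (P := P) (ξf := ξf) (ξg := ξg) k
  have hs := div_nonneg (noiseLevel_nonneg μ₀ c δf δg) (Nat.cast_nonneg (α := ℝ) n)
  have hq := dirConst_nonneg L₂ I.γ c
  have hd := sq_nonneg (dirLip L₁ L₂ I.γ μ₀ c)
  unfold stepBound stepConst
  set S := expStat pb I P ξf ξg k
  set X := expSpread pb I P ξf ξg k
  set s := noiseLevel μ₀ c δf δg / n
  set d := dirLip L₁ L₂ I.γ μ₀ c ^ 2
  set q := dirConst L₂ I.γ c
  have p1 : 0 ≤ 4 * d * (S + s) := by positivity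
  have p2 : 0 ≤ 4 * q * (X + s) := by positivity
  linarith

/-- Feeds the expected recursions into `tracking_sum_le` with β = 1 - ρ and m_k = μ_k - μ_{k+1}. The
initial consensus error is part of `Q`, since the comparison with the initial points produces it at
every step. -/
theorem IsRun.sum_stat_add_spread_le (h : IsRun pb I P ξf ξg L₁ L₂ μ₀ c Flow ρ lam δf δg)
    (hμ : ∀ k : ℕ, ((k : ℝ) + 1) * (I.μ k - I.μ (k + 1)) ≤ μ₀) {C : ℝ}
    (hC : TrackBounds C L₁ L₂ I.γ μ₀ c) (hlam : lam ≤ 1 / (100 * C ^ 7) * (1 - ρ) ^ 4)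
    {K : ℕ} (hK : 0 < K) :
    lam * (∑ k ∈ Finset.range K, expStat pb I P ξf ξg k
        + ∑ k ∈ Finset.range K, expSpread pb I P ξf ξg k)
      ≤ 300 * C ^ 8 * (expPot pb I P ξf ξg Flow 0 + lam * expSpread pb I P ξf ξg 0 / (1 - ρ)
        + lam ^ 2 * expTrack pb I P ξf ξg c 0 / (1 - ρ) ^ 3
        + K * lam ^ 2 * noiseLevel μ₀ c δf δg / n
        + K * lam ^ 3 * noiseLevel μ₀ c δf δg / (1 - ρ) ^ 4) := by
  have hρ0 := h.mixing.rho_nonneg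
  have hρ1 := h.mixing.rho_lt
  have hβ : 0 < 1 - ρ := by linarith
  have hC0 : 0 < C := by linarith [hC.one_le]
  have hlam0 := h.lam_pos
  have hr := half_sub_pos h.regular.pos₂ h.regular.mem
  have hμ0 := h.regular.mu_pos
  have hs := noiseLevel_nonneg μ₀ c δf δg
  set s := noiseLevel μ₀ c δf δg with hsdef
  have hN : (1 : ℝ) ≤ n := by exact_mod_cast h.regular.pos
  set Q₁ := spread (gossip I.W fun i => upperDir pb c i (initPoint I i)) with hQ₁
  have hQ₁0 : 0 ≤ Q₁ := spread_nonneg _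
  have hX := fun k => expSpread_nonneg (pb := pb) (I := I) (P := P) (ξf := ξf) (ξg := ξg) k
  have hS := fun k => expStat_nonneg (pb := pb) (I := I) (P := P) (ξf := ξf) (ξg := ξg) k
  have hD := fun k => expTrack_nonneg (pb := pb) (I := I) (P := P) (ξf := ξf) (ξg := ξg) (c := c) k
  have hT := h.expPot_nonneg
  have hE : ∀ k, 0 ≤ expStat pb I P ξf ξg k + expSpread pb I P ξf ξg k + s / n := fun k =>
    add_nonneg (add_nonneg (hS k) (hX k)) (by positivity)
  have hB : ∀ k, lam ^ 2 * stepBound pb I P ξf ξg L₁ L₂ μ₀ c δf δg k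
      ≤ lam ^ 2 * (stepConst L₁ L₂ I.γ μ₀ c
        * (expStat pb I P ξf ξg k + expSpread pb I P ξf ξg k + s / n)) := fun k =>
    mul_le_mul_of_nonneg_left (stepBound_le k) (sq_nonneg lam)
  refine tracking_sum_le (T := expPot pb I P ξf ξg Flow) (X := expSpread pb I P ξf ξg)
    (D := expTrack pb I P ξf ξg c) (S := expStat pb I P ξf ξg) (Z := expShift pb I P ξf ξg)
    (m := fun k => I.μ k - I.μ (k + 1)) (Q := Q₁ + expSpread pb I P ξf ξg 0) hC.one_le hβ
    (by linarith) hlam0 hlam hs hN (add_nonneg hQ₁0 (hX 0)) hT hX hD hS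
    (fun k => sub_nonneg.mpr (h.mu_anti k)) (fun k => (hμ k).trans hC.mu_le) ?_ ?_ ?_ ?_ ?_ ?_ hK
  · intro K
    -- The decrements telescope to μ₀ - μ_K ≤ μ₀.
    rw [Finset.sum_range_sub', h.mu_zero]
    linarith [h.mu_nonneg K, hC.mu_le]
  · intro k
    have h1 := h.expPot_succ_le k
    have h2 := mul_le_mul_of_nonneg_left (hB k) h.regular.potConst_nonneg
    have h3 := mul_le_mul_of_nonneg_right hC.pot_le (mul_nonneg (sq_nonneg lam) (hE k))
    have h4 := mul_le_mul_of_nonneg_right hC.inv_le (mul_nonneg hlam0.le (hS k))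
    have h5 := mul_le_mul_of_nonneg_right hC.drift_le (mul_nonneg hlam0.le (hX k))
    have e : lam / C * expStat pb I P ξf ξg k = 1 / C * (lam * expStat pb I P ξf ξg k) := by ring
    rw [e]
    linarith
  · intro k
    have h1 := h.expSpread_succ_le k
    have h2 : 2 / (1 - ρ) * lam ^ 2 * expTrack pb I P ξf ξg c k
        ≤ C / (1 - ρ) * lam ^ 2 * expTrack pb I P ξf ξg c k := by
      have := hD k
      have := hC.two_le
      gcongr
    linarith
  · intro k
    have h1 := h.expTrack_succ_le k
    have hZ : 0 ≤ expShift pb I P ξf ξg k := integral_nonneg fun _ => sq_nonneg _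
    have hmk : 0 ≤ (I.μ k - I.μ (k + 1)) ^ 2 := sq_nonneg _
    refine h1.trans ?_
    have hq : 0 ≤ stepConst L₁ L₂ I.γ μ₀ c := by
      have := dirConst_nonneg L₂ I.γ c
      unfold stepConst
      positivity
    rw [sub_sub_cancel]
    refine add_le_add le_rfl ?_
    exact track_terms_le hβ (sq_nonneg _) hq (by positivity) (hX k) (hX (k + 1)) (hX 0) hZ hmk hQ₁0
      hs (sq_nonneg lam) (hE k) (hB k) hC.track_le
  · intro k
    refine (h.expShift_le k).trans ?_
    refine mul_le_mul_of_nonneg_left (Finset.sum_le_sum fun j _ => (hB j).trans ?_)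
      (Nat.cast_nonneg k)
    rw [mul_left_comm, ← mul_assoc]
    have := hE j
    have := hC.step_le
    gcongr
  · have h1 := h.spread_gossip_upperDir_init_le
    exact init_terms_le (by positivity) hr hμ0 (hX 0) (hT 0) (hD 0) hs h1 hC.init_le

end Sums

/-! ### The quantities of the convergence theorem -/

section Quantities

variable {n dx dy : ℕ} {Ξf Ξg Ω : Type*} [MeasurableSpace Ξf] [MeasurableSpace Ξg]
  {pb : Problem n dx dy Ξf Ξg} {I : Input n dx dy} {ξf : Fin n → ℕ → Ω → Ξf}
  {ξg : Fin n → ℕ → Ω → Ξg} {L₁ L₂ μ₀ c Flow ρ lam δf δg : ℝ}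
  [MeasurableSpace Ω] {P : Measure Ω} [IsProbabilityMeasure P]

theorem Regular.gradSq_eq (h : Regular pb L₁ L₂ I.γ μ₀ c Flow) (k : ℕ) (ω : Ω) :
    gradSq pb I ξf ξg k ω
      = ‖psiGrad pb I.γ (I.μ k) (mean (point (iter pb I ξf ξg k ω))).fst‖ ^ 2 := by
  rw [gradSq, (h.smooth.quadApprox_Psi h.pos h.nonneg₁ h.pos₂ h.mem (I.μ k)).gradient, mean_point,
    tri_fst]

theorem IsRun.integrable_gradSq (h : IsRun pb I P ξf ξg L₁ L₂ μ₀ c Flow ρ lam δf δg) (k : ℕ) :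
    Integrable (gradSq pb I ξf ξg k) P ∧ ∫ ω, gradSq pb I ξf ξg k ω ∂P ≤ expStat pb I P ξf ξg k := by
  have e : gradSq pb I ξf ξg k
      = fun ω => ‖psiGrad pb I.γ (I.μ k) (mean (point (iter pb I ξf ξg k ω))).fst‖ ^ 2 :=
    funext fun ω => h.regular.gradSq_eq k ω
  have hi : Integrable (gradSq pb I ξf ξg k) P := by
    rw [e]
    exact integrable_norm_sq (((h.regular.isLip_psiGrad (I.μ k)).comp isLip_fst).memLp
      (h.memLp_mean_point k))
  refine ⟨hi, integral_mono hi (h.regular.integrable_stat (I.μ k) (h.memLp_mean_point k))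
    fun ω => ?_⟩
  simp only [h.regular.gradSq_eq k ω, stat]
  exact le_add_of_nonneg_right (sq_nonneg _)

theorem consSq_eq (k : ℕ) : consSq pb I ξf ξg k = fun ω => spread (point (iter pb I ξf ξg k ω)) :=
  funext fun _ => (spread_point _).symm

theorem mean_initPoint : mean (initPoint I) = tri (pt (avg I.x₀) (avg I.y₀)) (avg I.θ₀) :=
  mean_point (State.mk I.θ₀ I.x₀ I.y₀ 0 0 0 0 0 0)

theorem spread_initPoint : spread (initPoint I) = disp I.x₀ + disp I.y₀ + disp I.θ₀ :=
  spread_tri _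

/-- The expansion around the minimizer has no linear term. It converts the initial gap in the
potential into the squared distance used in the Lyapunov function. -/
theorem Regular.env_sub_V_le {γ : ℝ} (h : Regular pb L₁ L₂ γ μ₀ c Flow) (z : Pair dx dy)
    (θ : Vec dy) :
    pb.envObj γ z θ - pb.V γ z ≤ (L₂ + 1 / γ) * ‖θ - pb.thetaStar γ z‖ ^ 2 := by
  have h1 := (abs_le.mp (h.smooth.env_quad h.pos h.pos₂ h.gamma_pos z z (pb.thetaStar γ z) θ)).2
  rw [h.smooth.envGradθ_thetaStar h.pos h.pos₂ h.mem, ← h.smooth.V_eq h.pos h.pos₂ h.mem, sub_self,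
    inner_zero_left, inner_zero_right, norm_zero] at h1
  linarith

theorem IsRun.expPot_zero_le (h : IsRun pb I P ξf ξg L₁ L₂ μ₀ c Flow ρ lam δf δg) :
    expPot pb I P ξf ξg Flow 0 ≤ phi0 pb I Flow + (L₂ + 1 / I.γ) * lowErr0 pb I := by
  rw [expPot_zero, mean_initPoint]
  have h1 := h.regular.env_sub_V_le (pt (avg I.x₀) (avg I.y₀)) (avg I.θ₀)
  simp only [pot, phi0, lowErr0, Problem.Psi, tri_fst, tri_snd]
  linarith

theorem IsRun.phi0_nonneg (h : IsRun pb I P ξf ξg L₁ L₂ μ₀ c Flow ρ lam δf δg) :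
    0 ≤ phi0 pb I Flow := by
  have h1 := h.regular.smooth.V_le_G h.regular.pos h.regular.pos₂ h.regular.mem
    (pt (avg I.x₀) (avg I.y₀))
  have h2 := mul_nonneg (h.mu_nonneg 0)
    (sub_nonneg.mpr (h.regular.lower (pt (avg I.x₀) (avg I.y₀))))
  simp only [phi0]
  linarith

theorem isLip_pair_fst : IsLip fun z : Pair dx dy => z.fst :=
  ⟨1, zero_le_one, fun z z' => by rw [one_mul]; exact norm_fst_le (z - z')⟩

theorem isLip_pair_snd : IsLip fun z : Pair dx dy => z.snd :=
  ⟨1, zero_le_one, fun z z' => by rw [one_mul]; exact norm_snd_le (z - z')⟩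

/-- The expected initial tracking error in terms of the trackers of the three variables. -/
theorem IsRun.expTrack_zero_eq (h : IsRun pb I P ξf ξg L₁ L₂ μ₀ c Flow ρ lam δf δg) :
    expTrack pb I P ξf ξg c 0 = c ^ 2 * ∫ ω, disp (iter pb I ξf ξg 1 ω).Dx ∂P
      + c ^ 2 * ∫ ω, disp (iter pb I ξf ξg 1 ω).Dy ∂P + ∫ ω, disp (iter pb I ξf ξg 1 ω).Dθ ∂P := by
  have hD := (h.memLp 1).2.1
  have hx : Integrable (fun ω => c ^ 2 * disp (iter pb I ξf ξg 1 ω).Dx) P := by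
    have := integrable_spread fun i => (isLip_pair_fst.comp isLip_fst).memLp (hD i)
    refine this.congr (Filter.Eventually.of_forall fun ω => ?_)
    exact spread_smul c _
  have hy : Integrable (fun ω => c ^ 2 * disp (iter pb I ξf ξg 1 ω).Dy) P := by
    have := integrable_spread fun i => (isLip_pair_snd.comp isLip_fst).memLp (hD i)
    refine this.congr (Filter.Eventually.of_forall fun ω => ?_)
    exact spread_smul c _
  have hθ : Integrable (fun ω => disp (iter pb I ξf ξg 1 ω).Dθ) P :=
    integrable_spread fun i => isLip_snd.memLp (hD i)
  have hxy : Integrable (fun ω => c ^ 2 * disp (iter pb I ξf ξg 1 ω).Dx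
    + c ^ 2 * disp (iter pb I ξf ξg 1 ω).Dy) P := hx.add hy
  unfold expTrack
  simp_rw [spread_tracker]
  rw [integral_add hxy hθ, integral_add hx hy, integral_const_mul, integral_const_mul]

/-- The initial tracking error is bounded by the dispersion of the exact directions. -/
theorem IsRun.expTrack_zero_le (h : IsRun pb I P ξf ξg L₁ L₂ μ₀ c Flow ρ lam δf δg) :
    expTrack pb I P ξf ξg c 0
      ≤ 2 * (c ^ 2 * disp (fun i => dirx (I.μ 0) (∇ (pb.f i)) (∇ (pb.g i)) (I.x₀ i) (I.y₀ i) (I.θ₀ i))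
        + c ^ 2 * disp (fun i => diry I.γ (I.μ 0) (∇ (pb.f i)) (∇ (pb.g i)) (I.x₀ i) (I.y₀ i) (I.θ₀ i))
        + disp (fun i => dirθ I.γ (∇ (pb.g i)) (I.x₀ i) (I.y₀ i) (I.θ₀ i)))
        + 2 * noiseLevel μ₀ c δf δg := by
  have hi0 : Integrable (fun _ : Ω => (0 : ℝ)) P := integrable_const 0
  set E := spread fun i => exactDir pb c I.γ (I.μ 0) i (initPoint I i) with hE
  have e : E = c ^ 2 * disp (fun i => dirx (I.μ 0) (∇ (pb.f i)) (∇ (pb.g i)) (I.x₀ i) (I.y₀ i) (I.θ₀ i))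
        + c ^ 2 * disp (fun i => diry I.γ (I.μ 0) (∇ (pb.f i)) (∇ (pb.g i)) (I.x₀ i) (I.y₀ i) (I.θ₀ i))
        + disp (fun i => dirθ I.γ (∇ (pb.g i)) (I.x₀ i) (I.y₀ i) (I.θ₀ i)) := by
    rw [disp_eq_spread, disp_eq_spread, ← spread_smul, ← spread_smul]
    exact spread_tri _
  rw [← e]
  have key := integral_le_comb (r₁ := 2) (r₂ := 2) (r₃ := 0) (r₄ := 0) (r₅ := 0) (r₆ := 0) (r₇ := 0)
    (h.integrable_spread_tracker 1) (integrable_const E) (h.integrable_meanSq_noise 0)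
    hi0 hi0 hi0 hi0 hi0 (fun ω => by
      have h2 : tracker c (iter pb I ξf ξg 1 ω) = gossip I.W (estimate c (iter pb I ξf ξg (0 + 1) ω)) :=
        tracker_run_one c
      have h3 := h.mixing.spread_gossip_le_self h.regular.pos
        (estimate c (iter pb I ξf ξg (0 + 1) ω))
      rw [← h2, estimate_iter_succ] at h3
      have h4 := spread_add_le
        (fun i => exactDir pb c I.γ (I.μ 0) i (point (iter pb I ξf ξg 0 ω) i))
        (fun i => noise pb I ξf ξg c 0 i ω)
      have h5 := spread_le_meanSq h.regular.pos fun i => noise pb I ξf ξg c 0 i ω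
      rw [point_iter_zero, ← hE] at h4
      rw [point_iter_zero] at h3
      linarith)
  rw [integral_const, probReal_univ, one_smul] at key
  have h6 := h.integral_meanSq_noise_le 0
  unfold expTrack
  linarith

end Quantities

/-! ### The constants of the convergence theorem -/

section Constants

variable {L₁ L₂ γ μ₀ c ρ : ℝ}

/-- The numerator of `tau2`. -/
noncomputable def num2 (L₁ L₂ γ μ₀ c : ℝ) : ℝ :=
  3 * (μ₀ ^ 2 * L₁ ^ 2 + 2 * L₂ ^ 2) * c + 4 * (μ₀ ^ 2 * L₁ ^ 2 + L₂ ^ 2) * c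
    + 2 * a1 L₂ γ * (6 / eta L₂ γ) * L₂ ^ 2

/-- The numerator of `tau3`. -/
noncomputable def num3 (L₁ L₂ γ μ₀ c : ℝ) : ℝ :=
  3 * (μ₀ ^ 2 * L₁ ^ 2 + L₂ ^ 2) * c + 4 * (μ₀ ^ 2 * L₁ ^ 2 + L₂ ^ 2 + 1 / γ ^ 2) * c
    + 2 * a1 L₂ γ * (6 / eta L₂ γ) * (1 / γ ^ 2)

/-- The numerator of `tau4`. -/
noncomputable def num4 (L₂ γ c : ℝ) : ℝ :=
  3 * L₂ ^ 2 * c + 4 / γ ^ 2 * c + 2 * a1 L₂ γ * (6 / eta L₂ γ) * (L₂ ^ 2 + 1 / γ ^ 2)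

theorem tau2_eq : tau2 L₁ L₂ γ μ₀ c ρ = 2 * (num2 L₁ L₂ γ μ₀ c / (c * (1 - ρ))) := rfl

theorem tau3_eq : tau3 L₁ L₂ γ μ₀ c ρ = 2 * (num3 L₁ L₂ γ μ₀ c / (c * (1 - ρ))) := rfl

theorem tau4_eq : tau4 L₂ γ c ρ = 2 * (num4 L₂ γ c / (c * (1 - ρ))) := rfl

theorem Lθ_eq_div : Lθ L₂ γ = √(L₂ ^ 2 + 1 / γ ^ 2) / eta L₂ γ := rfl

/-- The square root in the Lipschitz constant of θ* cancels against that in the definition. -/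
theorem a1_eq (hL₂ : 0 < L₂) (hη : 0 < eta L₂ γ) : a1 L₂ γ = eta L₂ γ / 2 := by
  have h : 0 < √(L₂ ^ 2 + 1 / γ ^ 2) := Real.sqrt_pos.mpr (by positivity)
  rw [a1, Lθ_eq_div]
  field_simp

/-- With a₁ = η/2 and L_θ² = (L₂² + γ⁻²)/η², the restriction on c_λ is the absorption condition of
the descent estimate. -/
theorem c_mul_le_of_le (hL₂ : 0 < L₂) (hη : 0 < eta L₂ γ)
    (hc : c ≤ eta L₂ γ / (32 * a1 L₂ γ * Lθ L₂ γ ^ 2)) :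
    c * (L₂ ^ 2 + 1 / γ ^ 2) ≤ eta L₂ γ ^ 2 / 16 := by
  have hl : 0 < L₂ ^ 2 + 1 / γ ^ 2 := by positivity
  rw [a1_eq hL₂ hη, Lθ_eq_div, div_pow, Real.sq_sqrt hl.le] at hc
  have e : eta L₂ γ / (32 * (eta L₂ γ / 2) * ((L₂ ^ 2 + 1 / γ ^ 2) / eta L₂ γ ^ 2))
      = eta L₂ γ ^ 2 / 16 / (L₂ ^ 2 + 1 / γ ^ 2) := by
    field_simp
    norm_num
  rw [e, le_div_iff₀ hl] at hc
  exact hc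

theorem le_num2 (hL₂ : 0 < L₂) (hη : 0 < eta L₂ γ) (hc : 0 < c) :
    L₂ ^ 2 * c ≤ num2 L₁ L₂ γ μ₀ c := by
  rw [num2, a1_eq hL₂ hη]
  have : 0 ≤ 3 * (μ₀ ^ 2 * L₁ ^ 2 + L₂ ^ 2 + L₂ ^ 2) * c + 4 * (μ₀ ^ 2 * L₁ ^ 2) * c
    + 3 * L₂ ^ 2 * c + 2 * (eta L₂ γ / 2) * (6 / eta L₂ γ) * L₂ ^ 2 := by positivity
  linarith

theorem le_num3 (hL₂ : 0 < L₂) (hη : 0 < eta L₂ γ) (hc : 0 < c) :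
    L₂ ^ 2 * c ≤ num3 L₁ L₂ γ μ₀ c := by
  rw [num3, a1_eq hL₂ hη]
  have : 0 ≤ 3 * (μ₀ ^ 2 * L₁ ^ 2 + L₂ ^ 2) * c + 4 * (μ₀ ^ 2 * L₁ ^ 2 + 1 / γ ^ 2) * c
    + 3 * L₂ ^ 2 * c + 2 * (eta L₂ γ / 2) * (6 / eta L₂ γ) * (1 / γ ^ 2) := by positivity
  linarith

theorem le_num4 (hL₂ : 0 < L₂) (hη : 0 < eta L₂ γ) (hc : 0 < c) :
    L₂ ^ 2 * c ≤ num4 L₂ γ c := by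
  rw [num4, a1_eq hL₂ hη]
  have : 0 ≤ 2 * L₂ ^ 2 * c + 4 / γ ^ 2 * c
    + 2 * (eta L₂ γ / 2) * (6 / eta L₂ γ) * (L₂ ^ 2 + 1 / γ ^ 2) := by positivity
  linarith

/-- Lower bounds for a weight `2 N / (c β)` of the Lyapunov function. -/
theorem le_weight {N L c β : ℝ} (hβ : 0 < β) (hc : 0 < c) (hN : L * c ≤ N) (hL : 0 ≤ L) :
    L / β ≤ 2 * (N / (c * β)) := by
  have h1 : L / β = L * c / (c * β) := by field_simp
  have h2 : L * c / (c * β) ≤ N / (c * β) := by gcongr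
  have h3 : 0 ≤ N / (c * β) := div_nonneg ((by positivity : 0 ≤ L * c).trans hN) (by positivity)
  linarith

/-- Upper bound for a weight `2 N / (c β)` of the Lyapunov function times a learning rate. -/
theorem weight_mul_le {N c β r : ℝ} (hβ : 0 < β) (hc : 0 < c) (hN : 0 ≤ N) (hr : r ≤ β) :
    2 * (N / (c * β)) * r ≤ 2 * N / c := by
  have h1 : 2 * (N / (c * β)) * r ≤ 2 * (N / (c * β)) * β := by gcongr
  refine h1.trans_eq ?_
  field_simp

theorem M4_ge (hL₁ : 0 ≤ L₁) (hL₂ : 0 < L₂) (hη : 0 < eta L₂ γ) (hμ : 0 < μ₀) :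
    2 * eta L₂ γ ≤ M4 L₁ L₂ γ μ₀ c := by
  rw [M4, a1_eq hL₂ hη]
  have h1 : 0 ≤ max L₂ (1 / γ) := hL₂.le.trans (le_max_left _ _)
  have : 0 ≤ ((μ₀ * L₁ + L₂ + max L₂ (1 / γ)) / 2 + 4 * (eta L₂ γ / 2) * Lθ L₂ γ ^ 2) * (6 * c ^ 2) := by
    positivity
  linarith

end Constants

/-! ### Elementary comparisons between the Lyapunov constant and the initial errors -/

theorem sum_mul_le {x₁ x₂ x₃ x₄ p₁ p₂ p₃ p₄ : ℝ} (hx₁ : 0 ≤ x₁) (hx₂ : 0 ≤ x₂) (hx₃ : 0 ≤ x₃)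
    (hx₄ : 0 ≤ x₄) (hp₁ : 0 ≤ p₁) (hp₂ : 0 ≤ p₂) (hp₃ : 0 ≤ p₃) (hp₄ : 0 ≤ p₄) :
    x₁ * p₁ + x₂ * p₂ + x₃ * p₃ + x₄ * p₄ ≤ (x₁ + x₂ + x₃ + x₄) * (p₁ + p₂ + p₃ + p₄) := by
  have z1 : 0 ≤ (x₂ + x₃ + x₄) * p₁ := by positivity
  have z2 : 0 ≤ (x₁ + x₃ + x₄) * p₂ := by positivity
  have z3 : 0 ≤ (x₁ + x₂ + x₄) * p₃ := by positivity
  have z4 : 0 ≤ (x₁ + x₂ + x₃) * p₄ := by positivity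
  linarith

theorem le_div_mul_add {T φ e a η : ℝ} (hη : 0 < η) (hφ : 0 ≤ φ) (ha : 0 ≤ a) (he : 0 ≤ e)
    (hT : T ≤ φ + a * e) : T ≤ (1 + a / (η / 2)) * (φ + η / 2 * e) := by
  refine hT.trans ?_
  have e1 : a / (η / 2) * (φ + η / 2 * e) = a / (η / 2) * φ + a * e := by field_simp
  rw [one_add_mul, e1]
  have : 0 ≤ a / (η / 2) * φ := by positivity
  have : 0 ≤ η / 2 * e := by positivity
  linarith

theorem le_inv_mul_weights {β L m c lam x y z t₂ t₃ t₄ : ℝ} (hβ : 0 < β) (hL : 0 < L) (hm : 0 < m)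
    (hmc : m ≤ c) (hm1 : m ≤ 1) (hlam : 0 ≤ lam) (hx : 0 ≤ x) (hy : 0 ≤ y) (hz : 0 ≤ z)
    (h₂ : L ^ 2 / β ≤ t₂) (h₃ : L ^ 2 / β ≤ t₃) (h₄ : L ^ 2 / β ≤ t₄) :
    lam * (x + y + z) / β
      ≤ 1 / (L ^ 2 * m) * (t₂ * (c * lam) * x + t₃ * (c * lam) * y + t₄ * lam * z) := by
  have hw : 0 ≤ L ^ 2 / β := by positivity
  have a4 : m * lam ≤ lam := mul_le_of_le_one_left hlam hm1
  have e : lam * (x + y + z) / β = 1 / (L ^ 2 * m)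
      * (L ^ 2 / β * (m * lam) * x + L ^ 2 / β * (m * lam) * y + L ^ 2 / β * (m * lam) * z) := by
    field_simp
  rw [e]
  have := hw.trans h₂
  have := hw.trans h₃
  have := hw.trans h₄
  gcongr

theorem le_inv_mul_weights_sq {β L lam x y z t₂ t₃ t₄ : ℝ} (hβ : 0 < β) (hL : 0 < L)
    (hx : 0 ≤ x) (hy : 0 ≤ y) (hz : 0 ≤ z)
    (h₂ : L ^ 2 / β ≤ t₂) (h₃ : L ^ 2 / β ≤ t₃) (h₄ : L ^ 2 / β ≤ t₄) :
    lam ^ 2 * (x + y + z) / β ^ 3 ≤ 1 / L ^ 2 * (lam ^ 2 / β ^ 2 * (t₂ * x + t₃ * y + t₄ * z)) := by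
  have e : lam ^ 2 * (x + y + z) / β ^ 3 = 1 / L ^ 2
      * (lam ^ 2 / β ^ 2 * (L ^ 2 / β * x + L ^ 2 / β * y + L ^ 2 / β * z)) := by field_simp
  rw [e]
  gcongr

theorem le_div_mul_variances {r η m μ M δ δ' : ℝ} (hη : 0 < η) (hm : 0 < m) (hmμ : m ≤ μ)
    (hm2 : m ≤ 2) (hr : 0 ≤ r) (hM : 2 * η ≤ M) :
    r * (δ ^ 2 + δ' ^ 2) ≤ r / (2 * η * m) * (M * (μ * δ ^ 2 + 2 * δ' ^ 2)) := by
  have e : r * (δ ^ 2 + δ' ^ 2) = r / (2 * η * m) * (2 * η * (m * δ ^ 2 + m * δ' ^ 2)) := by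
    field_simp
  rw [e]
  have : 0 ≤ M := by linarith
  gcongr

theorem weights_mul_le {c x y z S t₂ t₃ t₄ lam N : ℝ} (hc : 0 ≤ c) (hN : 0 ≤ N) (hx : 0 ≤ x)
    (hy : 0 ≤ y) (hz : 0 ≤ z) (h₂ : t₂ * lam ≤ N) (h₃ : t₃ * lam ≤ N) (h₄ : t₄ * lam ≤ N)
    (hS : x + y + z ≤ S) :
    t₂ * (c * lam) * x + t₃ * (c * lam) * y + t₄ * lam * z ≤ N * (c + 1) * S := by
  have a2 := mul_le_mul_of_nonneg_right h₂ (by positivity : 0 ≤ c * x)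
  have a3 := mul_le_mul_of_nonneg_right h₃ (by positivity : 0 ≤ c * y)
  have a4 := mul_le_mul_of_nonneg_right h₄ hz
  have a5 := mul_le_mul_of_nonneg_left hS (by positivity : 0 ≤ N * (c + 1))
  have : 0 ≤ N * (x + y + c * z) := by positivity
  linarith

theorem weights_sq_mul_le {c x y z u v w S σ ν t₂ t₃ t₄ b N : ℝ} (hN : 0 ≤ N) (hx : 0 ≤ x)
    (hy : 0 ≤ y) (hz : 0 ≤ z) (hu : 0 ≤ u) (hv : 0 ≤ v) (hw : 0 ≤ w) (hν : 0 ≤ ν)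
    (h₂ : t₂ * b ≤ N) (h₃ : t₃ * b ≤ N) (h₄ : t₄ * b ≤ N)
    (h : c ^ 2 * x + c ^ 2 * y + z ≤ 2 * (c ^ 2 * u + c ^ 2 * v + w) + 2 * (ν * σ))
    (hS : u + v + w ≤ S) (hσ : σ ≤ S) :
    b * (t₂ * (c ^ 2 * x) + t₃ * (c ^ 2 * y) + t₄ * z) ≤ N * (2 * (c ^ 2 + 1) + 2 * ν) * S := by
  have a2 := mul_le_mul_of_nonneg_right h₂ (by positivity : 0 ≤ c ^ 2 * x)
  have a3 := mul_le_mul_of_nonneg_right h₃ (by positivity : 0 ≤ c ^ 2 * y)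
  have a4 := mul_le_mul_of_nonneg_right h₄ hz
  have y1 := mul_le_mul_of_nonneg_left hS (by positivity : 0 ≤ 2 * (c ^ 2 + 1))
  have y2 := mul_le_mul_of_nonneg_left hσ (by positivity : 0 ≤ 2 * ν)
  have y3 : 0 ≤ 2 * (u + v + c ^ 2 * w) := by positivity
  have a5 : c ^ 2 * x + c ^ 2 * y + z ≤ (2 * (c ^ 2 + 1) + 2 * ν) * S := by linarith
  have a6 := mul_le_mul_of_nonneg_left a5 hN
  linarith

section LyapunovConstant

variable {n dx dy : ℕ} {Ξf Ξg Ω : Type*} [MeasurableSpace Ξf] [MeasurableSpace Ξg]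
  {pb : Problem n dx dy Ξf Ξg} {I : Input n dx dy} {ξf : Fin n → ℕ → Ω → Ξf}
  {ξg : Fin n → ℕ → Ω → Ξg} {L₁ L₂ μ₀ c Flow ρ lam δf δg : ℝ}
  [MeasurableSpace Ω] {P : Measure Ω} [IsProbabilityMeasure P]

/-- Regrouped into four blocks that match the four terms of the summed bound: potential, consensus,
tracking and variance. -/
theorem IsRun.C2_eq (h : IsRun pb I P ξf ξg L₁ L₂ μ₀ c Flow ρ lam δf δg) :
    C2 pb I P ξf ξg L₁ L₂ c ρ Flow δf δg
      = (phi0 pb I Flow + eta L₂ I.γ / 2 * lowErr0 pb I)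
        + (tau2 L₁ L₂ I.γ μ₀ c ρ * (c * lam) * disp I.x₀ + tau3 L₁ L₂ I.γ μ₀ c ρ * (c * lam) * disp I.y₀
          + tau4 L₂ I.γ c ρ * lam * disp I.θ₀)
        + lam ^ 2 / (1 - ρ) ^ 2
          * (tau2 L₁ L₂ I.γ μ₀ c ρ * (c ^ 2 * ∫ ω, disp (iter pb I ξf ξg 1 ω).Dx ∂P)
          + tau3 L₁ L₂ I.γ μ₀ c ρ * (c ^ 2 * ∫ ω, disp (iter pb I ξf ξg 1 ω).Dy ∂P)
          + tau4 L₂ I.γ c ρ * ∫ ω, disp (iter pb I ξf ξg 1 ω).Dθ ∂P)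
        + M4 L₁ L₂ I.γ μ₀ c * (μ₀ * δf ^ 2 + 2 * δg ^ 2) := by
  have hη := eta_pos h.regular.pos₂ h.regular.mem
  rw [C2, lyap0]
  simp only [h.mu_zero, h.rates.x, h.rates.y, h.rates.θ, a1_eq h.regular.pos₂ hη]
  ring

theorem integral_disp_nonneg {d : ℕ} (v : Ω → Fin n → Vec d) : 0 ≤ ∫ ω, disp (v ω) ∂P :=
  integral_nonneg fun _ => disp_nonneg _

/-- The constant in the comparison of the Lyapunov constant with the initial errors. -/
noncomputable def lowerConst (L₂ γ μ₀ c r : ℝ) : ℝ :=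
  (1 + (L₂ + 1 / γ) / (eta L₂ γ / 2)) + 1 / (L₂ ^ 2 * min c 1) + 1 / L₂ ^ 2
    + r / (2 * eta L₂ γ * min μ₀ 2)

/-- The constant `C₂` dominates the initial errors and the variances. -/
theorem IsRun.le_C2 (h : IsRun pb I P ξf ξg L₁ L₂ μ₀ c Flow ρ lam δf δg) {r : ℝ} (hr : 0 ≤ r) :
    expPot pb I P ξf ξg Flow 0 + lam * expSpread pb I P ξf ξg 0 / (1 - ρ)
        + lam ^ 2 * expTrack pb I P ξf ξg c 0 / (1 - ρ) ^ 3 + r * (δf ^ 2 + δg ^ 2)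
      ≤ lowerConst L₂ I.γ μ₀ c r * C2 pb I P ξf ξg L₁ L₂ c ρ Flow δf δg := by
  have hη := eta_pos h.regular.pos₂ h.regular.mem
  have hL₂ := h.regular.pos₂
  have hc := h.regular.c_pos
  have hγ := h.regular.gamma_pos
  have hμ := h.regular.mu_pos
  have hlam := h.lam_pos
  have hβ : 0 < 1 - ρ := by have := h.mixing.rho_lt; linarith
  have hΦ := h.phi0_nonneg
  have hT := h.expPot_zero_le
  have he : 0 ≤ lowErr0 pb I := sq_nonneg _
  have hM := M4_ge (c := c) h.regular.nonneg₁ hL₂ hη hμ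
  have w2 : L₂ ^ 2 / (1 - ρ) ≤ tau2 L₁ L₂ I.γ μ₀ c ρ :=
    le_weight hβ hc (le_num2 hL₂ hη hc) (by positivity)
  have w3 : L₂ ^ 2 / (1 - ρ) ≤ tau3 L₁ L₂ I.γ μ₀ c ρ :=
    le_weight hβ hc (le_num3 hL₂ hη hc) (by positivity)
  have w4 : L₂ ^ 2 / (1 - ρ) ≤ tau4 L₂ I.γ c ρ :=
    le_weight hβ hc (le_num4 hL₂ hη hc) (by positivity)
  have hdx := disp_nonneg I.x₀
  have hdy := disp_nonneg I.y₀
  have hdθ := disp_nonneg I.θ₀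
  have hDx := integral_disp_nonneg (P := P) fun ω => (iter pb I ξf ξg 1 ω).Dx
  have hDy := integral_disp_nonneg (P := P) fun ω => (iter pb I ξf ξg 1 ω).Dy
  have hDθ := integral_disp_nonneg (P := P) fun ω => (iter pb I ξf ξg 1 ω).Dθ
  rw [h.C2_eq, h.expTrack_zero_eq, expSpread_zero, spread_initPoint]
  -- The minima equalize unequal weights inside one block: c lam against lam for the variables, μ₀
  -- against 2 for the two variances.
  have hm : 0 < min c 1 := by positivity
  have hm' : 0 < min μ₀ 2 := by positivity
  refine (add_le_add (add_le_add (add_le_add (le_div_mul_add hη hΦ (by positivity) he hT)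
    (le_inv_mul_weights hβ hL₂ hm (min_le_left _ _) (min_le_right _ _) hlam.le hdx hdy hdθ w2 w3 w4))
    (le_inv_mul_weights_sq hβ hL₂ (mul_nonneg (sq_nonneg c) hDx) (mul_nonneg (sq_nonneg c) hDy) hDθ
      w2 w3 w4)) (le_div_mul_variances hη hm' (min_le_left _ _) (min_le_right _ _) hr hM)).trans ?_
  have hw : 0 ≤ L₂ ^ 2 / (1 - ρ) := by positivity
  have ht2 := hw.trans w2
  have ht3 := hw.trans w3
  have ht4 := hw.trans w4
  have hM0 : 0 ≤ M4 L₁ L₂ I.γ μ₀ c := by linarith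
  unfold lowerConst
  have hcl : 0 ≤ c * lam := by positivity
  have hb : 0 ≤ lam ^ 2 / (1 - ρ) ^ 2 := by positivity
  have hv : 0 ≤ μ₀ * δf ^ 2 + 2 * δg ^ 2 := by positivity
  have hη2 : 0 ≤ eta L₂ I.γ / 2 := by positivity
  exact sum_mul_le (by positivity) (by positivity) (by positivity) (by positivity)
    (add_nonneg hΦ (mul_nonneg hη2 he))
    (add_nonneg (add_nonneg (mul_nonneg (mul_nonneg ht2 hcl) hdx)
      (mul_nonneg (mul_nonneg ht3 hcl) hdy)) (mul_nonneg (mul_nonneg ht4 hlam.le) hdθ))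
    (mul_nonneg hb (add_nonneg (add_nonneg (mul_nonneg ht2 (mul_nonneg (sq_nonneg c) hDx))
      (mul_nonneg ht3 (mul_nonneg (sq_nonneg c) hDy))) (mul_nonneg ht4 hDθ)))
    (mul_nonneg hM0 hv)

/-- The constant in the bound of the Lyapunov constant by the initial data. -/
noncomputable def upperConst (L₁ L₂ γ μ₀ c : ℝ) : ℝ :=
  (1 + eta L₂ γ / 2)
    + 2 * (num2 L₁ L₂ γ μ₀ c + num3 L₁ L₂ γ μ₀ c + num4 L₂ γ c) / c
      * (c + 1 + (2 * (c ^ 2 + 1) + 2 * noiseConst μ₀ c))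
    + M4 L₁ L₂ γ μ₀ c * (μ₀ + 2)

/-- The constant `C₂` is bounded by the initial data and the variances. -/
theorem IsRun.C2_le (h : IsRun pb I P ξf ξg L₁ L₂ μ₀ c Flow ρ lam δf δg)
    (hlam4 : lam ≤ (1 - ρ) ^ 4) :
    C2 pb I P ξf ξg L₁ L₂ c ρ Flow δf δg
      ≤ upperConst L₁ L₂ I.γ μ₀ c * (initSize pb I Flow + δf ^ 2 + δg ^ 2) := by
  have hη := eta_pos h.regular.pos₂ h.regular.mem
  have hL₂ := h.regular.pos₂
  have hc := h.regular.c_pos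
  have hμ := h.regular.mu_pos
  have hlam := h.lam_pos
  have hβ : 0 < 1 - ρ := by have := h.mixing.rho_lt; linarith
  have hβ1 : 1 - ρ ≤ 1 := by have := h.mixing.rho_nonneg; linarith
  have hΦ := h.phi0_nonneg
  have he : 0 ≤ lowErr0 pb I := sq_nonneg _
  have hM := M4_ge (c := c) h.regular.nonneg₁ hL₂ hη hμ
  have hdx := disp_nonneg I.x₀
  have hdy := disp_nonneg I.y₀
  have hdθ := disp_nonneg I.θ₀
  have hDx := integral_disp_nonneg (P := P) fun ω => (iter pb I ξf ξg 1 ω).Dx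
  have hDy := integral_disp_nonneg (P := P) fun ω => (iter pb I ξf ξg 1 ω).Dy
  have hDθ := integral_disp_nonneg (P := P) fun ω => (iter pb I ξf ξg 1 ω).Dθ
  have hD := h.expTrack_zero_le
  rw [h.expTrack_zero_eq, noiseLevel] at hD
  have hν := noiseConst_nonneg μ₀ c
  have hEx := disp_nonneg fun i => dirx (I.μ 0) (∇ (pb.f i)) (∇ (pb.g i)) (I.x₀ i) (I.y₀ i) (I.θ₀ i)
  have hEy := disp_nonneg fun i =>
    diry I.γ (I.μ 0) (∇ (pb.f i)) (∇ (pb.g i)) (I.x₀ i) (I.y₀ i) (I.θ₀ i)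
  have hEθ := disp_nonneg fun i => dirθ I.γ (∇ (pb.g i)) (I.x₀ i) (I.y₀ i) (I.θ₀ i)
  have hn2 : 0 ≤ num2 L₁ L₂ I.γ μ₀ c := (by positivity : 0 ≤ L₂ ^ 2 * c).trans (le_num2 hL₂ hη hc)
  have hn3 : 0 ≤ num3 L₁ L₂ I.γ μ₀ c := (by positivity : 0 ≤ L₂ ^ 2 * c).trans (le_num3 hL₂ hη hc)
  have hn4 : 0 ≤ num4 L₂ I.γ c := (by positivity : 0 ≤ L₂ ^ 2 * c).trans (le_num4 hL₂ hη hc)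
  -- The weights τ carry one factor 1/(1-ρ), and those of the trackers two more. This bound and the
  -- next cancel all of them, so C₂ stays bounded as ρ → 1.
  have hlamβ : lam ≤ 1 - ρ := hlam4.trans (pow_le_of_le_one hβ.le hβ1 (by norm_num))
  have hlam2 : lam ^ 2 / (1 - ρ) ^ 2 ≤ 1 - ρ := by
    rw [div_le_iff₀ (by positivity)]
    calc lam ^ 2 = lam * lam := sq lam
      _ ≤ (1 - ρ) ^ 4 * (1 - ρ) := by gcongr
      _ = (1 - ρ) ^ 2 * ((1 - ρ) * (1 - ρ) ^ 2) := by ring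
      _ ≤ 1 * ((1 - ρ) * (1 - ρ) ^ 2) := by gcongr; exact pow_le_one₀ hβ.le hβ1
      _ = _ := one_mul _
  rw [h.C2_eq, initSize, tau2_eq, tau3_eq, tau4_eq]
  set Ex := disp fun i => dirx (I.μ 0) (∇ (pb.f i)) (∇ (pb.g i)) (I.x₀ i) (I.y₀ i) (I.θ₀ i)
  set Ey := disp fun i => diry I.γ (I.μ 0) (∇ (pb.f i)) (∇ (pb.g i)) (I.x₀ i) (I.y₀ i) (I.θ₀ i)
  set Eθ := disp fun i => dirθ I.γ (∇ (pb.g i)) (I.x₀ i) (I.y₀ i) (I.θ₀ i)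
  unfold upperConst
  set N := 2 * (num2 L₁ L₂ I.γ μ₀ c + num3 L₁ L₂ I.γ μ₀ c + num4 L₂ I.γ c) / c with hN
  have hN0 : 0 ≤ N := by positivity
  have k2 : 2 * num2 L₁ L₂ I.γ μ₀ c / c ≤ N := by
    rw [hN]
    exact div_le_div_of_nonneg_right (by linarith) hc.le
  have k3 : 2 * num3 L₁ L₂ I.γ μ₀ c / c ≤ N := by
    rw [hN]
    exact div_le_div_of_nonneg_right (by linarith) hc.le
  have k4 : 2 * num4 L₂ I.γ c / c ≤ N := by
    rw [hN]
    exact div_le_div_of_nonneg_right (by linarith) hc.le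
  have hf := sq_nonneg δf
  have hg := sq_nonneg δg
  set S := phi0 pb I Flow + lowErr0 pb I + disp I.x₀ + disp I.y₀ + disp I.θ₀ + Ex + Ey + Eθ + δf ^ 2
    + δg ^ 2
  have s1 : phi0 pb I Flow + lowErr0 pb I ≤ S := by linarith
  have s2 : disp I.x₀ + disp I.y₀ + disp I.θ₀ ≤ S := by linarith
  have s3 : Ex + Ey + Eθ ≤ S := by linarith
  have s4 : δf ^ 2 + δg ^ 2 ≤ S := by linarith
  have b1 : phi0 pb I Flow + eta L₂ I.γ / 2 * lowErr0 pb I ≤ (1 + eta L₂ I.γ / 2) * S := by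
    have := mul_le_mul_of_nonneg_left s1 (by positivity : 0 ≤ 1 + eta L₂ I.γ / 2)
    have : 0 ≤ eta L₂ I.γ / 2 * phi0 pb I Flow := by positivity
    linarith
  have b2 := weights_mul_le hc.le hN0 hdx hdy hdθ ((weight_mul_le hβ hc hn2 hlamβ).trans k2)
    ((weight_mul_le hβ hc hn3 hlamβ).trans k3) ((weight_mul_le hβ hc hn4 hlamβ).trans k4) s2
  have b3 := weights_sq_mul_le hN0 hDx hDy hDθ hEx hEy hEθ hν
    ((weight_mul_le hβ hc hn2 hlam2).trans k2) ((weight_mul_le hβ hc hn3 hlam2).trans k3)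
    ((weight_mul_le hβ hc hn4 hlam2).trans k4) hD s3 s4
  have b4 : M4 L₁ L₂ I.γ μ₀ c * (μ₀ * δf ^ 2 + 2 * δg ^ 2) ≤ M4 L₁ L₂ I.γ μ₀ c * (μ₀ + 2) * S := by
    rw [mul_assoc]
    refine mul_le_mul_of_nonneg_left ?_ (by linarith)
    have := mul_le_mul_of_nonneg_left s4 (by positivity : 0 ≤ μ₀ + 2)
    have : 0 ≤ μ₀ * δg ^ 2 + 2 * δf ^ 2 := by positivity
    linarith
  have e : (1 + eta L₂ I.γ / 2 + N * (c + 1 + (2 * (c ^ 2 + 1) + 2 * noiseConst μ₀ c))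
      + M4 L₁ L₂ I.γ μ₀ c * (μ₀ + 2)) * S
      = (1 + eta L₂ I.γ / 2) * S + N * (c + 1) * S + N * (2 * (c ^ 2 + 1) + 2 * noiseConst μ₀ c) * S
        + M4 L₁ L₂ I.γ μ₀ c * (μ₀ + 2) * S := by ring
  rw [e]
  exact add_le_add (add_le_add (add_le_add b1 b2) b3) b4

end LyapunovConstant

/-! ### The penalty parameters -/

/-- For p ≤ 1 the ratio satisfies (x/(x+1))^p ≥ x/(x+1), so one step lowers x^(-p) by at most
1/(x+1). With x = k + 1 this is the decay of the penalty decrements. -/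
theorem rpow_neg_step {p : ℝ} (hp : 0 ≤ p) (hp1 : p ≤ 1) {x : ℝ} (hx : 1 ≤ x) :
    (x + 1) ^ (-p) ≤ x ^ (-p) ∧ x * (x ^ (-p) - (x + 1) ^ (-p)) ≤ 1 := by
  have hx0 : 0 < x := by linarith
  refine ⟨Real.rpow_le_rpow_of_nonpos hx0 (by linarith) (by linarith), ?_⟩
  have h1 : x / (x + 1) ≤ (x / (x + 1)) ^ p := by
    have := Real.rpow_le_rpow_of_exponent_ge (x := x / (x + 1)) (by positivity)
      ((div_le_one (by positivity)).mpr (by linarith)) hp1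
    rwa [Real.rpow_one] at this
  have h2 : (x + 1) ^ (-p) = x ^ (-p) * (x / (x + 1)) ^ p := by
    rw [Real.div_rpow hx0.le (by positivity), Real.rpow_neg hx0.le, Real.rpow_neg (by positivity)]
    have : x ^ p ≠ 0 := (Real.rpow_pos_of_pos hx0 p).ne'
    field_simp
  have h3 : x ^ (-p) ≤ 1 := Real.rpow_le_one_of_one_le_of_nonpos hx (by linarith)
  have h4 : 0 ≤ x ^ (-p) := by positivity
  have h5 : x ^ (-p) - (x + 1) ^ (-p) ≤ 1 * (1 - x / (x + 1)) := by
    rw [h2, ← mul_one_sub]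
    have : 0 ≤ 1 - x / (x + 1) := by
      rw [sub_nonneg, div_le_one (by positivity)]; linarith
    have : x ^ (-p) * (1 - (x / (x + 1)) ^ p) ≤ x ^ (-p) * (1 - x / (x + 1)) := by gcongr
    exact this.trans (by gcongr)
  calc x * (x ^ (-p) - (x + 1) ^ (-p)) ≤ x * (1 * (1 - x / (x + 1))) := by gcongr
    _ = x / (x + 1) := by field_simp; ring
    _ ≤ 1 := (div_le_one (by positivity)).mpr (by linarith)

/-- The learning rate gives K lam² = c_θ² n, so the averaged noise contributes a constant that C₂
absorbs, and K lam = c_θ √n √K, the denominator of the rate. The last noise term keeps lam² = c_θ² n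
/ K. -/
theorem rate_le {K n cθ β A B ν σ T X D Y C lam : ℝ} (hK : 0 < K) (hn : 0 < n) (hcθ : 0 < cθ)
    (hA : 0 ≤ A) (hlam : lam = cθ * √n / √K)
    (h : lam * Y ≤ A * (T + lam * X / β + lam ^ 2 * D / β ^ 3 + K * lam ^ 2 * (ν * σ) / n
      + K * lam ^ 3 * (ν * σ) / β ^ 4))
    (hC : T + lam * X / β + lam ^ 2 * D / β ^ 3 + cθ ^ 2 * ν * σ ≤ B * C) :
    1 / K * Y ≤ A * B / cθ * (C / (√n * √K)) + A * ν * cθ ^ 2 * (n * σ / (β ^ 4 * K)) := by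
  have hsn : 0 < √n := Real.sqrt_pos.mpr hn
  have hsK : 0 < √K := Real.sqrt_pos.mpr hK
  have en : √n ^ 2 = n := Real.sq_sqrt hn.le
  have eK : √K ^ 2 = K := Real.sq_sqrt hK.le
  have hl : 0 < lam := by rw [hlam]; positivity
  have e2 : K * lam ^ 2 = cθ ^ 2 * n := by
    rw [hlam, div_pow, mul_pow, en, eK]
    field_simp
  have e3 : K * lam = cθ * (√n * √K) := by
    rw [hlam]
    nth_rewrite 1 [← eK]
    field_simp
  have e4 : K * lam ^ 2 * (ν * σ) / n = cθ ^ 2 * ν * σ := by rw [e2]; field_simp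
  have e5 : K * lam ^ 3 * (ν * σ) / β ^ 4 = lam * (cθ ^ 2 * n * (ν * σ) / β ^ 4) := by
    rw [← e2]; ring
  rw [e4, e5] at h
  have h1 : lam * Y ≤ A * (B * C) + lam * (A * (cθ ^ 2 * n * (ν * σ) / β ^ 4)) := by
    have := mul_le_mul_of_nonneg_left hC hA
    linarith
  have h2 : lam * (Y - A * (cθ ^ 2 * n * (ν * σ) / β ^ 4)) ≤ A * (B * C) := by linarith
  have h3 : Y - A * (cθ ^ 2 * n * (ν * σ) / β ^ 4) ≤ A * (B * C) / lam := by
    rwa [le_div_iff₀' hl]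
  have h4 := mul_le_mul_of_nonneg_left h3 (by positivity : 0 ≤ 1 / K)
  have e6 : 1 / K * (A * (B * C) / lam) = A * B / cθ * (C / (√n * √K)) := by
    rw [show 1 / K * (A * (B * C) / lam) = A * (B * C) / (K * lam) by field_simp, e3]
    field_simp
  have e7 : 1 / K * (A * (cθ ^ 2 * n * (ν * σ) / β ^ 4)) = A * ν * cθ ^ 2 * (n * σ / (β ^ 4 * K)) := by
    -- At β = 0 both sides vanish by the convention for division by zero.
    rcases eq_or_ne β 0 with rfl | hβ
    · simp
    · field_simp
  rw [mul_sub, e6, e7] at h4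
  linarith

section Rate

variable {n dx dy : ℕ} {Ξf Ξg Ω : Type*} [MeasurableSpace Ξf] [MeasurableSpace Ξg]
  {pb : Problem n dx dy Ξf Ξg} {I : Input n dx dy} {ξf : Fin n → ℕ → Ω → Ξf}
  {ξg : Fin n → ℕ → Ω → Ξg} {L₁ L₂ μ₀ c Flow ρ lam δf δg : ℝ}
  [MeasurableSpace Ω] {P : Measure Ω} [IsProbabilityMeasure P]

theorem lowerConst_pos {γ r : ℝ} (hL₂ : 0 < L₂) (hγ : 0 < γ) (hη : 0 < eta L₂ γ) (hμ : 0 < μ₀)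
    (hc : 0 < c) (hr : 0 ≤ r) : 0 < lowerConst L₂ γ μ₀ c r := by
  unfold lowerConst
  positivity

theorem IsRun.C2_nonneg (h : IsRun pb I P ξf ξg L₁ L₂ μ₀ c Flow ρ lam δf δg) :
    0 ≤ C2 pb I P ξf ξg L₁ L₂ c ρ Flow δf δg := by
  have hβ : 0 < 1 - ρ := by have := h.mixing.rho_lt; linarith
  have h1 := h.le_C2 le_rfl
  have h2 := lowerConst_pos (r := 0) h.regular.pos₂ h.regular.gamma_pos
    (eta_pos h.regular.pos₂ h.regular.mem) h.regular.mu_pos h.regular.c_pos le_rfl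
  have hT := h.expPot_nonneg 0
  have hX := expSpread_nonneg (pb := pb) (I := I) (P := P) (ξf := ξf) (ξg := ξg) 0
  have hD := expTrack_nonneg (pb := pb) (I := I) (P := P) (ξf := ξf) (ξg := ξg) (c := c) 0
  have hlam := h.lam_pos
  refine nonneg_of_mul_nonneg_right (le_trans ?_ h1) h2
  positivity

theorem IsRun.initSize_nonneg (h : IsRun pb I P ξf ξg L₁ L₂ μ₀ c Flow ρ lam δf δg) :
    0 ≤ initSize pb I Flow := by
  have h1 : 0 ≤ lowErr0 pb I := sq_nonneg _
  exact add_nonneg (add_nonneg (add_nonneg (add_nonneg (add_nonneg (add_nonneg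
    (add_nonneg h.phi0_nonneg h1) (disp_nonneg _)) (disp_nonneg _)) (disp_nonneg _))
    (disp_nonneg _)) (disp_nonneg _)) (disp_nonneg _)

/-- The convergence rate of the stationarity measure and of the consensus error. -/
theorem IsRun.average_le (h : IsRun pb I P ξf ξg L₁ L₂ μ₀ c Flow ρ lam δf δg)
    (hμ : ∀ k : ℕ, ((k : ℝ) + 1) * (I.μ k - I.μ (k + 1)) ≤ μ₀) {C : ℝ}
    (hC : TrackBounds C L₁ L₂ I.γ μ₀ c) (hlamκ : lam ≤ 1 / (100 * C ^ 7) * (1 - ρ) ^ 4)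
    {K : ℕ} (hK : 0 < K) {cθ : ℝ} (hcθ : 0 < cθ) (hlam : lam = cθ * √n / √K) :
    1 / (K : ℝ) * (∑ k ∈ Finset.range K, expStat pb I P ξf ξg k
        + ∑ k ∈ Finset.range K, expSpread pb I P ξf ξg k)
      ≤ 300 * C ^ 8 * lowerConst L₂ I.γ μ₀ c (cθ ^ 2 * noiseConst μ₀ c) / cθ
          * (C2 pb I P ξf ξg L₁ L₂ c ρ Flow δf δg / (√n * √K))
        + 300 * C ^ 8 * noiseConst μ₀ c * cθ ^ 2
          * (n * (δf ^ 2 + δg ^ 2) / ((1 - ρ) ^ 4 * K)) := by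
  have hC0 : 0 ≤ C := by linarith [hC.one_le]
  have h1 := h.sum_stat_add_spread_le hμ hC hlamκ hK
  have h2 := h.le_C2 (mul_nonneg (sq_nonneg cθ) (noiseConst_nonneg μ₀ c))
  exact rate_le (by exact_mod_cast hK) (by exact_mod_cast h.regular.pos) hcθ (by positivity) hlam
    h1 h2

end Rate

/-! ### Assembly of the convergence theorem -/

theorem isRun_input {n dx dy : ℕ} {Ξf Ξg Ω : Type*} [MeasurableSpace Ξf] [MeasurableSpace Ξg]
    [MeasurableSpace Ω] {P : Measure Ω} {pb : Problem n dx dy Ξf Ξg} {ξf : Fin n → ℕ → Ω → Ξf}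
    {ξg : Fin n → ℕ → Ω → Ξg} {W : Matrix (Fin n) (Fin n) ℝ}
    {L₁ L₂ γ μ₀ p cθ cl Flow ρ δf δg : ℝ} {θ₀ : Fin n → Vec dy} {x₀ : Fin n → Vec dx}
    {y₀ : Fin n → Vec dy} {K : ℕ} (hreg : Regular pb L₁ L₂ γ μ₀ cl Flow)
    (hf : ∀ i, IsOracle (pb.lossF i) (pb.distF i) δf)
    (hg : ∀ i, IsOracle (pb.lossG i) (pb.distG i) δg) (hs : IsSampling pb P ξf ξg)
    (hW : IsMixing W ρ) (hp : 0 ≤ p) (hp1 : p ≤ 1) (hcθ : 0 < cθ) (hK : 0 < K) :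
    IsRun pb (input W γ μ₀ p cθ cl K θ₀ x₀ y₀) P ξf ξg L₁ L₂ μ₀ cl Flow ρ (cθ * √n / √K) δf δg ∧
    ∀ k : ℕ, ((k : ℝ) + 1) * ((input W γ μ₀ p cθ cl K θ₀ x₀ y₀).μ k
      - (input W γ μ₀ p cθ cl K θ₀ x₀ y₀).μ (k + 1)) ≤ μ₀ := by
  have hμ₀ := hreg.mu_pos
  have hn := hreg.pos
  have hstep := fun k : ℕ => rpow_neg_step hp hp1 (x := (k : ℝ) + 1) (by simp)
  have hsucc : ∀ k : ℕ, (input W γ μ₀ p cθ cl K θ₀ x₀ y₀).μ (k + 1)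
      = μ₀ * ((k : ℝ) + 1 + 1) ^ (-p) := fun k => by simp [input]
  constructor
  · refine ⟨hreg, hf, hg, hs, hW, ⟨fun _ => rfl, fun _ => rfl, fun _ => rfl⟩, by positivity,
      fun k => ?_, fun k => ?_, by simp [input]⟩
    · change 0 ≤ μ₀ * ((k : ℝ) + 1) ^ (-p)
      positivity
    · rw [hsucc]
      exact mul_le_mul_of_nonneg_left (hstep k).1 hμ₀.le
  · intro k
    rw [hsucc]
    change ((k : ℝ) + 1) * (μ₀ * ((k : ℝ) + 1) ^ (-p) - _) ≤ _
    have := mul_le_mul_of_nonneg_left (hstep k).2 hμ₀.le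
    linarith

end SunDSBO

theorem theorem2 (L₁ L₂ γ μ₀ cl : ℝ) (hL₁ : 0 ≤ L₁) (hL₂ : 0 < L₂)
    (hγ : γ ∈ Set.Ioo 0 (1 / (2 * L₂))) (hμ₀ : 0 < μ₀)
    (hcl : 0 < cl) (hcl' : cl ≤ eta L₂ γ / (32 * a1 L₂ γ * Lθ L₂ γ ^ 2)) :
    ∃ κ : ℝ, 0 < κ ∧
    ∀ p ∈ Set.Ico (0 : ℝ) (1 / 4), ∀ cθ : ℝ, 0 < cθ →
    ∃ C : ℝ, 0 < C ∧
    ∀ (n dx dy : ℕ) (Ξf Ξg Ω : Type*) [MeasurableSpace Ξf] [MeasurableSpace Ξg]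
      [MeasurableSpace Ω] (P : Measure Ω) [IsProbabilityMeasure P]
      (pb : Problem n dx dy Ξf Ξg) (ξf : Fin n → ℕ → Ω → Ξf) (ξg : Fin n → ℕ → Ω → Ξg)
      (W : Matrix (Fin n) (Fin n) ℝ) (ρ δf δg Flow : ℝ)
      (θ₀ : Fin n → Vec dy) (x₀ : Fin n → Vec dx) (y₀ : Fin n → Vec dy) (K : ℕ),
      0 < n → 0 < K → 0 ≤ δf → 0 ≤ δg →
      Smooth pb L₁ L₂ →
      (∀ z, Flow ≤ pb.F z) →
      (∀ i, IsOracle (pb.lossF i) (pb.distF i) δf) →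
      (∀ i, IsOracle (pb.lossG i) (pb.distG i) δg) →
      IsSampling pb P ξf ξg →
      IsMixing W ρ →
      cθ * √n / √K ≤ κ * (1 - ρ) ^ 4 →
      ∀ I : Input n dx dy, I = input W γ μ₀ p cθ cl K θ₀ x₀ y₀ →
      ∀ C₂ : ℝ, C₂ = C2 pb I P ξf ξg L₁ L₂ cl ρ Flow δf δg →
      -- the quantities below are well defined
      (∀ z θ, IsMinOn (pb.envObj γ z) Set.univ θ ↔ θ = pb.thetaStar γ z) ∧
      (∀ z z', ‖pb.thetaStar γ z - pb.thetaStar γ z'‖ ≤ Lθ L₂ γ * ‖z - z'‖) ∧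
      (∀ k, Differentiable ℝ (pb.Psi γ (I.μ k))) ∧
      (∀ k < K, Integrable (gradSq pb I ξf ξg k) P ∧ Integrable (consSq pb I ξf ξg k) P) ∧
      -- the size of the constant is controlled independently of the network and of `n`
      C₂ ≤ C * (initSize pb I Flow + δf ^ 2 + δg ^ 2) ∧
      -- stationarity
      1 / (K : ℝ) * ∑ k ∈ Finset.range K, ∫ ω, gradSq pb I ξf ξg k ω ∂P
        ≤ C * (C₂ / (√n * √K)) + C * (n * (δf ^ 2 + δg ^ 2) / ((1 - ρ) ^ 4 * K)) ∧
      -- consensus error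
      1 / (K : ℝ) * ∑ k ∈ Finset.range K, ∫ ω, consSq pb I ξf ξg k ω ∂P
        ≤ C * (C₂ / √K)
          + C * ((n : ℝ) ^ (3 / 2 : ℝ) * (δf ^ 2 + δg ^ 2) / ((1 - ρ) ^ 4 * K)) := by
  have hB := trackBounds hL₁ hL₂ hγ hμ₀ hcl
  set A := trackConst L₁ L₂ γ μ₀ cl
  have hA : 0 < A := by linarith [hB.one_le]
  have hA1 : 1 / (100 * A ^ 7) ≤ 1 := by
    rw [div_le_one (by positivity)]
    have := one_le_pow₀ hB.one_le (n := 7)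
    linarith
  -- `A` depends only on the smoothness data, γ, μ₀ and c_λ, so κ can be fixed before p and c_θ.
  refine ⟨1 / (100 * A ^ 7), by positivity, fun p hp cθ hcθ => ?_⟩
  set R₁ := 300 * A ^ 8 * lowerConst L₂ γ μ₀ cl (cθ ^ 2 * noiseConst μ₀ cl) / cθ
  set R₂ := 300 * A ^ 8 * noiseConst μ₀ cl * cθ ^ 2
  -- One constant serves the two coefficients of the rate and the bound of C₂; the entry 1 secures
  -- positivity.
  set C := max (max R₁ R₂) (max (upperConst L₁ L₂ γ μ₀ cl) 1)
  have hC1 : R₁ ≤ C := (le_max_left _ _).trans (le_max_left _ _)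
  have hC2 : R₂ ≤ C := (le_max_right _ _).trans (le_max_left _ _)
  have hC3 : upperConst L₁ L₂ γ μ₀ cl ≤ C := (le_max_left _ _).trans (le_max_right _ _)
  have hC4 : 1 ≤ C := (le_max_right _ _).trans (le_max_right _ _)
  have hC0 : 0 < C := by linarith
  refine ⟨C, hC0, ?_⟩
  intro n dx dy Ξf Ξg Ω _ _ _ P _ pb ξf ξg W ρ δf δg Flow θ₀ x₀ y₀ K hn hK _ _ hs hlow hf hg hsam hW
    hκ I hI C₂ hC₂
  have hreg : Regular pb L₁ L₂ γ μ₀ cl Flow :=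
    ⟨hn, hL₁, hL₂, hγ, hμ₀, hcl, c_mul_le_of_le hL₂ (eta_pos hL₂ hγ) hcl', hs, hlow⟩
  obtain ⟨h, hμ⟩ := isRun_input (θ₀ := θ₀) (x₀ := x₀) (y₀ := y₀) hreg hf hg hsam hW hp.1
    (by linarith [hp.2]) hcθ hK
  have hγI : I.γ = γ := by rw [hI]; rfl
  rw [← hI] at h hμ
  have hβ : 0 < 1 - ρ := by have := hW.rho_lt; linarith
  have hrate := h.average_le hμ (by rw [hγI]; exact hB) hκ hK hcθ rfl
  have hC20 := h.C2_nonneg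
  have hup := h.C2_le (hκ.trans (mul_le_of_le_one_left (by positivity) hA1))
  rw [hγI, ← hC₂] at hrate hup
  rw [← hC₂] at hC20
  have hK' : (0 : ℝ) < K := by exact_mod_cast hK
  have hn1 : (1 : ℝ) ≤ n := by exact_mod_cast hn
  have hsn : 1 ≤ √(n : ℝ) := Real.one_le_sqrt.mpr hn1
  have hσ : 0 ≤ δf ^ 2 + δg ^ 2 := by positivity
  have hrate' := hrate.trans (add_le_add
    (mul_le_mul_of_nonneg_right hC1 (by positivity : 0 ≤ C₂ / (√(n : ℝ) * √(K : ℝ))))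
    (mul_le_mul_of_nonneg_right hC2
      (by positivity : 0 ≤ n * (δf ^ 2 + δg ^ 2) / ((1 - ρ) ^ 4 * K))))
  have hS0 : 0 ≤ ∑ k ∈ Finset.range K, expStat pb I P ξf ξg k :=
    Finset.sum_nonneg fun k _ => expStat_nonneg k
  have hX0 : 0 ≤ ∑ k ∈ Finset.range K, expSpread pb I P ξf ξg k :=
    Finset.sum_nonneg fun k _ => expSpread_nonneg k
  refine ⟨fun z θ => hs.isMinOn_iff hn hL₂ hγ z θ, fun z z' => hs.thetaStar_lipschitz hn hL₂ hγ z z',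
    fun k => (hs.quadApprox_Psi hn hL₁ hL₂ hγ (I.μ k)).differentiable,
    fun k _ => ⟨(h.integrable_gradSq k).1, ?_⟩, ?_, ?_, ?_⟩
  · rw [consSq_eq]
    exact h.integrable_spread_point k
  · refine hup.trans (mul_le_mul_of_nonneg_right hC3 ?_)
    have := h.initSize_nonneg
    positivity
  · refine le_trans ?_ hrate'
    refine mul_le_mul_of_nonneg_left ?_ (by positivity)
    -- Stationarity and consensus errors are bounded jointly; each claim drops the nonnegative sum
    -- of the other.
    exact (Finset.sum_le_sum fun k _ => (h.integrable_gradSq k).2).trans (le_add_of_nonneg_right hX0)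
  · have e : ∑ k ∈ Finset.range K, ∫ ω, consSq pb I ξf ξg k ω ∂P
        = ∑ k ∈ Finset.range K, expSpread pb I P ξf ξg k :=
      Finset.sum_congr rfl fun k _ => by rw [consSq_eq]; rfl
    rw [e]
    refine (mul_le_mul_of_nonneg_left (le_add_of_nonneg_left hS0) (by positivity)).trans
      (hrate'.trans ?_)
    -- The joint bound is √n times stronger than the consensus claim in both of its terms, so n ≥ 1
    -- is enough.
    have hpow : (n : ℝ) ≤ (n : ℝ) ^ (3 / 2 : ℝ) := by
      have := Real.rpow_le_rpow_of_exponent_le hn1 (by norm_num : (1 : ℝ) ≤ 3 / 2)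
      rwa [Real.rpow_one] at this
    have hden : √(K : ℝ) ≤ √(n : ℝ) * √(K : ℝ) := le_mul_of_one_le_left (by positivity) hsn
    have hsK : 0 < √(K : ℝ) := Real.sqrt_pos.mpr hK'
    gcongr
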